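/- **Setting.** Let $\mu$ be the white noise measure on $S'(\mathbb R)$, i.e. the probability measure with $\int e^{i\langle\omega,\xi\rangle}\,d\mu(\omega)=e^{-\frac12|\xi|^2_{L^2(\mathbb R)}}$ for $\xi\in S(\mathbb R)$. Let $I_n$ be the $n$-fold Wiener integral on the symmetric functions $\widehat{L}^2(\mathbb R^n)$. For $l\in\mathbb R$ and a (formal) chaos expansion $\Phi=\sum_n I_n(\Phi^{(n)})$ with $\Phi^{(n)}\in\widehat L^2(\mathbb R^n)$ put $\|\Phi\|_l^2=\sum_n n!\,e^{2ln}|\Phi^{(n)}|^2_{L^2(\mathbb R^n)}$. Let $\mathcal G$ be the space of $\phi\in L^2(\mu)$ with $\|\phi\|_l<\infty$ for all $l>0$, and $\mathcal G^*$ the space of all $\Phi$ with $\|\Phi\|_{-l}<\infty$ for some $l>0$. They are paired by $\langle\langle\Phi,\phi\rangle\rangle=\sum_n n!\,(\Phi^{(n)},\phi^{(n)})_{L^2(\mathbb R^n)}$. For $\phi\in\mathcal G$, $\Phi\in\mathcal G^*$ the product $\phi\cdot\Phi\in\mathcal G^*$ is given by $\langle\langle\phi\cdot\Phi,\psi\rangle\rangle=\langle\langle\Phi,\psi\phi\rangle\rangle$,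 $\psi\in\mathcal G$, with $\psi\phi$ the pointwise product. **Derivative.** For $h\in L^2(\mathbb R)$ let $D_h\Phi=\sum_{n\ge1} n\,I_{n-1}\big(\int_{\mathbb R} h(r)\Phi^{(n)}(\cdot,r)\,dr\big)$. Fix $\theta\in[0,1]$. The stochastic derivative of $\Phi\in\mathcal G^*$ is $D_t\Phi=\sum_{n\ge1} n\,I_{n-1}(\Phi^{(n)}(\cdot,t))$, where the value at $t$ is understood as the limit of averages: $D_t\Phi$ is the element of $\mathcal G^*$ with $\langle\langle D_t\Phi,\psi\rangle\rangle=\lim_{\varepsilon\downarrow0}\langle\langle D_{h_\varepsilon}\Phi,\psi\rangle\rangle$ for all $\psi\in\mathcal G$, $h_\varepsilon=\varepsilon^{-1}\mathbf 1_{[t-\theta\varepsilon,\,t+(1-\theta)\varepsilon]}$, if it exists. (For fixed $\Phi$ this agrees for almost every $t$ with the kernel formula.) **Integrals.** A process $\Psi$ is Pettis-integrable with integral $I\in\mathcal G^*$ if for all $\psi\in\mathcal G$ the function $\langle\langle\Psi,\psi\rangle\rangle$ is integrable with integral $\langle\langle I,\psi\rangle\rangle$. The Skorohod integral $\int_0^t\Psi(s)\,\delta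 B(s)$ is $\sum_n I_{n+1}(\widehat F_n)\in\mathcal G^*$, where $\widehat F_n$ is the symmetrization of $F_n(x,s)=\mathbf 1_{[0,t]}(s)\Psi(s)^{(n)}(x)\in L^2(\mathbb R^{n+1})$. Let $T\in\mathbb R$, $g$ a real function of two real variables, $\sigma(s)\in\mathcal G$ for all $s$, and $\Phi(s)\in\mathcal G^*$ for all $s$. Put $$\mathcal K_g(\Phi)(t,s)=\Phi(s)g(t,s)+\int_s^t(\Phi(u)-\Phi(s))\,g(du,s),$$ a Pettis--Stieltjes integral, where $u\mapsto g(u,s)$ has bounded variation on $[u_0,t]$ for every $u_0\in(s,t)$. With $X_1(t)=\int_0^tg(t,s)\,dB(s)$ and $X_\sigma(t)=\int_0^tg(t,s)\sigma(s)\,dB(s)$ define $$\int_0^t\Phi(s)\,dX_\sigma(s)=\int_0^t\sigma(s)\cdot\mathcal K_g(\Phi)(t,s)\,\delta B(s)+\int_0^t\sigma(s)\cdot D_s\{\mathcal K_g(\Phi)(t,s)\}\,ds$$ (Skorohod and Pettis integral), and $\int_0^t\Phi\,dX_1$ by the same formula without the factors $\sigma(s)$. Call $\Phi$ $dX_\sigma$-integrable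 on $[0,T]$ if for every $t\in[0,T]$: $\mathcal K_g(\Phi)(t,s)$ and $D_s\{\mathcal K_g(\Phi)(t,s)\}$ exist in $\mathcal G^*$ for almost every $s\in[0,t]$; $s\mapsto\sigma(s)\cdot\mathcal K_g(\Phi)(t,s)$ is weakly measurable with $\int_0^t\|\sigma(s)\cdot\mathcal K_g(\Phi)(t,s)\|_{-l}^2\,ds<\infty$ for some $l>0$; and the Skorohod and Pettis integrals exist in $\mathcal G^*$. $dX_1$-integrability is the same without the factors $\sigma(s)$. **Theorem.** Let $\phi\in\mathcal G$, $*\in\{1,\sigma\}$, and let $\Phi$ be $dX_*$-integrable on $[0,T]$. Then $\phi\cdot\Phi$ is $dX_*$-integrable on $[0,T]$, and for every $t\in[0,T]$ $$\int_0^t\phi\cdot\Phi(s)\,dX_*(s)=\phi\cdot\int_0^t\Phi(s)\,dX_*(s).$$ -/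

import Mathlib

open MeasureTheory Filter Topology Set
open scoped ENNReal SchwartzMap

noncomputable section

namespace WhiteNoise

/-! ### The white noise probability space -/

/-- The space `S'(ℝ)` of (real) tempered distributions. -/
def TemperedDist : Type := 𝓢(ℝ, ℝ) →L[ℝ] ℝ

/-- The canonical pairing `⟨ω, ξ⟩` of a tempered distribution and a Schwartz function. -/
def TemperedDist.eval (ω : TemperedDist) (ξ : 𝓢(ℝ, ℝ)) : ℝ :=
  (show 𝓢(ℝ, ℝ) →L[ℝ] ℝ from ω) ξ

/-- The Borel `σ`-field of `S'(ℝ)`, which is generated by the evaluations `ω ↦ ⟨ω, ξ⟩`. -/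
instance : MeasurableSpace TemperedDist :=
  ⨆ ξ : 𝓢(ℝ, ℝ), MeasurableSpace.comap (fun ω => TemperedDist.eval ω ξ) inferInstance

/-- `μ` is the white noise measure: its characteristic functional is `exp (-|ξ|² / 2)`. -/
def IsWhiteNoiseMeasure (μ : Measure TemperedDist) : Prop :=
  ∀ ξ : 𝓢(ℝ, ℝ), ∫ ω, Complex.exp (Complex.I * (ω.eval ξ : ℂ)) ∂μ
    = Complex.exp (-(1 / 2 : ℂ) * ((∫ x, ξ x ^ 2 : ℝ) : ℂ))

/-! ### Symmetric kernels -/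

/-- `L²(ℝⁿ)`, real-valued. -/
abbrev KernelL2 (n : ℕ) : Type := Lp ℝ 2 (volume : Measure (Fin n → ℝ))

theorem measurePreserving_perm {n : ℕ} (π : Equiv.Perm (Fin n)) :
    MeasurePreserving (fun (x : Fin n → ℝ) i => x (π i)) volume volume := by
  have h := volume_measurePreserving_piCongrLeft (fun _ : Fin n => ℝ) π.symm
  convert h using 1
  funext x i
  obtain ⟨j, rfl⟩ := π.symm.surjective i
  rw [MeasurableEquiv.coe_piCongrLeft, Equiv.piCongrLeft_apply_apply]
  simp

/-- The symmetric functions in `L²(ℝⁿ)`: those invariant under permutations of coordinates. -/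
def symL2 (n : ℕ) : Submodule ℝ (KernelL2 n) :=
  ⨅ π : Equiv.Perm (Fin n),
    LinearMap.eqLocus (Lp.compMeasurePreservingₗ ℝ _ (measurePreserving_perm π)) LinearMap.id

/-- Sequences of symmetric kernels, that is, formal chaos expansions `∑ Iₙ(Φ⁽ⁿ⁾)`. -/
abbrev ChaosSeq : Type := ∀ n : ℕ, symL2 n

/-- The squared norm `‖Φ‖_l² = ∑ n! e^{2ln} |Φ⁽ⁿ⁾|²` in `[0, ∞]`, for `l ∈ ℝ`. -/
def normSq (l : ℝ) (Φ : ChaosSeq) : ℝ≥0∞ :=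
  ∑' n : ℕ, ENNReal.ofReal (n.factorial * Real.exp (2 * l * n) * ‖Φ n‖ ^ 2)

theorem normSq_mono {l l' : ℝ} (h : l ≤ l') (Φ : ChaosSeq) : normSq l Φ ≤ normSq l' Φ := by
  unfold normSq
  gcongr

theorem normSq_add_le (l : ℝ) (Φ Ψ : ChaosSeq) :
    normSq l (Φ + Ψ) ≤ 2 * normSq l Φ + 2 * normSq l Ψ := by
  unfold normSq
  rw [← ENNReal.tsum_mul_left, ← ENNReal.tsum_mul_left, ← ENNReal.tsum_add]
  refine ENNReal.tsum_le_tsum fun n => ?_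
  have h2 : ∀ x : ℝ, (2 : ℝ≥0∞) * ENNReal.ofReal x = ENNReal.ofReal (2 * x) := fun x => by
    rw [ENNReal.ofReal_mul (by norm_num), ENNReal.ofReal_ofNat]
  rw [h2, h2, ← ENNReal.ofReal_add (by positivity) (by positivity)]
  apply ENNReal.ofReal_le_ofReal
  have h1 : ‖(Φ + Ψ) n‖ ≤ ‖Φ n‖ + ‖Ψ n‖ := norm_add_le _ _
  have h3 : ‖(Φ + Ψ) n‖ ^ 2 ≤ 2 * ‖Φ n‖ ^ 2 + 2 * ‖Ψ n‖ ^ 2 := by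
    nlinarith [norm_nonneg ((Φ + Ψ) n), sq_nonneg (‖Φ n‖ - ‖Ψ n‖)]
  have h4 : (0 : ℝ) ≤ n.factorial * Real.exp (2 * l * n) := by positivity
  nlinarith [mul_le_mul_of_nonneg_left h3 h4]

theorem normSq_smul (l c : ℝ) (Φ : ChaosSeq) :
    normSq l (c • Φ) = ENNReal.ofReal (c ^ 2) * normSq l Φ := by
  unfold normSq
  rw [← ENNReal.tsum_mul_left]
  refine tsum_congr fun n => ?_
  rw [← ENNReal.ofReal_mul (sq_nonneg c)]
  congr 1
  rw [Pi.smul_apply, norm_smul, mul_pow, Real.norm_eq_abs, sq_abs]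
  ring

/-- The space `𝒢*` of generalized random variables: the union of the `𝒢_{-l}`, `l > 0`, where
`𝒢_{-l}` consists of the (formal) chaos expansions of finite norm `‖·‖_{-l}`. -/
def GStar : Submodule ℝ ChaosSeq where
  carrier := {Φ | ∃ l : ℝ, 0 < l ∧ normSq (-l) Φ < ∞}
  zero_mem' := ⟨1, one_pos, by simp [normSq]⟩
  add_mem' := by
    rintro Φ Ψ ⟨l, hl, h⟩ ⟨l', hl', h'⟩
    refine ⟨max l l', lt_max_of_lt_left hl, (normSq_add_le _ _ _).trans_lt ?_⟩
    refine ENNReal.add_lt_top.2 ⟨ENNReal.mul_lt_top (by simp) ?_, ENNReal.mul_lt_top (by simp) ?_⟩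
    · exact (normSq_mono (neg_le_neg (le_max_left l l')) Φ).trans_lt h
    · exact (normSq_mono (neg_le_neg (le_max_right l l')) Ψ).trans_lt h'
  smul_mem' := by
    rintro c Φ ⟨l, hl, h⟩
    refine ⟨l, hl, ?_⟩
    rw [normSq_smul]
    exact ENNReal.mul_lt_top ENNReal.ofReal_lt_top h

/-! ### Multiple Wiener integrals, test random variables -/

/-- The pairs `(ξ^{⊗n}, Iₙ(ξ^{⊗n}))`, `ξ ∈ S(ℝ)`, where `Iₙ(ξ^{⊗n})` is the random variable
`|ξ|ⁿ Heₙ(⟨·, ξ⟩ / |ξ|)`, with `Heₙ` the (monic, probabilists') Hermite polynomial. -/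
def wienerGenerators (μ : Measure TemperedDist) (n : ℕ) : Set (KernelL2 n × Lp ℝ 2 μ) :=
  {p | ∃ ξ : 𝓢(ℝ, ℝ),
    (p.1 =ᵐ[volume] fun x => ∏ i, ξ (x i)) ∧
    (p.2 =ᵐ[μ] fun ω => Real.sqrt (∫ x, ξ x ^ 2) ^ n *
      Polynomial.aeval (ω.eval ξ / Real.sqrt (∫ x, ξ x ^ 2)) (Polynomial.hermite n))}

/-- The graph of the `n`-fold Wiener integral `Iₙ`, on symmetric kernels: `Iₙ` is the extension
by linearity and `L²`-continuity from the powers `ξ^{⊗n}`. -/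
def wienerGraph (μ : Measure TemperedDist) (n : ℕ) : Submodule ℝ (KernelL2 n × Lp ℝ 2 μ) :=
  (Submodule.span ℝ (wienerGenerators μ n)).topologicalClosure

/-- `X = ∑ Iₙ(f⁽ⁿ⁾)` in `L²(μ)`. -/
def HasChaosExpansion (μ : Measure TemperedDist) (f : ChaosSeq) (X : Lp ℝ 2 μ) : Prop :=
  ∃ Y : ℕ → Lp ℝ 2 μ, (∀ n, ((f n : KernelL2 n), Y n) ∈ wienerGraph μ n) ∧ HasSum Y X

/-- The space `𝒢` of test random variables: the square-integrable random variables whose kernels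
have finite norm `‖·‖_l` for every `l > 0`. -/
structure TestRV (μ : Measure TemperedDist) where
  /-- the random variable -/
  toLp : Lp ℝ 2 μ
  /-- the kernels of its chaos expansion -/
  kernel : ChaosSeq
  hasChaosExpansion : HasChaosExpansion μ kernel toLp
  normSq_lt_top : ∀ l : ℝ, 0 < l → normSq l kernel < ∞

variable {μ : Measure TemperedDist}

/-- The bilinear pairing `⟪Φ, ψ⟫ = ∑ n! (Φ⁽ⁿ⁾, ψ⁽ⁿ⁾)` of `𝒢*` and `𝒢`. -/
def pairing (Φ : GStar) (ψ : TestRV μ) : ℝ :=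
  ∑' n : ℕ, (n.factorial : ℝ) * inner ℝ (Φ.1 n) (ψ.kernel n)

/-- `Ξ = φ · Φ`, that is `⟪Ξ, ψ⟫ = ⟪Φ, ψ · φ⟫` for all `ψ ∈ 𝒢`, where `ψ · φ ∈ 𝒢` is the
pointwise product of random variables. -/
def IsProduct (φ : TestRV μ) (Φ Ξ : GStar) : Prop :=
  ∀ ψ : TestRV μ, ∃ χ : TestRV μ, (χ.toLp =ᵐ[μ] fun ω => ψ.toLp ω * φ.toLp ω) ∧
    pairing Ξ ψ = pairing Φ χ

open Classical in
/-- The product `φ · Φ ∈ 𝒢*` of a test and a generalized random variable. -/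
def testMul (φ : TestRV μ) (Φ : GStar) : GStar :=
  if h : ∃ Ξ, IsProduct φ Φ Ξ then h.choose else 0

/-! ### The stochastic derivative -/

/-- `⟪D_h Φ, ψ⟫`, where `D_h Φ = ∑ n Iₙ₋₁((h, Φ⁽ⁿ⁾))` is the derivative of `Φ` in the direction
`h ∈ L²(ℝ)` and `(h, f)(u) = ∫ h(r) f(u, r) dr`. -/
def dirDerivPairing (h : ℝ → ℝ) (Φ : GStar) (ψ : TestRV μ) : ℝ :=
  ∑' n : ℕ, (n.factorial : ℝ) * ∫ u : Fin n → ℝ,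
    ((n + 1 : ℝ) * ∫ r : ℝ, h r * (Φ.1 (n + 1) : KernelL2 (n + 1)) (Fin.snoc u r)) *
      (ψ.kernel n : KernelL2 n) u

/-- The uniform probability density on the window `[t - θε, t + (1 - θ)ε]` at `t`. -/
def window (θ t ε : ℝ) : ℝ → ℝ :=
  Set.indicator (Set.Icc (t - θ * ε) (t + (1 - θ) * ε)) fun _ => ε⁻¹

/-- `Ξ` is the stochastic derivative `D_t Φ`.

The kernels `n Φ⁽ⁿ⁾(·, t)` of `D_t Φ` are sections of `L²`-classes, so by themselves they are
determined only for almost every `t`. The value at the given point `t` is the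
Lebesgue value of `r ↦ D_r Φ` at `t`, that is, the weak limit in `𝒢*` of the averages of
`D_r Φ` over `[t - θε, t + (1 - θ)ε]` as `ε ↓ 0`; the average of `D_r Φ` with weight `h` is
`D_h Φ`. For almost every `t` it exists and has the kernels
`n Φ⁽ⁿ⁾(·, t)`, whatever `θ ∈ [0, 1]` is. -/
def HasStochDeriv (μ : Measure TemperedDist) (θ t : ℝ) (Φ Ξ : GStar) : Prop :=
  ∀ ψ : TestRV μ,
    Tendsto (fun ε : ℝ => dirDerivPairing (window θ t ε) Φ ψ) (𝓝[>] 0) (𝓝 (pairing Ξ ψ))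

/-! ### Pettis and Skorohod integrals -/

/-- `Ψ` is Pettis-integrable on `[0, t]` with `∫₀ᵗ Ψ(s) ds = I ∈ 𝒢*`. -/
def HasPettisIntegral (μ : Measure TemperedDist) (Ψ : ℝ → GStar) (t : ℝ) (I : GStar) : Prop :=
  ∀ ψ : TestRV μ, IntegrableOn (fun s => pairing (Ψ s) ψ) (Icc 0 t) ∧
    pairing I ψ = ∫ s in Icc 0 t, pairing (Ψ s) ψ

/-- `Ψ` is Skorohod-integrable on `[0, t]` with `∫₀ᵗ Ψ(s) δB(s) = J ∈ 𝒢*`: the zeroth kernel of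
`J` vanishes and the `(n+1)`-st one is the symmetrization in all `n + 1` variables of
`F(x, s) = 1_{[0,t]}(s) Ψ(s)⁽ⁿ⁾(x)`. -/
def HasSkorohodIntegral (Ψ : ℝ → GStar) (t : ℝ) (J : GStar) : Prop :=
  J.1 0 = 0 ∧ ∀ n : ℕ, ∃ F : KernelL2 (n + 1),
    (∀ᵐ s : ℝ, (fun x : Fin n → ℝ => F (Fin.snoc x s)) =ᵐ[volume]
      fun x => (Icc (0 : ℝ) t).indicator (fun r => ((Ψ r).1 n : KernelL2 n) x) s) ∧
    ((J.1 (n + 1) : KernelL2 (n + 1)) =ᵐ[volume]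
      fun y => ((n + 1).factorial : ℝ)⁻¹ * ∑ π : Equiv.Perm (Fin (n + 1)), F fun i => y (π i))

/-- `f` on `[a, t]`, extended to `ℝ` by constants. -/
def clamp (f : ℝ → ℝ) (a t : ℝ) : ℝ → ℝ := fun u => f (max a (min u t))

open Classical in
/-- The positive (`sgn = true`) and negative (`sgn = false`) parts in the Jordan decomposition of
the Lebesgue--Stieltjes measure of `f` on `(a, t]`. -/
def stieltjesPart (sgn : Bool) (f : ℝ → ℝ) (a t : ℝ) : Measure ℝ :=
  if h : BoundedVariationOn (clamp f a t) univ then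
    let j := SignedMeasure.toJordanDecomposition h.vectorMeasure
    (if sgn then j.posPart else j.negPart).restrict (Ioc a t)
  else 0

/-- The positive and negative parts of the Lebesgue--Stieltjes measure `df` on `(s, t]`, when `f`
has bounded variation on `[a, t]` for all `a ∈ (s, t)`, but possibly not on `(s, t]`. -/
def stieltjesMeasure (sgn : Bool) (f : ℝ → ℝ) (s t : ℝ) : Measure ℝ :=
  ⨆ k : ℕ, stieltjesPart sgn f (s + 1 / ((k : ℝ) + 1)) t

/-- `Ψ` is Pettis--Stieltjes-integrable with respect to `df` on `[s, t]`, with integral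
`I ∈ 𝒢*`. (It is applied to `Ψ` with `Ψ(s) = 0`, so the left end point is immaterial.) -/
def HasPettisStieltjes (μ : Measure TemperedDist) (f : ℝ → ℝ) (s t : ℝ) (Ψ : ℝ → GStar)
    (I : GStar) : Prop :=
  LocallyBoundedVariationOn f (Ioc s t) ∧ ∀ ψ : TestRV μ,
    (∀ sgn : Bool, Integrable (fun u => pairing (Ψ u) ψ) (stieltjesMeasure sgn f s t)) ∧
    pairing I ψ = (∫ u, pairing (Ψ u) ψ ∂(stieltjesMeasure true f s t)) -
      ∫ u, pairing (Ψ u) ψ ∂(stieltjesMeasure false f s t)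

/-! ### The integrals with respect to Volterra processes -/

/-- `K = 𝒦_g(Φ)(t, s) = Φ(s) g(t, s) + ∫_s^t (Φ(u) - Φ(s)) g(du, s)`. -/
def HasKernelOp (μ : Measure TemperedDist) (g : ℝ → ℝ → ℝ) (Φ : ℝ → GStar) (t s : ℝ)
    (K : GStar) : Prop :=
  ∃ I : GStar, HasPettisStieltjes μ (fun u => g u s) s t (fun u => Φ u - Φ s) I ∧
    K = g t s • Φ s + I

/-- `I = ∫₀ᵗ m(s)[𝒦_g(Φ)(t, s)] δB(s) + ∫₀ᵗ m(s)[D_s 𝒦_g(Φ)(t, s)] ds`, all of whose terms exist;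
the Skorohod integrand has a square-integrable norm `‖·‖_{-l}` for some `l > 0`.
Here `m(s)` is the volatility modulation: the identity, or multiplication by `σ(s)`. -/
def HasVolterraIntegral (μ : Measure TemperedDist) (θ : ℝ) (g : ℝ → ℝ → ℝ)
    (m : ℝ → GStar → GStar) (Φ : ℝ → GStar) (t : ℝ) (I : GStar) : Prop :=
  ∃ (K DK : ℝ → GStar) (J P : GStar),
    (∀ᵐ s ∂(volume.restrict (Icc 0 t)), HasKernelOp μ g Φ t s (K s)) ∧
    (∀ᵐ s ∂(volume.restrict (Icc 0 t)), HasStochDeriv μ θ s (K s) (DK s)) ∧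
    (∀ ψ : TestRV μ, AEMeasurable (fun s => pairing (m s (K s)) ψ) (volume.restrict (Icc 0 t))) ∧
    (∃ l : ℝ, 0 < l ∧ ∫⁻ s in Icc 0 t, normSq (-l) (m s (K s)).1 < ∞) ∧
    HasSkorohodIntegral (fun s => m s (K s)) t J ∧
    HasPettisIntegral μ (fun s => m s (DK s)) t P ∧
    I = J + P

/-- Integrability on `[0, T]`: the integral over `[0, t]` exists for every `t ∈ [0, T]`. -/
def VolterraIntegrable (μ : Measure TemperedDist) (θ : ℝ) (g : ℝ → ℝ → ℝ)
    (m : ℝ → GStar → GStar) (Φ : ℝ → GStar) (T : ℝ) : Prop :=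
  ∀ t ∈ Icc 0 T, ∃ I, HasVolterraIntegral μ θ g m Φ t I

open Classical in
/-- The value of the integral over `[0, t]` (zero when it does not exist). -/
def volterraIntegral (μ : Measure TemperedDist) (θ : ℝ) (g : ℝ → ℝ → ℝ)
    (m : ℝ → GStar → GStar) (Φ : ℝ → GStar) (t : ℝ) : GStar :=
  if h : ∃ I, HasVolterraIntegral μ θ g m Φ t I then h.choose else 0

/-- `Φ` is `dX₁`-integrable on `[0, T]`, where `X₁(t) = ∫₀ᵗ g(t, s) dB(s)`. -/
def IntegrableX1 (μ : Measure TemperedDist) (θ : ℝ) (g : ℝ → ℝ → ℝ) (Φ : ℝ → GStar)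
    (T : ℝ) : Prop :=
  VolterraIntegrable μ θ g (fun _ Ψ => Ψ) Φ T

/-- `∫₀ᵗ Φ(s) dX₁(s)`. -/
def integralX1 (μ : Measure TemperedDist) (θ : ℝ) (g : ℝ → ℝ → ℝ) (Φ : ℝ → GStar)
    (t : ℝ) : GStar :=
  volterraIntegral μ θ g (fun _ Ψ => Ψ) Φ t

/-- `Φ` is `dX_σ`-integrable on `[0, T]`, where `X_σ(t) = ∫₀ᵗ g(t, s) σ(s) dB(s)`. -/
def IntegrableXσ (μ : Measure TemperedDist) (θ : ℝ) (g : ℝ → ℝ → ℝ) (σ : ℝ → TestRV μ)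
    (Φ : ℝ → GStar) (T : ℝ) : Prop :=
  VolterraIntegrable μ θ g (fun s Ψ => testMul (σ s) Ψ) Φ T

/-- `∫₀ᵗ Φ(s) dX_σ(s)`. -/
def integralXσ (μ : Measure TemperedDist) (θ : ℝ) (g : ℝ → ℝ → ℝ) (σ : ℝ → TestRV μ)
    (Φ : ℝ → GStar) (t : ℝ) : GStar :=
  volterraIntegral μ θ g (fun s Ψ => testMul (σ s) Ψ) Φ t

end WhiteNoise

end

open WhiteNoise

open MeasureTheory Filter Topology Set
open scoped ENNReal SchwartzMap

noncomputable section

namespace WhiteNoise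

/-! Multiplication by φ commutes with neither half of the integral, but the two defects cancel.
Write K(s) for 𝒦_g(Φ)(t, s). Testing with φψ in place of ψ gives 𝒦_g(φ·Φ)(t, s) = φ·K(s). The
stochastic derivative is a derivation, D_s(φ·K) = φ·D_sK + D_sφ·K, so the Pettis term gains ∫
σ(s)·D_sφ·K(s) ds. The Skorohod integral is the adjoint of the gradient, so φ·∫ Ψ δB = ∫ φ·Ψ δB + ∫
D_sφ·Ψ(s) ds; with Ψ = σ·K the Skorohod term loses the same amount, because multiplications by test
variables commute. The two rules are `hasStochDeriv_testMul` and `HasSkorohodIntegral.testMul`; they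
meet in `HasVolterraIntegral.testMul`.

The analysis is carried out with bounded operators on a single Fock space. An expansion of finite
norm ‖·‖_l is stored with its n-th kernel multiplied by √n! e^{ln}; then levels l and -l are dual
under the Fock inner product, and lowering the level is the contraction `scale`. Multiplication is
bounded from two factors at level l + 1 to level l ≥ 0 (`mulFock`), the gradient from level l + 1 to
L² functions with values at level l (`grad`); φ·Φ and the Skorohod integral are given by their
adjoints. The identities between these operators are linear and continuous in each argument, so they
need checking only on exponential functionals, whose span is dense at every level and for which
products, derivatives and inner products are explicit. The boundedness of multiplication is a Gram
matrix estimate for exponentials (`norm_sum_fexp_mul_le`).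

The point s and the variable K(s) vary together, so the product rule must hold for all K at once,
off a null set that depends on φ alone. For averages over a window it is an exact identity whose
extra term is an average of Dφ; this term converges at the Lebesgue points of the gradient of φ,
taken at countably many levels. -/

section

/-! ### Closed linear relations and weak measurability -/

section FunctionalAnalysis

variable {X Y : Type*} [NormedAddCommGroup X] [NormedSpace ℝ X] [NormedAddCommGroup Y]
  [NormedSpace ℝ Y]

/-- A closed single-valued linear relation that is bounded over a dense subspace is the graph of a
bounded operator. -/
theorem exists_clm_of_isClosed_graph [CompleteSpace Y] (R : Submodule ℝ (X × Y))
    (hR : IsClosed (R : Set (X × Y))) (hR0 : ∀ y, ((0 : X), y) ∈ R → y = 0) (C : ℝ)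
    (D : Submodule ℝ X) (hD : Dense (D : Set X))
    (h : ∀ x ∈ D, ∃ y, (x, y) ∈ R ∧ ‖y‖ ≤ C * ‖x‖) :
    ∃ T : X →L[ℝ] Y, ∀ x, (x, T x) ∈ R ∧ ‖T x‖ ≤ C * ‖x‖ := by
  choose! f hf hfC using h
  have huniq : ∀ x y y', (x, y) ∈ R → (x, y') ∈ R → y = y' := fun x y y' h1 h2 => by
    have := R.sub_mem h1 h2
    simp only [Prod.mk_sub_mk, sub_self] at this
    exact sub_eq_zero.1 (hR0 _ this)
  let f0 : D →ₗ[ℝ] Y :=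
    { toFun := fun x => f x
      map_add' := fun x y => huniq (x + y : X) _ _ (hf _ (D.add_mem x.2 y.2)) (by
        simpa using R.add_mem (hf x x.2) (hf y y.2))
      map_smul' := fun c x => huniq (c • x : X) _ _ (hf _ (D.smul_mem c x.2)) (by
        simpa using R.smul_mem c (hf x x.2)) }
  let f1 : D →L[ℝ] Y := f0.mkContinuous C fun x => hfC x x.2
  have hdr : DenseRange D.subtypeL := by
    have : range D.subtypeL = (D : Set X) := by ext; simp
    rw [DenseRange, this]; exact hD
  have hui : IsUniformInducing D.subtypeL := isUniformInducing_val _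
  refine ⟨f1.extend D.subtypeL, fun x => ?_⟩
  -- Membership in the relation and the norm bound are closed conditions on x, and both hold on the
  -- dense subspace.
  have hcl : IsClosed {x : X | (x, f1.extend D.subtypeL x) ∈ R ∧
      ‖f1.extend D.subtypeL x‖ ≤ C * ‖x‖} := by
    have hc := (f1.extend D.subtypeL).continuous
    exact IsClosed.inter (hR.preimage (continuous_id.prodMk hc))
      (isClosed_le hc.norm (continuous_const.mul continuous_norm))
  have hall := closure_minimal (s := (D : Set X)) (fun x hx => by
    have := f1.extend_eq hdr hui ⟨x, hx⟩
    simp only [Submodule.subtypeL_apply] at this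
    simp only [mem_ofPred_eq, this]
    exact ⟨hf x hx, hfC x hx⟩) hcl
  exact hall (hD x)

variable {E : Type*} [NormedAddCommGroup E] [InnerProductSpace ℝ E]

/-- Pettis' measurability theorem in a separable Hilbert space. -/
theorem aestronglyMeasurable_of_inner [TopologicalSpace.SeparableSpace E] {α : Type*}
    [MeasurableSpace α] {ν : Measure α} {f : α → E}
    (hf : ∀ v, AEMeasurable (fun a => inner ℝ v (f a)) ν) : AEStronglyMeasurable f ν := by
  -- The projections onto spans of finitely many members of a dense sequence are finite sums of
  -- measurable coordinates, and they converge pointwise to the identity.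
  let u := TopologicalSpace.denseSeq E
  let V : ℕ → Submodule ℝ E := fun n => Submodule.span ℝ (u '' Iic n)
  have hfin : ∀ n, FiniteDimensional ℝ (V n) := fun n =>
    FiniteDimensional.span_of_finite ℝ ((finite_Iic n).image u)
  have hmono : Monotone V := fun m n h => Submodule.span_mono (image_mono (Iic_subset_Iic.2 h))
  have htop : (⨆ n, V n).topologicalClosure = ⊤ := by
    rw [← Submodule.dense_iff_topologicalClosure_eq_top]
    refine (TopologicalSpace.denseRange_denseSeq E).mono ?_
    rintro _ ⟨n, rfl⟩
    exact (le_iSup V n) (Submodule.subset_span ⟨n, by simp, rfl⟩)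
  refine aestronglyMeasurable_of_tendsto_ae (u := atTop)
    (f := fun n a => (V n).starProjection (f a)) (fun n => ?_)
    (Eventually.of_forall fun a => ?_)
  · let b := stdOrthonormalBasis ℝ (V n)
    have : (fun a => (V n).starProjection (f a)) =
        fun a => ∑ i, (inner ℝ (b i : E) (f a)) • (b i : E) := by
      funext a
      rw [b.starProjection_eq_sum_rankOne]
      simp [InnerProductSpace.rankOne_apply]
    rw [this]
    exact Finset.aestronglyMeasurable_fun_sum _ fun i _ =>
      ((hf _).aestronglyMeasurable).smul_const _
  · exact Submodule.starProjection_tendsto_self V hmono (f a) htop.ge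

end FunctionalAnalysis

/-- The coefficients of an everywhere convergent power series are determined by its sum. -/
theorem coeff_eq_of_hasSum {a b : ℕ → ℝ} {F : ℝ → ℝ} (ha : ∀ t, HasSum (fun n => t ^ n * a n) (F t))
    (hb : ∀ t, HasSum (fun n => t ^ n * b n) (F t)) : a = b := by
  have key : ∀ c : ℕ → ℝ, (∀ t, HasSum (fun n => t ^ n * c n) (F t)) →
      HasFPowerSeriesAt F (FormalMultilinearSeries.ofScalars ℝ c) 0 := fun c hc => by
    rw [hasFPowerSeriesAt_iff]
    refine Eventually.of_forall fun z => ?_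
    simpa [FormalMultilinearSeries.coeff_ofScalars] using hc z
  have := (key a ha).eq_formalMultilinearSeries (key b hb)
  funext n
  have := congrArg (fun p => p.coeff n) this
  simpa [FormalMultilinearSeries.coeff_ofScalars] using this

/-! ### Square-integrable functions of two variables as vector-valued functions -/

section Curry

variable {α β : Type*} [MeasurableSpace α] [MeasurableSpace β] {μ : Measure α} {ν : Measure β}

instance : Fact ((2 : ℝ≥0∞) ≠ ∞) := ⟨by norm_num⟩

theorem integral_mul_eq_inner {f g : α → ℝ} {F G : Lp ℝ 2 μ} (hF : F =ᵐ[μ] f) (hG : G =ᵐ[μ] g) :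
    inner ℝ F G = ∫ a, f a * g a ∂μ := by
  rw [L2.inner_def]
  refine integral_congr_ae ?_
  filter_upwards [hF, hG] with a h1 h2
  simp [h1, h2, mul_comm]

theorem norm_sq_eq_integral (F : Lp ℝ 2 μ) : ‖F‖ ^ 2 = ∫ a, F a ^ 2 ∂μ := by
  rw [← real_inner_self_eq_norm_sq,
    integral_mul_eq_inner (EventuallyEq.refl _ _) (EventuallyEq.refl _ _)]
  simp [sq]

theorem norm_sq_eq_integral_norm_sq {E : Type*} [NormedAddCommGroup E] [InnerProductSpace ℝ E]
    (F : Lp E 2 μ) : ‖F‖ ^ 2 = ∫ a, ‖F a‖ ^ 2 ∂μ := by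
  rw [← real_inner_self_eq_norm_sq, L2.inner_def]
  simp

theorem memLp_prod_mul {f : α → ℝ} {g : β → ℝ} (hf : MemLp f 2 μ) (hg : MemLp g 2 ν) :
    MemLp (fun p : α × β => f p.1 * g p.2) 2 (μ.prod ν) := by
  refine (memLp_two_iff_integrable_sq (hf.1.comp_fst.mul hg.1.comp_snd)).2 ?_
  have := ((memLp_two_iff_integrable_sq hf.1).1 hf).mul_prod
    ((memLp_two_iff_integrable_sq hg.1).1 hg)
  refine this.congr (Eventually.of_forall fun p => ?_)
  simp [mul_pow]

variable [SFinite ν]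

variable [SFinite μ]

theorem memLp_two_section {f : α × β → ℝ} (hf : MemLp f 2 (μ.prod ν)) :
    ∀ᵐ s ∂μ, MemLp (fun x => f (s, x)) 2 ν := by
  have h1 := ((memLp_two_iff_integrable_sq hf.1).1 hf).prod_right_ae
  have h2 := hf.1.prodMk_left
  filter_upwards [h1, h2] with s hs1 hs2
  exact (memLp_two_iff_integrable_sq hs2).2 hs1

open Classical in
/-- The sections `f(s, ·)` of a function of two variables, as elements of `L²`. -/
def sectionLp (ν : Measure β) (f : α × β → ℝ) (s : α) : Lp ℝ 2 ν :=
  if h : MemLp (fun x => f (s, x)) 2 ν then h.toLp _ else 0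

theorem coeFn_sectionLp {f : α × β → ℝ} (hf : MemLp f 2 (μ.prod ν)) :
    ∀ᵐ s ∂μ, sectionLp ν f s =ᵐ[ν] fun x => f (s, x) := by
  filter_upwards [memLp_two_section hf] with s hs
  rw [sectionLp, dif_pos hs]
  exact hs.coeFn_toLp

/-- By Pettis' theorem only the inner products with a fixed v need to be measurable, and these are
parameter integrals covered by Fubini. -/
theorem aestronglyMeasurable_sectionLp [IsSeparable ν] {f : α × β → ℝ}
    (hf : MemLp f 2 (μ.prod ν)) : AEStronglyMeasurable (sectionLp ν f) μ := by
  refine aestronglyMeasurable_of_inner fun v => ?_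
  have h1 : AEStronglyMeasurable (fun p : α × β => v p.2 * f p) (μ.prod ν) :=
    ((Lp.aestronglyMeasurable v).comp_snd).mul hf.1
  refine (h1.integral_prod_right').aemeasurable.congr ?_
  filter_upwards [coeFn_sectionLp hf] with s hs
  exact (integral_mul_eq_inner (EventuallyEq.refl _ _) hs).symm

theorem norm_sq_sectionLp {f : α × β → ℝ} (hf : MemLp f 2 (μ.prod ν)) :
    ∀ᵐ s ∂μ, ‖sectionLp ν f s‖ ^ 2 = ∫ x, f (s, x) ^ 2 ∂ν := by
  filter_upwards [coeFn_sectionLp hf] with s hs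
  rw [norm_sq_eq_integral]
  refine integral_congr_ae ?_
  filter_upwards [hs] with x hx
  rw [hx]

theorem memLp_sectionLp [IsSeparable ν] {f : α × β → ℝ} (hf : MemLp f 2 (μ.prod ν)) :
    MemLp (sectionLp ν f) 2 μ := by
  have hm := aestronglyMeasurable_sectionLp hf
  have : MemLp (fun s => ‖sectionLp ν f s‖) 2 μ := by
    refine (memLp_two_iff_integrable_sq hm.norm).2 ?_
    refine ((memLp_two_iff_integrable_sq hf.1).1 hf).integral_prod_left.congr ?_
    filter_upwards [norm_sq_sectionLp hf] with s hs using hs.symm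
  exact (memLp_norm_iff hm).1 this

/-- The isometry `L²(μ ⊗ ν) → L²(μ; L²(ν))`. -/
def curryL2 [IsSeparable ν] : Lp ℝ 2 (μ.prod ν) →ₗᵢ[ℝ] Lp (Lp ℝ 2 ν) 2 μ where
  toFun F := (memLp_sectionLp (Lp.memLp F)).toLp _
  map_add' F G := by
    ext1
    filter_upwards [MemLp.coeFn_toLp (memLp_sectionLp (Lp.memLp (F + G))),
      Lp.coeFn_add ((memLp_sectionLp (Lp.memLp F)).toLp _) ((memLp_sectionLp (Lp.memLp G)).toLp _),
      MemLp.coeFn_toLp (memLp_sectionLp (Lp.memLp F)),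
      MemLp.coeFn_toLp (memLp_sectionLp (Lp.memLp G)), coeFn_sectionLp (Lp.memLp F),
      coeFn_sectionLp (Lp.memLp G), coeFn_sectionLp (Lp.memLp (F + G)),
      Measure.ae_ae_of_ae_prod (Lp.coeFn_add F G)] with s h1 h2 h3 h4 h5 h6 h7 h8
    rw [h1, h2, Pi.add_apply, h3, h4]
    ext1
    filter_upwards [h5, h6, h7, h8, Lp.coeFn_add (sectionLp ν F s) (sectionLp ν G s)]
      with x k5 k6 k7 k8 k9
    rw [k7, k9, Pi.add_apply, k5, k6, k8, Pi.add_apply]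
  map_smul' c F := by
    ext1
    filter_upwards [MemLp.coeFn_toLp (memLp_sectionLp (Lp.memLp (c • F))),
      Lp.coeFn_smul c ((memLp_sectionLp (Lp.memLp F)).toLp _),
      MemLp.coeFn_toLp (memLp_sectionLp (Lp.memLp F)), coeFn_sectionLp (Lp.memLp F),
      coeFn_sectionLp (Lp.memLp (c • F)),
      Measure.ae_ae_of_ae_prod (Lp.coeFn_smul c F)] with s h1 h2 h3 h5 h7 h8
    rw [h1, RingHom.id_apply, h2, Pi.smul_apply, h3]
    ext1
    filter_upwards [h5, h7, h8, Lp.coeFn_smul c (sectionLp ν F s)] with x k5 k7 k8 k9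
    rw [k7, k9, Pi.smul_apply, k5, k8, Pi.smul_apply]
  norm_map' F := by
    refine (pow_left_inj₀ (norm_nonneg _) (norm_nonneg _) two_ne_zero).1 ?_
    simp only [LinearMap.coe_mk, AddHom.coe_mk]
    rw [norm_sq_eq_integral_norm_sq, norm_sq_eq_integral, integral_prod]
    · refine integral_congr_ae ?_
      filter_upwards [MemLp.coeFn_toLp (memLp_sectionLp (Lp.memLp F)),
        norm_sq_sectionLp (Lp.memLp F)] with s h1 h2
      rw [h1, h2]
    · exact (memLp_two_iff_integrable_sq (Lp.memLp F).1).1 (Lp.memLp F)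

theorem coeFn_curryL2 [IsSeparable ν] (F : Lp ℝ 2 (μ.prod ν)) :
    ∀ᵐ s ∂μ, curryL2 F s =ᵐ[ν] fun x => F (s, x) := by
  filter_upwards [MemLp.coeFn_toLp (memLp_sectionLp (Lp.memLp F)), coeFn_sectionLp (Lp.memLp F)]
    with s h1 h2
  have h3 : curryL2 F s = sectionLp ν F s := h1
  rw [h3]; exact h2

/-- The range of an isometry of a complete space is closed, and it contains the functions 1_A(a) c,
which generate L²(μ; L²(ν)). -/
theorem curryL2_surjective [IsSeparable ν] :
    Function.Surjective (curryL2 : Lp ℝ 2 (μ.prod ν) →ₗᵢ[ℝ] Lp (Lp ℝ 2 ν) 2 μ) := by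
  intro K
  suffices h : K ∈ (curryL2 (μ := μ) (ν := ν)).toLinearMap.range from h
  induction K using Lp.induction (p := 2) ENNReal.ofNat_ne_top with
  | indicatorConst c hs hμs =>
    rename_i s
    have hm := memLp_prod_mul (memLp_indicator_const 2 hs (1 : ℝ) (Or.inr hμs.ne)) (Lp.memLp c)
    refine ⟨hm.toLp _, ?_⟩
    ext1
    filter_upwards [coeFn_curryL2 (hm.toLp _), Measure.ae_ae_of_ae_prod hm.coeFn_toLp,
      indicatorConstLp_coeFn (p := 2) (hs := hs) (hμs := hμs.ne) (c := c)] with a h1 h2 h3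
    simp only [LinearIsometry.coe_toLinearMap]
    rw [Lp.simpleFunc.coe_indicatorConst, h3]
    ext1
    filter_upwards [h1, h2, Lp.coeFn_zero ℝ 2 ν] with x k1 k2 k3
    rw [k1, k2]
    by_cases ha : a ∈ s
    · simp [ha]
    · simpa [ha] using k3.symm
  | add hf hg _ h1 h2 => exact Submodule.add_mem _ h1 h2
  | isClosed =>
    have : IsClosed (range (curryL2 (μ := μ) (ν := ν))) :=
      (curryL2 (μ := μ) (ν := ν)).isometry.isClosedEmbedding.isClosed_range
    convert this using 1
    ext; simp

end Curry

end

/-! ### Kernels of several variables: sections, tensor products, polarization -/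

section

theorem measurePreserving_snoc (n : ℕ) :
    MeasurePreserving (fun p : ℝ × (Fin n → ℝ) => (Fin.snoc p.2 p.1 : Fin (n + 1) → ℝ)) := by
  have h := (volume_preserving_piFinSuccAbove (fun _ : Fin (n + 1) => ℝ) (Fin.last n)).symm
  convert! h using 1
  funext p
  simp [MeasurableEquiv.piFinSuccAbove_symm_apply, Fin.insertNthEquiv, Fin.insertNth_last']

theorem measurePreserving_unsnoc (n : ℕ) :
    MeasurePreserving
      (fun x : Fin (n + 1) → ℝ => (x (Fin.last n), fun i : Fin n => x i.castSucc)) := by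
  have h := volume_preserving_piFinSuccAbove (fun _ : Fin (n + 1) => ℝ) (Fin.last n)
  convert! h using 1
  funext p
  simp [MeasurableEquiv.piFinSuccAbove_apply, Fin.insertNthEquiv]
  rfl

/-- The isometry of `L²(ℝⁿ⁺¹)` into `L²(ℝ; L²(ℝⁿ))` given by the sections in the last variable. -/
def kcurry (n : ℕ) : KernelL2 (n + 1) →ₗᵢ[ℝ] Lp (KernelL2 n) 2 (volume : Measure ℝ) :=
  (curryL2 (μ := (volume : Measure ℝ)) (ν := (volume : Measure (Fin n → ℝ)))).comp
    (Lp.compMeasurePreservingₗᵢ ℝ _ (measurePreserving_snoc n))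

theorem coeFn_kcurry {n : ℕ} (F : KernelL2 (n + 1)) :
    ∀ᵐ s : ℝ, kcurry n F s =ᵐ[volume] fun u => F (Fin.snoc u s) := by
  have h := Measure.ae_ae_of_ae_prod
    (Lp.coeFn_compMeasurePreserving F (measurePreserving_snoc n))
  filter_upwards [coeFn_curryL2 (Lp.compMeasurePreservingₗᵢ ℝ _ (measurePreserving_snoc n) F), h]
    with s h1 h2
  exact h1.trans h2

/-- Supplies the kernel F(x, s) that the Skorohod integral asks for, when only its sections in s are
at hand. -/
theorem kcurry_surjective (n : ℕ) : Function.Surjective (kcurry n) := by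
  refine curryL2_surjective.comp fun G => ?_
  refine ⟨Lp.compMeasurePreserving _ (measurePreserving_unsnoc n) G, ?_⟩
  ext1
  refine (Lp.coeFn_compMeasurePreserving _ (measurePreserving_snoc n)).trans ?_
  refine ((measurePreserving_snoc n).quasiMeasurePreserving.ae_eq_comp
    (Lp.coeFn_compMeasurePreserving G (measurePreserving_unsnoc n))).trans ?_
  refine Eventually.of_forall fun p => ?_
  simp

/-- The inclusion of `S(ℝ)` in `L²(ℝ)`. -/
def schwartzL2 : 𝓢(ℝ, ℝ) →L[ℝ] Lp ℝ 2 (volume : Measure ℝ) :=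
  SchwartzMap.toLpCLM ℝ ℝ 2 volume

theorem coeFn_schwartzL2 (ξ : 𝓢(ℝ, ℝ)) : schwartzL2 ξ =ᵐ[volume] ξ := ξ.coeFn_toLp 2 volume

theorem inner_schwartzL2 (ξ η : 𝓢(ℝ, ℝ)) :
    inner ℝ (schwartzL2 ξ) (schwartzL2 η) = ∫ x, ξ x * η x :=
  integral_mul_eq_inner (coeFn_schwartzL2 ξ) (coeFn_schwartzL2 η)

theorem norm_sq_schwartzL2 (ξ : 𝓢(ℝ, ℝ)) : ‖schwartzL2 ξ‖ ^ 2 = ∫ x, ξ x ^ 2 := by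
  rw [← real_inner_self_eq_norm_sq, inner_schwartzL2]
  simp [sq]

theorem memLp_tensor {n : ℕ} (ξ : Fin n → 𝓢(ℝ, ℝ)) :
    MemLp (fun x : Fin n → ℝ => ∏ i, ξ i (x i)) 2 volume := by
  have hc : Continuous fun x : Fin n → ℝ => ∏ i, ξ i (x i) :=
    continuous_finsetProd _ fun i _ => (ξ i).continuous.comp (continuous_apply i)
  refine (memLp_two_iff_integrable_sq hc.aestronglyMeasurable).2 ?_
  have := Integrable.fintype_prod (f := fun i => fun x : ℝ => ξ i x ^ 2)
    (μ := fun _ => volume) fun i =>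
      (memLp_two_iff_integrable_sq (ξ i).continuous.aestronglyMeasurable).1 ((ξ i).memLp 2)
  refine this.congr (Eventually.of_forall fun x => ?_)
  simp [Finset.prod_pow]

/-- The tensor product `ξ₁ ⊗ ⋯ ⊗ ξₙ` of Schwartz functions. -/
def tensor {n : ℕ} (ξ : Fin n → 𝓢(ℝ, ℝ)) : KernelL2 n := (memLp_tensor ξ).toLp _

theorem coeFn_tensor {n : ℕ} (ξ : Fin n → 𝓢(ℝ, ℝ)) :
    tensor ξ =ᵐ[volume] fun x => ∏ i, ξ i (x i) := (memLp_tensor ξ).coeFn_toLp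

theorem inner_tensor {n : ℕ} (ξ η : Fin n → 𝓢(ℝ, ℝ)) :
    inner ℝ (tensor ξ) (tensor η) = ∏ i, inner ℝ (schwartzL2 (ξ i)) (schwartzL2 (η i)) := by
  rw [integral_mul_eq_inner (coeFn_tensor ξ) (coeFn_tensor η)]
  simp_rw [inner_schwartzL2, ← Finset.prod_mul_distrib]
  exact integral_fintype_prod_volume_eq_prod (fun i => fun x : ℝ => ξ i x * η i x)

theorem mem_symL2_iff {n : ℕ} {f : KernelL2 n} : f ∈ symL2 n ↔
    ∀ π : Equiv.Perm (Fin n), Lp.compMeasurePreserving _ (measurePreserving_perm π) f = f := by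
  simp [symL2, Submodule.mem_iInf, LinearMap.mem_eqLocus, Lp.compMeasurePreservingₗ]

theorem compMeasurePreserving_perm_tensor {n : ℕ} (π : Equiv.Perm (Fin n))
    (ξ : Fin n → 𝓢(ℝ, ℝ)) :
    Lp.compMeasurePreserving _ (measurePreserving_perm π) (tensor ξ) =
      tensor fun i => ξ (π.symm i) := by
  ext1
  refine (Lp.coeFn_compMeasurePreserving _ _).trans ?_
  refine ((measurePreserving_perm π).quasiMeasurePreserving.ae_eq_comp (coeFn_tensor ξ)).trans ?_
  refine EventuallyEq.trans (Eventually.of_forall fun x => ?_) (coeFn_tensor _).symm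
  simp only [Function.comp]
  exact Fintype.prod_equiv π _ _ fun i => by simp

/-- The symmetric tensor power `ξ^{⊗n}`. -/
def tensorPow (n : ℕ) (ξ : 𝓢(ℝ, ℝ)) : symL2 n :=
  ⟨tensor fun _ => ξ, mem_symL2_iff.2 fun π => compMeasurePreserving_perm_tensor π _⟩

theorem inner_tensorPow (n : ℕ) (ξ η : 𝓢(ℝ, ℝ)) :
    inner ℝ (tensorPow n ξ) (tensorPow n η) = inner ℝ (schwartzL2 ξ) (schwartzL2 η) ^ n := by
  rw [Submodule.coe_inner]
  simp [tensorPow, inner_tensor]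

theorem kcurry_tensor {n : ℕ} (ξ : Fin (n + 1) → 𝓢(ℝ, ℝ)) :
    ∀ᵐ s : ℝ, kcurry n (tensor ξ) s = ξ (Fin.last n) s • tensor fun i : Fin n => ξ i.castSucc := by
  have h := Measure.ae_ae_of_ae_prod
    ((measurePreserving_snoc n).quasiMeasurePreserving.ae_eq_comp (coeFn_tensor ξ))
  filter_upwards [coeFn_kcurry (tensor ξ), h] with s h1 h2
  ext1
  filter_upwards [h1, h2, coeFn_tensor fun i : Fin n => ξ i.castSucc,
    Lp.coeFn_smul (ξ (Fin.last n) s) (tensor fun i : Fin n => ξ i.castSucc)] with u k1 k2 k3 k4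
  rw [k1, k4, Pi.smul_apply, k3]
  simp only [Function.comp] at k2
  rw [k2, Fin.prod_univ_castSucc]
  simp [mul_comm]

theorem eq_zero_of_inner_schwartzL2 {f : Lp ℝ 2 (volume : Measure ℝ)}
    (h : ∀ ξ, inner ℝ (schwartzL2 ξ) f = 0) : f = 0 := by
  have hd : DenseRange schwartzL2 := SchwartzMap.denseRange_toLpCLM ENNReal.ofNat_ne_top
  refine hd.eq_zero_of_inner_left ℝ ?_
  exact fun ξ => (real_inner_comm _ _).trans (h ξ)

/-- Induction on the number of variables: the section map splits off the last one, where density of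
S(ℝ) in L²(ℝ) applies. -/
theorem eq_zero_of_inner_tensor {n : ℕ} : ∀ {f : KernelL2 n},
    (∀ ξ : Fin n → 𝓢(ℝ, ℝ), inner ℝ (tensor ξ) f = 0) → f = 0 := by
  induction n with
  | zero =>
    intro f h
    have h0 := h Fin.elim0
    rw [integral_mul_eq_inner (coeFn_tensor _) (EventuallyEq.refl _ _)] at h0
    simp only [Finset.univ_eq_empty, Finset.prod_empty, one_mul] at h0
    ext1
    refine EventuallyEq.trans (Eventually.of_forall fun x => ?_) (Lp.coeFn_zero _ _ _).symm
    -- ℝ⁰ is one point of mass 1, so the inner product with the empty tensor is the value of f.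
    have : (volume : Measure (Fin 0 → ℝ)) = Measure.dirac x := by
      rw [volume_pi, Measure.pi_of_empty _ x]
    have h1 : ∫ x, f x ∂(volume : Measure (Fin 0 → ℝ)) = f x := by
      simp_rw [this, integral_dirac]
    simpa [h1] using h0
  | succ n ih =>
    intro f h
    suffices hz : kcurry n f = 0 by
      exact (kcurry n).injective (by rw [hz, map_zero])
    refine Lp.ext (EventuallyEq.trans ?_ (Lp.coeFn_zero _ _ _).symm)
    refine Lp.ae_eq_zero_of_forall_setIntegral_eq_zero (kcurry n f) two_ne_zero
      ENNReal.ofNat_ne_top (fun A hA hμA => ?_) fun A hA hμA => ?_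
    · exact integrableOn_Lp_of_measure_ne_top _ (by norm_num) hμA.ne
    · refine ih fun ξ => ?_
      have hint := integrableOn_Lp_of_measure_ne_top (kcurry n f) (by norm_num) hμA.ne
      rw [← integral_inner hint]
      -- For fixed ξ the function s ↦ (ξ₁ ⊗ ⋯ ⊗ ξₙ, f(·, s)) lies in L²(ℝ), and it is orthogonal to
      -- every η since f is orthogonal to ξ₁ ⊗ ⋯ ⊗ ξₙ ⊗ η.
      have hz : (innerSL ℝ (tensor ξ)).compLp (kcurry n f) = 0 := by
        refine eq_zero_of_inner_schwartzL2 fun η => ?_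
        rw [← h (Fin.snoc ξ η), ← (kcurry n).inner_map_map, L2.inner_def, L2.inner_def]
        refine integral_congr_ae ?_
        filter_upwards [coeFn_schwartzL2 η,
          (innerSL ℝ (tensor ξ)).coeFn_compLp (kcurry n f),
          kcurry_tensor (Fin.snoc ξ η : Fin (n + 1) → 𝓢(ℝ, ℝ))] with s h1 h2 h3
        rw [h1, h2, h3]
        simp only [Fin.snoc_last, Fin.snoc_castSucc, innerSL_apply_apply, real_inner_smul_left]
        simp [mul_comm]
      have h2 := (innerSL ℝ (tensor ξ)).coeFn_compLp (kcurry n f)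
      rw [hz] at h2
      refine integral_eq_zero_of_ae (ae_restrict_of_ae ?_)
      filter_upwards [h2, Lp.coeFn_zero ℝ 2 (volume : Measure ℝ)] with s k1 k2
      rw [k2] at k1
      simpa using k1.symm

theorem inner_tensor_perm {n : ℕ} (f : symL2 n) (ξ : Fin n → 𝓢(ℝ, ℝ)) (π : Equiv.Perm (Fin n)) :
    inner ℝ (tensor fun i => ξ (π i)) (f : KernelL2 n) = inner ℝ (tensor ξ) (f : KernelL2 n) := by
  have h1 := compMeasurePreserving_perm_tensor π.symm ξ
  have h2 := mem_symL2_iff.1 f.2 π.symm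
  rw [Equiv.symm_symm] at h1
  rw [← h1]
  conv_lhs => rw [← h2]
  let U : KernelL2 n →ₗᵢ[ℝ] KernelL2 n :=
    Lp.compMeasurePreservingₗᵢ ℝ _ (measurePreserving_perm π.symm)
  exact U.inner_map_map _ _

theorem tensor_sum {n m : ℕ} (ξ : Fin m → 𝓢(ℝ, ℝ)) (t : Fin m → ℝ) :
    (tensor fun _ : Fin n => ∑ j, t j • ξ j) =
      ∑ r : Fin n → Fin m, (∏ i, t (r i)) • tensor fun i => ξ (r i) := by
  ext1
  have h : ∀ r : Fin n → Fin m, ((∏ i, t (r i)) • tensor fun i => ξ (r i) : KernelL2 n) =ᵐ[volume]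
      fun x => (∏ i, t (r i)) * ∏ i, ξ (r i) (x i) := fun r => by
    filter_upwards [Lp.coeFn_smul (∏ i, t (r i)) (tensor fun i => ξ (r i)),
      coeFn_tensor fun i => ξ (r i)] with x h1 h2
    rw [h1, Pi.smul_apply, h2, smul_eq_mul]
  filter_upwards [coeFn_tensor fun _ : Fin n => ∑ j, t j • ξ j, ae_all_iff.2 h,
    Lp.coeFn_fun_finsetSum Finset.univ fun r : Fin n → Fin m =>
      ((∏ i, t (r i)) • tensor fun i => ξ (r i) : KernelL2 n)] with x h1 h2 h3
  rw [h1, h3]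
  simp_rw [h2, ← Finset.prod_mul_distrib]
  simp only [sum_apply, smul_apply, smul_eq_mul]
  rw [Finset.prod_univ_sum, Fintype.piFinset_univ]

/-- Polarization: a symmetric kernel that is orthogonal to all powers is zero. -/
theorem eq_zero_of_inner_tensorPow {n : ℕ} {f : symL2 n}
    (h : ∀ ξ, inner ℝ (tensorPow n ξ) f = 0) : f = 0 := by
  refine Subtype.ext (eq_zero_of_inner_tensor fun ξ => ?_)
  let c : (Fin n → Fin n) → ℝ := fun r => inner ℝ (tensor fun i => ξ (r i)) (f : KernelL2 n)
  -- P(t) = ((∑ tⱼ ξⱼ)^{⊗n}, f) vanishes for all real t, hence as a polynomial. By symmetry of f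
  -- each bijective r contributes the same number to the coefficient of t₁ ⋯ tₙ, so this coefficient
  -- is a positive multiple of (ξ₁ ⊗ ⋯ ⊗ ξₙ, f).
  let P : MvPolynomial (Fin n) ℝ := ∑ r : Fin n → Fin n, MvPolynomial.C (c r) * ∏ i, MvPolynomial.X (r i)
  have hP : P = 0 := by
    refine MvPolynomial.funext fun t => ?_
    have := h (∑ j, t j • ξ j)
    rw [Submodule.coe_inner, tensorPow] at this
    simp only [tensor_sum, sum_inner, real_inner_smul_left] at this
    simp only [P, map_sum, map_mul, map_prod, MvPolynomial.eval_C, MvPolynomial.eval_X, map_zero]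
    rw [← this]
    exact Finset.sum_congr rfl fun r _ => mul_comm _ _
  have hcoeff : ∀ r : Fin n → Fin n, MvPolynomial.coeff (∑ i, Finsupp.single i 1)
      (MvPolynomial.C (c r) * ∏ i, MvPolynomial.X (r i)) =
        if Function.Bijective r then c id else 0 := fun r => by
    have h1 : (∏ i, MvPolynomial.X (r i) : MvPolynomial (Fin n) ℝ) =
        MvPolynomial.monomial (∑ i, Finsupp.single (r i) 1) 1 := by
      rw [MvPolynomial.monomial_sum_one]
      rfl
    rw [h1, MvPolynomial.coeff_C_mul, MvPolynomial.coeff_monomial]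
    have h2 : (∑ i, Finsupp.single (r i) 1 : Fin n →₀ ℕ) = ∑ i, Finsupp.single i 1 ↔
        Function.Bijective r := by
      constructor
      · intro h
        refine Finite.surjective_iff_bijective.1 fun j => ?_
        by_contra hj
        push Not at hj
        have := DFunLike.congr_fun h j
        simp [Finsupp.single_apply, hj] at this
      · intro h
        exact Fintype.sum_bijective r h _ _ fun i => rfl
    by_cases hr : Function.Bijective r
    · rw [if_pos (h2.2 hr), if_pos hr, mul_one]
      exact inner_tensor_perm f ξ (Equiv.ofBijective r hr)
    · rw [if_neg (mt h2.1 hr), if_neg hr, mul_zero]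
  have h3 := congrArg (MvPolynomial.coeff (∑ i, Finsupp.single i 1)) hP
  simp only [P, MvPolynomial.coeff_sum, MvPolynomial.coeff_zero, hcoeff] at h3
  rw [← Finset.sum_filter, Finset.sum_const, nsmul_eq_mul, mul_eq_zero] at h3
  refine h3.resolve_left ?_
  rw [Nat.cast_eq_zero, Finset.card_eq_zero]
  exact Finset.ne_empty_of_mem (Finset.mem_filter.2 ⟨Finset.mem_univ id, Function.bijective_id⟩)

theorem isClosed_symL2 (n : ℕ) : IsClosed (symL2 n : Set (KernelL2 n)) := by
  have : (symL2 n : Set (KernelL2 n)) = ⋂ π : Equiv.Perm (Fin n),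
      {f | Lp.compMeasurePreserving _ (measurePreserving_perm π) f = f} := by
    ext f; simp [mem_symL2_iff]
  rw [this]
  exact isClosed_iInter fun π => isClosed_eq
    (Lp.isometry_compMeasurePreserving (measurePreserving_perm π)).continuous continuous_id

instance (n : ℕ) : CompleteSpace (symL2 n) := (isClosed_symL2 n).completeSpace_coe

/-- The orthogonal projection of `L²(ℝⁿ)` onto the symmetric kernels. -/
def symProj (n : ℕ) : KernelL2 n →L[ℝ] symL2 n := (symL2 n).orthogonalProjectionOnto

theorem inner_symProj {n : ℕ} (f : KernelL2 n) (g : symL2 n) :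
    inner ℝ (symProj n f) g = inner ℝ f (g : KernelL2 n) :=
  (symL2 n).inner_orthogonalProjectionOnto_eq_of_mem_right g f

theorem dense_span_tensorPow (n : ℕ) :
    Dense (Submodule.span ℝ (range (tensorPow n)) : Set (symL2 n)) := by
  rw [Submodule.dense_iff_topologicalClosure_eq_top, Submodule.topologicalClosure_eq_top_iff,
    Submodule.eq_bot_iff]
  intro f hf
  refine eq_zero_of_inner_tensorPow fun ξ => ?_
  exact (Submodule.mem_orthogonal _ _).1 hf _ (Submodule.subset_span ⟨ξ, rfl⟩)

end

section

/-! ### The generating function of the Hermite polynomials -/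

/-- The coefficients of the power series `exp (-t² / 2)`. -/
def gaussCoeff (l : ℕ) : ℝ := if Even l then (-1 / 2) ^ (l / 2) / (l / 2).factorial else 0

/-- This is the generating function ∑ tⁿ Heₙ(x) / n! = exp(tx) exp(-t²/2), read off coefficient by
coefficient. -/
theorem coeff_hermite_div_factorial (k l : ℕ) :
    ((Polynomial.hermite (k + l)).coeff k : ℝ) / (k + l).factorial
      = gaussCoeff l / k.factorial := by
  rcases Nat.even_or_odd l with hl | hl
  · obtain ⟨j, rfl⟩ := hl
    have hj : (j + j) / 2 = j := by omega
    rw [gaussCoeff, if_pos ⟨j, rfl⟩, hj, show k + (j + j) = 2 * j + k by ring,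
      Polynomial.coeff_hermite_explicit]
    have h1 : (((2 * j + k).choose k : ℕ) : ℝ) * k.factorial * (2 * j).factorial
        = (2 * j + k).factorial := by
      have := Nat.add_choose_mul_factorial_mul_factorial (2 * j) k
      rw [← this]
      push_cast; ring
    -- The case j = 0 is separate because 2 * j - 1 truncates to 0; there both sides equal 1.
    have h2 : ((2 * j).factorial : ℝ) = 2 ^ j * j.factorial * (2 * j - 1).doubleFactorial := by
      rcases j with _ | j
      · simp
      · rw [show 2 * (j + 1) = (2 * j + 1) + 1 by ring, Nat.factorial_eq_mul_doubleFactorial,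
          show 2 * j + 1 + 1 = 2 * (j + 1) by ring, Nat.doubleFactorial_two_mul,
          show 2 * (j + 1) - 1 = 2 * j + 1 by omega]
        push_cast; ring
    have h3 : ((2 * j - 1).doubleFactorial : ℝ) ≠ 0 := by
      exact_mod_cast (Nat.doubleFactorial_pos _).ne'
    have h4 : ((2 * j + k).choose k : ℝ) ≠ 0 := by
      exact_mod_cast (Nat.choose_pos (by omega)).ne'
    rw [← h1, h2]
    have h5 : ((-1 : ℝ) / 2) ^ j = (-1) ^ j / 2 ^ j := div_pow _ _ _
    rw [h5]
    push_cast
    field_simp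
  · rw [gaussCoeff, if_neg (Nat.not_even_iff_odd.2 hl), Polynomial.coeff_hermite_of_odd_add]
    · simp
    · rcases hl with ⟨j, rfl⟩
      exact ⟨k + j, by ring⟩

theorem summable_gaussCoeff (t : ℝ) :
    HasSum (fun l => t ^ l * gaussCoeff l) (Real.exp (-(t ^ 2) / 2)) ∧
      HasSum (fun l => |t ^ l * gaussCoeff l|) (Real.exp (t ^ 2 / 2)) := by
  have hinj : Function.Injective fun j : ℕ => 2 * j := fun a b h => by simpa using h
  have hexp : ∀ x : ℝ, HasSum (fun j : ℕ => x ^ j / j.factorial) (Real.exp x) := fun x => by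
    rw [Real.exp_eq_exp_ℝ]; exact NormedSpace.expSeries_div_hasSum_exp x
  have h0 : ∀ l ∉ range fun j : ℕ => 2 * j, t ^ l * gaussCoeff l = 0 := fun l hl => by
    have : ¬ Even l := fun h => hl (by obtain ⟨j, rfl⟩ := h; exact ⟨j, by ring⟩)
    simp [gaussCoeff, this]
  have h1 : ∀ j : ℕ, t ^ (2 * j) * gaussCoeff (2 * j) = (-(t ^ 2) / 2) ^ j / j.factorial := by
    intro j
    have : (2 * j) / 2 = j := by omega
    rw [gaussCoeff, if_pos (even_two_mul j), this, pow_mul, mul_div_assoc', ← mul_pow]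
    congr 2; ring
  constructor
  · rw [← hinj.hasSum_iff h0]
    simpa only [Function.comp_def, h1] using hexp (-(t ^ 2) / 2)
  · rw [← hinj.hasSum_iff fun l hl => by rw [h0 l hl, abs_zero]]
    have h2 : ∀ j : ℕ, |(-(t ^ 2) / 2) ^ j / j.factorial| = (t ^ 2 / 2) ^ j / j.factorial := by
      intro j
      rw [abs_div, abs_pow, neg_div, abs_neg, abs_of_nonneg (by positivity : (0 : ℝ) ≤ t ^ 2 / 2),
        Nat.abs_cast]
    simpa only [Function.comp_def, h1, h2] using hexp (t ^ 2 / 2)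

/-- The homogeneous form `vⁿ Heₙ(x / v) / n!` of the Hermite polynomials. -/
def hermiteHom (n : ℕ) (x v : ℝ) : ℝ :=
  ∑ p ∈ Finset.HasAntidiagonal.antidiagonal n, x ^ p.1 / p.1.factorial * (v ^ p.2 * gaussCoeff p.2)

/-- Unlike the quotient x / v, the homogeneous form has no singularity at v = 0. The hypothesis
makes the two agree there; it holds for x = ⟨ω, ξ⟩ and v = |ξ|, since |ξ| = 0 forces ξ = 0. -/
theorem pow_mul_aeval_hermite (n : ℕ) {x v : ℝ} (h : v = 0 → x = 0) :
    v ^ n * Polynomial.aeval (x / v) (Polynomial.hermite n) = n.factorial * hermiteHom n x v := by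
  rcases eq_or_ne v 0 with hv | hv
  · obtain rfl := h hv
    subst hv
    rcases n with _ | n
    · simp [hermiteHom, gaussCoeff]
    · rw [hermiteHom, Finset.sum_eq_zero]
      · simp
      · rintro ⟨k, l⟩ hkl
        rw [Finset.HasAntidiagonal.mem_antidiagonal] at hkl
        rcases k with _ | k
        · simp at hkl; subst hkl; simp
        · simp
  · rw [Polynomial.aeval_eq_sum_range, Polynomial.natDegree_hermite, hermiteHom,
      Finset.Nat.sum_antidiagonal_eq_sum_range_succ
        (fun k l => x ^ k / k.factorial * (v ^ l * gaussCoeff l)), Finset.mul_sum, Finset.mul_sum]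
    refine Finset.sum_congr rfl fun k hk => ?_
    obtain ⟨l, rfl⟩ := Nat.exists_eq_add_of_le (Nat.lt_succ_iff.1 (Finset.mem_range.1 hk))
    have h1 := coeff_hermite_div_factorial k l
    rw [div_eq_div_iff (by positivity) (by positivity)] at h1
    have h2 : (x / v) ^ k * v ^ (k + l) = x ^ k * v ^ l := by
      rw [div_pow, pow_add]; field_simp
    rw [Nat.add_sub_cancel_left, zsmul_eq_mul]
    have h3 : (k.factorial : ℝ) ≠ 0 := by positivity
    rw [div_mul_eq_mul_div, mul_div_assoc', eq_div_iff h3]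
    linear_combination ((x / v) ^ k * v ^ (k + l)) * h1
      + gaussCoeff l * (k + l).factorial * h2

theorem hermiteHom_mul (n : ℕ) (x v t : ℝ) : hermiteHom n (t * x) (t * v) = t ^ n * hermiteHom n x v := by
  rw [hermiteHom, hermiteHom, Finset.mul_sum]
  refine Finset.sum_congr rfl fun p hp => ?_
  rw [← Finset.HasAntidiagonal.mem_antidiagonal.1 hp, pow_add, mul_pow, mul_pow]
  ring

theorem hasSum_hermiteHom (x v : ℝ) :
    HasSum (fun n => hermiteHom n x v) (Real.exp (x - v ^ 2 / 2)) := by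
  have hx : HasSum (fun k : ℕ => x ^ k / k.factorial) (Real.exp x) := by
    rw [Real.exp_eq_exp_ℝ]; exact NormedSpace.expSeries_div_hasSum_exp x
  have hxn : Summable fun k : ℕ => ‖x ^ k / k.factorial‖ :=
    NormedSpace.norm_expSeries_div_summable x
  have hv := summable_gaussCoeff v
  have h := summable_norm_sum_mul_antidiagonal_of_summable_norm hxn hv.2.summable
  have h2 := tsum_mul_tsum_eq_tsum_sum_antidiagonal_of_summable_norm hxn hv.2.summable
  rw [hx.tsum_eq, hv.1.tsum_eq, ← Real.exp_add] at h2
  have h3 := h.of_norm.hasSum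
  rw [← h2] at h3
  rwa [show x - v ^ 2 / 2 = x + -v ^ 2 / 2 by ring]

/-- The Cauchy product of the absolute series bounds all finite partial sums at once; this is the
dominating function for convergence in L²(μ). -/
theorem abs_sum_hermiteHom_le (s : Finset ℕ) (x v : ℝ) :
    |∑ n ∈ s, hermiteHom n x v| ≤ Real.exp (|x| + v ^ 2 / 2) := by
  have hx : HasSum (fun k : ℕ => |x| ^ k / k.factorial) (Real.exp |x|) := by
    rw [Real.exp_eq_exp_ℝ]; exact NormedSpace.expSeries_div_hasSum_exp |x|
  have hv := (summable_gaussCoeff v).2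
  have hxn : Summable fun k : ℕ => ‖|x| ^ k / k.factorial‖ :=
    NormedSpace.norm_expSeries_div_summable |x|
  have hvn : Summable fun l => ‖|v ^ l * gaussCoeff l|‖ := by
    simpa using hv.summable
  have h := summable_norm_sum_mul_antidiagonal_of_summable_norm hxn hvn
  have h2 := tsum_mul_tsum_eq_tsum_sum_antidiagonal_of_summable_norm hxn hvn
  rw [hx.tsum_eq, hv.tsum_eq, ← Real.exp_add] at h2
  rw [h2]
  refine (Finset.abs_sum_le_sum_abs _ _).trans ?_
  refine le_trans ?_ (h.of_norm.sum_le_tsum s fun n _ => Finset.sum_nonneg fun p _ => by positivity)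
  refine Finset.sum_le_sum fun n _ => (Finset.abs_sum_le_sum_abs _ _).trans ?_
  refine Finset.sum_le_sum fun p _ => ?_
  rw [abs_mul, abs_div, abs_pow, Nat.abs_cast]

/-- Dominated convergence of series in `L²`. -/
theorem hasSum_Lp_of_dominated {α : Type*} [MeasurableSpace α] {ν : Measure α} {f : ℕ → Lp ℝ 2 ν}
    {F : Lp ℝ 2 ν} {g : ℕ → α → ℝ} {G b : α → ℝ} (hf : ∀ n, f n =ᵐ[ν] g n) (hF : F =ᵐ[ν] G)
    (hb : MemLp b 2 ν) (hgb : ∀ a (s : Finset ℕ), |∑ n ∈ s, g n a| ≤ b a)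
    (hg : ∀ a, HasSum (fun n => g n a) (G a)) : HasSum f F := by
  rw [HasSum, SummationFilter.unconditional_filter, tendsto_iff_norm_sub_tendsto_zero]
  have key : Tendsto (fun s : Finset ℕ => ‖∑ n ∈ s, f n - F‖ ^ 2) atTop (𝓝 0) := by
    have h1 : ∀ s : Finset ℕ, ‖∑ n ∈ s, f n - F‖ ^ 2 = ∫ a, (∑ n ∈ s, g n a - G a) ^ 2 ∂ν := by
      intro s
      rw [norm_sq_eq_integral]
      refine integral_congr_ae ?_
      filter_upwards [Lp.coeFn_sub (∑ n ∈ s, f n) F, Lp.coeFn_fun_finsetSum s f, hF,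
        ae_all_iff.2 hf] with a k1 k2 k3 k4
      rw [k1, Pi.sub_apply, k2, k3]
      simp_rw [k4]
    simp_rw [h1]
    have h2 : ∫ a, (0 : ℝ) ∂ν = 0 := by simp
    rw [← h2]
    have hGb : ∀ a, |G a| ≤ b a := fun a =>
      le_of_tendsto ((hg a).abs) (Eventually.of_forall fun s => hgb a s)
    refine tendsto_integral_filter_of_dominated_convergence (fun a => (2 * b a) ^ 2)
      (Eventually.of_forall fun s => ?_) (Eventually.of_forall fun s => ?_) ?_ ?_
    · refine ((Finset.aestronglyMeasurable_fun_sum _ fun n _ => ?_).sub ?_).pow 2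
      · exact (Lp.aestronglyMeasurable (f n)).congr (hf n)
      · exact (Lp.aestronglyMeasurable F).congr hF
    · refine Eventually.of_forall fun a => ?_
      have h3 := abs_sub (∑ n ∈ s, g n a) (G a)
      have h4 := hgb a s
      have h5 := hGb a
      rw [Real.norm_eq_abs, abs_pow]
      exact pow_le_pow_left₀ (abs_nonneg _) (by linarith) 2
    · exact (memLp_two_iff_integrable_sq (hb.1.const_mul 2)).1 (hb.const_mul 2)
    · refine Eventually.of_forall fun a => ?_
      have h3 := (hg a).sub_const (G a)
      rw [sub_self] at h3
      have h4 := Tendsto.pow h3 2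
      simpa using h4
  have := key.sqrt
  simpa using this

/-! ### The Gaussian field -/

theorem measurable_eval (ξ : 𝓢(ℝ, ℝ)) : Measurable fun ω : TemperedDist => ω.eval ξ := by
  rw [measurable_iff_comap_le]
  exact le_iSup (fun ξ : 𝓢(ℝ, ℝ) =>
    MeasurableSpace.comap (fun ω : TemperedDist => ω.eval ξ) inferInstance) ξ

theorem eval_add (ω : TemperedDist) (ξ η : 𝓢(ℝ, ℝ)) : ω.eval (ξ + η) = ω.eval ξ + ω.eval η :=
  map_add (show 𝓢(ℝ, ℝ) →L[ℝ] ℝ from ω) ξ η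

theorem eval_smul (ω : TemperedDist) (c : ℝ) (ξ : 𝓢(ℝ, ℝ)) : ω.eval (c • ξ) = c * ω.eval ξ :=
  map_smul (show 𝓢(ℝ, ℝ) →L[ℝ] ℝ from ω) c ξ

theorem eval_zero (ω : TemperedDist) : ω.eval 0 = 0 :=
  map_zero (show 𝓢(ℝ, ℝ) →L[ℝ] ℝ from ω)

/-- The exponential functional `exp (⟨ω, ξ⟩ - |ξ|² / 2)`. -/
def expFn (ξ : 𝓢(ℝ, ℝ)) (ω : TemperedDist) : ℝ := Real.exp (ω.eval ξ - ‖schwartzL2 ξ‖ ^ 2 / 2)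

theorem measurable_expFn (ξ : 𝓢(ℝ, ℝ)) : Measurable (expFn ξ) :=
  Real.measurable_exp.comp ((measurable_eval ξ).sub_const _)

theorem expFn_mul (ξ η : 𝓢(ℝ, ℝ)) (ω : TemperedDist) :
    expFn ξ ω * expFn η ω =
      Real.exp (inner ℝ (schwartzL2 ξ) (schwartzL2 η)) * expFn (ξ + η) ω := by
  rw [expFn, expFn, expFn, ← Real.exp_add, ← Real.exp_add, eval_add, map_add, norm_add_sq_real]
  congr 1; ring

variable {μ : Measure TemperedDist} [IsProbabilityMeasure μ]

/-- The characteristic functional at t • ξ is the Gaussian characteristic function at t. -/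
theorem map_eval_eq_gaussianReal (hμ : IsWhiteNoiseMeasure μ) (ξ : 𝓢(ℝ, ℝ)) :
    μ.map (fun ω => ω.eval ξ) =
      ProbabilityTheory.gaussianReal 0 (‖schwartzL2 ξ‖₊ ^ 2) := by
  have : IsProbabilityMeasure (μ.map fun ω => ω.eval ξ) :=
    Measure.isProbabilityMeasure_map (measurable_eval ξ).aemeasurable
  refine Measure.ext_of_charFun (funext fun t => ?_)
  rw [charFun_apply_real, ProbabilityTheory.charFun_gaussianReal,
    integral_map (measurable_eval ξ).aemeasurable (by fun_prop)]
  have h := hμ (t • ξ)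
  have h2 : ∫ x, (t • ξ) x ^ 2 = t ^ 2 * ‖schwartzL2 ξ‖ ^ 2 := by
    rw [norm_sq_schwartzL2, ← integral_const_mul]
    simp [mul_pow]
  rw [h2] at h
  simp only [eval_smul] at h
  refine Eq.trans ?_ (h.trans ?_)
  · refine integral_congr_ae (Eventually.of_forall fun ω => ?_)
    simp only
    congr 1; push_cast; ring
  · congr 1; push_cast
    simp
    ring

theorem integrable_exp_eval (hμ : IsWhiteNoiseMeasure μ) (ξ : 𝓢(ℝ, ℝ)) :
    Integrable (fun ω => Real.exp (ω.eval ξ)) μ := by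
  have h := ProbabilityTheory.integrable_exp_mul_gaussianReal (μ := 0)
    (v := ‖schwartzL2 ξ‖₊ ^ 2) 1
  rw [← map_eval_eq_gaussianReal hμ ξ] at h
  simpa [Function.comp_def] using
    (integrable_map_measure (by fun_prop) (measurable_eval ξ).aemeasurable).1 h

theorem integrable_expFn (hμ : IsWhiteNoiseMeasure μ) (ξ : 𝓢(ℝ, ℝ)) : Integrable (expFn ξ) μ := by
  have := (integrable_exp_eval hμ ξ).mul_const (Real.exp (-(‖schwartzL2 ξ‖ ^ 2 / 2)))
  refine this.congr (Eventually.of_forall fun ω => ?_)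
  simp only [expFn, ← Real.exp_add, sub_eq_add_neg]

theorem integral_expFn (hμ : IsWhiteNoiseMeasure μ) (ξ : 𝓢(ℝ, ℝ)) : ∫ ω, expFn ξ ω ∂μ = 1 := by
  have h := ProbabilityTheory.mgf_gaussianReal (map_eval_eq_gaussianReal hμ ξ) 1
  simp only [ProbabilityTheory.mgf, one_mul, zero_add, one_pow, mul_one] at h
  simp only [expFn, sub_eq_add_neg, Real.exp_add]
  rw [integral_mul_const, h, ← Real.exp_add]
  simp

theorem integrable_expFn_mul (hμ : IsWhiteNoiseMeasure μ) (ξ η : 𝓢(ℝ, ℝ)) :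
    Integrable (fun ω => expFn ξ ω * expFn η ω) μ := by
  simp_rw [expFn_mul]
  exact (integrable_expFn hμ _).const_mul _

theorem integral_expFn_mul (hμ : IsWhiteNoiseMeasure μ) (ξ η : 𝓢(ℝ, ℝ)) :
    ∫ ω, expFn ξ ω * expFn η ω ∂μ = Real.exp (inner ℝ (schwartzL2 ξ) (schwartzL2 η)) := by
  simp_rw [expFn_mul]
  rw [integral_const_mul, integral_expFn hμ, mul_one]

theorem memLp_expFn (hμ : IsWhiteNoiseMeasure μ) (ξ : 𝓢(ℝ, ℝ)) : MemLp (expFn ξ) 2 μ := by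
  refine (memLp_two_iff_integrable_sq (measurable_expFn ξ).aestronglyMeasurable).2 ?_
  simpa only [sq] using integrable_expFn_mul hμ ξ ξ

theorem memLp_exp_abs_eval (hμ : IsWhiteNoiseMeasure μ) (ξ : 𝓢(ℝ, ℝ)) (c : ℝ) :
    MemLp (fun ω : TemperedDist => Real.exp (|ω.eval ξ| + c)) 2 μ := by
  have hm : Measurable fun ω : TemperedDist => Real.exp (|ω.eval ξ| + c) :=
    Real.measurable_exp.comp ((measurable_eval ξ).abs.add_const c)
  refine (memLp_two_iff_integrable_sq hm.aestronglyMeasurable).2 ?_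
  have h := ((integrable_exp_eval hμ ((2 : ℝ) • ξ)).add
    (integrable_exp_eval hμ ((-2 : ℝ) • ξ))).mul_const (Real.exp (2 * c))
  refine h.mono' (hm.pow_const 2).aestronglyMeasurable (Eventually.of_forall fun ω => ?_)
  rw [Real.norm_eq_abs, abs_of_nonneg (by positivity), Pi.add_apply, eval_smul, eval_smul,
    ← Real.exp_nat_mul, mul_add, Real.exp_add]
  push_cast
  refine mul_le_mul_of_nonneg_right ?_ (Real.exp_pos _).le
  rcases abs_cases (ω.eval ξ) with ⟨h1, _⟩ | ⟨h1, _⟩ <;> rw [h1]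
  · exact le_add_of_nonneg_right (Real.exp_pos _).le
  · rw [mul_neg, ← neg_mul]
    exact le_add_of_nonneg_left (Real.exp_pos _).le

/-- The exponential functional as an element of `L²(μ)`. -/
def expRV (hμ : IsWhiteNoiseMeasure μ) (ξ : 𝓢(ℝ, ℝ)) : Lp ℝ 2 μ := (memLp_expFn hμ ξ).toLp _

theorem coeFn_expRV (hμ : IsWhiteNoiseMeasure μ) (ξ : 𝓢(ℝ, ℝ)) : expRV hμ ξ =ᵐ[μ] expFn ξ :=
  (memLp_expFn hμ ξ).coeFn_toLp

theorem inner_expRV (hμ : IsWhiteNoiseMeasure μ) (ξ η : 𝓢(ℝ, ℝ)) :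
    inner ℝ (expRV hμ ξ) (expRV hμ η) = Real.exp (inner ℝ (schwartzL2 ξ) (schwartzL2 η)) := by
  rw [integral_mul_eq_inner (coeFn_expRV hμ ξ) (coeFn_expRV hμ η), integral_expFn_mul hμ]

/-- The random variable `Iₙ(ξ^{⊗n}) / n!`. -/
def wickPowFn (n : ℕ) (ξ : 𝓢(ℝ, ℝ)) (ω : TemperedDist) : ℝ :=
  hermiteHom n (ω.eval ξ) ‖schwartzL2 ξ‖

theorem measurable_wickPowFn (n : ℕ) (ξ : 𝓢(ℝ, ℝ)) : Measurable (wickPowFn n ξ) := by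
  unfold wickPowFn hermiteHom
  exact Finset.measurable_fun_sum _ fun p _ =>
    (((measurable_eval ξ).pow_const _).div_const _).mul_const _

theorem memLp_wickPowFn (hμ : IsWhiteNoiseMeasure μ) (n : ℕ) (ξ : 𝓢(ℝ, ℝ)) :
    MemLp (wickPowFn n ξ) 2 μ := by
  refine (memLp_exp_abs_eval hμ ξ (‖schwartzL2 ξ‖ ^ 2 / 2)).mono
    (measurable_wickPowFn n ξ).aestronglyMeasurable (Eventually.of_forall fun ω => ?_)
  have := abs_sum_hermiteHom_le {n} (ω.eval ξ) ‖schwartzL2 ξ‖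
  rw [Finset.sum_singleton] at this
  rw [Real.norm_eq_abs, Real.norm_eq_abs, Real.abs_exp]
  exact this

/-- `Iₙ(ξ^{⊗n}) / n!` as an element of `L²(μ)`. -/
def wickPow (hμ : IsWhiteNoiseMeasure μ) (n : ℕ) (ξ : 𝓢(ℝ, ℝ)) : Lp ℝ 2 μ :=
  (memLp_wickPowFn hμ n ξ).toLp _

theorem coeFn_wickPow (hμ : IsWhiteNoiseMeasure μ) (n : ℕ) (ξ : 𝓢(ℝ, ℝ)) :
    wickPow hμ n ξ =ᵐ[μ] wickPowFn n ξ := (memLp_wickPowFn hμ n ξ).coeFn_toLp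

/-- The free parameter t makes this a power series, so that chaos components can be extracted by
comparing coefficients. -/
theorem hasSum_wickPow (hμ : IsWhiteNoiseMeasure μ) (ξ : 𝓢(ℝ, ℝ)) (t : ℝ) :
    HasSum (fun n => t ^ n • wickPow hμ n ξ) (expRV hμ (t • ξ)) := by
  refine hasSum_Lp_of_dominated (g := fun n ω => hermiteHom n (t * ω.eval ξ) (t * ‖schwartzL2 ξ‖))
    (fun n => ?_) (coeFn_expRV hμ (t • ξ)) (memLp_exp_abs_eval hμ (t • ξ)
      ((t * ‖schwartzL2 ξ‖) ^ 2 / 2)) (fun ω s => ?_) fun ω => ?_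
  · filter_upwards [Lp.coeFn_smul (t ^ n) (wickPow hμ n ξ), coeFn_wickPow hμ n ξ] with ω h1 h2
    rw [h1, Pi.smul_apply, h2, wickPowFn, hermiteHom_mul, smul_eq_mul]
  · rw [eval_smul]; exact abs_sum_hermiteHom_le _ _ _
  · have := hasSum_hermiteHom (t * ω.eval ξ) (t * ‖schwartzL2 ξ‖)
    rwa [expFn, eval_smul, map_smul, norm_smul, mul_pow, Real.norm_eq_abs, sq_abs, ← mul_pow]

/-- The inner product of the exponentials of sξ and tη is exp(st(ξ, η)). Comparing coefficients in
s, then in t, gives orthogonality and the norms together. -/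
theorem inner_wickPow (hμ : IsWhiteNoiseMeasure μ) (n m : ℕ) (ξ η : 𝓢(ℝ, ℝ)) :
    inner ℝ (wickPow hμ n ξ) (wickPow hμ m η) =
      if n = m then inner ℝ (schwartzL2 ξ) (schwartzL2 η) ^ n / n.factorial else 0 := by
  have hexp : ∀ x : ℝ, HasSum (fun j : ℕ => x ^ j / j.factorial) (Real.exp x) := fun x => by
    rw [Real.exp_eq_exp_ℝ]; exact NormedSpace.expSeries_div_hasSum_exp x
  have h1 : ∀ t : ℝ, (fun n => inner ℝ (wickPow hμ n ξ) (expRV hμ (t • η))) =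
      fun n => (t * inner ℝ (schwartzL2 ξ) (schwartzL2 η)) ^ n / n.factorial := by
    intro t
    refine coeff_eq_of_hasSum
      (F := fun s => inner ℝ (expRV hμ (s • ξ)) (expRV hμ (t • η))) (fun s => ?_) fun s => ?_
    · have := (hasSum_wickPow hμ ξ s).mapL (innerSL ℝ (expRV hμ (t • η)))
      simp only [innerSL_apply_apply, real_inner_smul_right] at this
      simpa only [real_inner_comm] using this
    · rw [inner_expRV, map_smul, map_smul, real_inner_smul_left, real_inner_smul_right]
      convert hexp (s * (t * inner ℝ (schwartzL2 ξ) (schwartzL2 η))) using 2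
      rw [mul_pow s, mul_div_assoc]
  have h2 : (fun m => inner ℝ (wickPow hμ n ξ) (wickPow hμ m η)) = fun m =>
      if n = m then inner ℝ (schwartzL2 ξ) (schwartzL2 η) ^ n / n.factorial else 0 := by
    refine coeff_eq_of_hasSum
      (F := fun t => inner ℝ (wickPow hμ n ξ) (expRV hμ (t • η))) (fun t => ?_) fun t => ?_
    · have := (hasSum_wickPow hμ η t).mapL (innerSL ℝ (wickPow hμ n ξ))
      simpa only [innerSL_apply_apply, real_inner_smul_right] using this
    · rw [congrFun (h1 t) n]
      have := hasSum_single (f := fun m => t ^ m * if n = m then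
        inner ℝ (schwartzL2 ξ) (schwartzL2 η) ^ n / (n.factorial : ℝ) else 0) n
        fun m hm => by simp [hm.symm]
      simp only [if_true] at this
      rwa [mul_pow, mul_div_assoc]
  exact congrFun h2 m

end

section

theorem _root_.HasSum.of_eq {X : Type*} [AddCommMonoid X] [TopologicalSpace X] {f g : ℕ → X} {a : X}
    (hg : HasSum g a) (h : ∀ n, f n = g n) : HasSum f a := (funext h : f = g) ▸ hg

/-! ### Fock space -/

/-- The Fock space, as the Hilbert sum of the spaces of symmetric kernels. -/
abbrev Fock : Type := lp (fun n => symL2 n) 2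

theorem symL2_inner_smul_left {n : ℕ} (c : ℝ) (f g : symL2 n) :
    inner ℝ (c • f) g = c * inner ℝ f g := real_inner_smul_left f g c

theorem symL2_inner_smul_right {n : ℕ} (c : ℝ) (f g : symL2 n) :
    inner ℝ f (c • g) = c * inner ℝ f g := real_inner_smul_right f g c

/-- The weight of the `n`-th kernel in the norm `‖·‖_l`. -/
def wt (l : ℝ) (n : ℕ) : ℝ := Real.sqrt n.factorial * Real.exp (l * n)

theorem wt_pos (l : ℝ) (n : ℕ) : 0 < wt l n := by unfold wt; positivity

theorem wt_mul (l l' : ℝ) (n : ℕ) : wt l n * wt l' n = n.factorial * Real.exp (l + l') ^ n := by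
  have h := Real.mul_self_sqrt (Nat.cast_nonneg (α := ℝ) n.factorial)
  rw [wt, wt, ← Real.exp_nat_mul, mul_mul_mul_comm, h, ← Real.exp_add]
  congr 2; ring

theorem wt_mul_neg (l : ℝ) (n : ℕ) : wt (-l) n * wt l n = n.factorial := by
  rw [wt_mul]; simp

theorem wt_eq (l d : ℝ) (n : ℕ) : wt l n = Real.exp (-d) ^ n * wt (l + d) n := by
  rw [wt, wt, mul_left_comm, ← Real.exp_nat_mul, ← Real.exp_add]
  congr 2; ring

theorem normSq_eq_tsum (l : ℝ) (Φ : ChaosSeq) :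
    normSq l Φ = ∑' n, ENNReal.ofReal (‖wt l n • Φ n‖ ^ 2) := by
  refine tsum_congr fun n => ?_
  rw [norm_smul, mul_pow, Real.norm_eq_abs, sq_abs, sq (wt l n), wt_mul, ← Real.exp_nat_mul,
    show 2 * l * (n : ℝ) = n * (l + l) by ring]

theorem memℓp_iff_summable {G : ℕ → Type*} [∀ n, NormedAddCommGroup (G n)] (f : ∀ n, G n) :
    Memℓp f 2 ↔ Summable fun n => ‖f n‖ ^ 2 := by
  rw [memℓp_gen_iff (by norm_num)]
  simp

theorem normSq_lt_top_iff (l : ℝ) (Φ : ChaosSeq) :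
    normSq l Φ < ∞ ↔ Memℓp (fun n => wt l n • Φ n) 2 := by
  rw [memℓp_iff_summable, normSq_eq_tsum, lt_top_iff_ne_top]
  constructor
  · intro h
    have := ENNReal.summable_toReal h
    simpa [ENNReal.toReal_ofReal (sq_nonneg _)] using this
  · intro h
    exact h.tsum_ofReal_ne_top

open Classical in
/-- The element of Fock space that corresponds to a chaos expansion of finite norm `‖·‖_l`. -/
def toFock (l : ℝ) (Φ : ChaosSeq) : Fock :=
  if h : Memℓp (fun n => wt l n • Φ n) 2 then ⟨fun n => wt l n • Φ n, h⟩ else 0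

/-- The chaos expansion of finite norm `‖·‖_l` that corresponds to an element of Fock space. -/
def ofFock (l : ℝ) (x : Fock) : ChaosSeq := fun n => (wt l n)⁻¹ • x n

theorem toFock_apply {l : ℝ} {Φ : ChaosSeq} (h : normSq l Φ < ∞) (n : ℕ) :
    toFock l Φ n = wt l n • Φ n := by
  rw [toFock, dif_pos ((normSq_lt_top_iff l Φ).1 h)]

theorem lp_norm_sq {G : ℕ → Type*} [∀ n, NormedAddCommGroup (G n)] (x : lp G 2) :
    ‖x‖ ^ 2 = ∑' n, ‖x n‖ ^ 2 := by
  have := lp.norm_rpow_eq_tsum (p := 2) (by norm_num) x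
  simpa using this

theorem normSq_eq_ofReal {l : ℝ} {Φ : ChaosSeq} (h : normSq l Φ < ∞) :
    normSq l Φ = ENNReal.ofReal (‖toFock l Φ‖ ^ 2) := by
  rw [lp_norm_sq, ENNReal.ofReal_tsum_of_nonneg (fun n => sq_nonneg _)
    ((memℓp_iff_summable _).1 (lp.memℓp _)), normSq_eq_tsum]
  simp_rw [toFock_apply h]

theorem normSq_ofFock (l : ℝ) (x : Fock) : normSq l (ofFock l x) < ∞ := by
  rw [normSq_lt_top_iff]
  convert lp.memℓp x using 2 with n
  rw [ofFock, smul_smul, mul_inv_cancel₀ (wt_pos l n).ne', one_smul]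

@[simp]
theorem toFock_ofFock (l : ℝ) (x : Fock) : toFock l (ofFock l x) = x := by
  ext n : 2
  rw [toFock_apply (normSq_ofFock l x), ofFock, smul_smul, mul_inv_cancel₀ (wt_pos l n).ne',
    one_smul]

theorem ofFock_toFock {l : ℝ} {Φ : ChaosSeq} (h : normSq l Φ < ∞) : ofFock l (toFock l Φ) = Φ := by
  funext n
  rw [ofFock, toFock_apply h, smul_smul, inv_mul_cancel₀ (wt_pos l n).ne', one_smul]

/-- The weights at levels l and -l multiply to n!, so the pairing of 𝒢* with 𝒢 becomes the Fock
inner product. -/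
theorem hasSum_inner_toFock {l : ℝ} {Φ ψ : ChaosSeq} (h : normSq (-l) Φ < ∞)
    (h' : normSq l ψ < ∞) :
    HasSum (fun n => (n.factorial : ℝ) * inner ℝ (Φ n) (ψ n))
      (inner ℝ (toFock (-l) Φ) (toFock l ψ)) := by
  refine (lp.hasSum_inner (𝕜 := ℝ) (toFock (-l) Φ) (toFock l ψ)).of_eq fun n => ?_
  rw [toFock_apply h, toFock_apply h', symL2_inner_smul_left, symL2_inner_smul_right, ← mul_assoc,
    wt_mul_neg]

theorem fock_norm_le_of_forall {x y : Fock} (h : ∀ n, ‖x n‖ ≤ ‖y n‖) : ‖x‖ ≤ ‖y‖ := by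
  rw [← sq_le_sq₀ (norm_nonneg _) (norm_nonneg _), lp_norm_sq, lp_norm_sq]
  exact ((memℓp_iff_summable _).1 (lp.memℓp x)).tsum_le_tsum
    (fun n => pow_le_pow_left₀ (norm_nonneg _) (h n) 2)
    ((memℓp_iff_summable _).1 (lp.memℓp y))

/-- Diagonal operators on Fock space. -/
def diagOp (c : ℕ → ℝ) (hc : ∀ n, |c n| ≤ 1) : Fock →L[ℝ] Fock :=
  have hle : ∀ (x : Fock) n, ‖c n • x n‖ ≤ ‖x n‖ := fun x n => by
    rw [norm_smul, Real.norm_eq_abs]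
    exact mul_le_of_le_one_left (norm_nonneg _) (hc n)
  have hmem : ∀ x : Fock, Memℓp (fun n => c n • x n) 2 := fun x => (lp.memℓp x).mono' (hle x)
  LinearMap.mkContinuous
    { toFun := fun x => ⟨fun n => c n • x n, hmem x⟩
      map_add' := fun x y => by ext n : 2; exact smul_add (c n) (x n) (y n)
      map_smul' := fun r x => by ext n : 2; exact smul_comm (c n) r (x n) } 1 fun x => by
    rw [one_mul]; exact fock_norm_le_of_forall (hle x)

/-- The second quantization of `e^{-|d|}`, a contraction that lowers the level by `|d|`. -/
def scale (d : ℝ) : Fock →L[ℝ] Fock :=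
  diagOp (fun n => Real.exp (-|d|) ^ n) fun n => by
    rw [abs_of_nonneg (by positivity)]
    exact pow_le_one₀ (Real.exp_pos _).le (Real.exp_le_one_iff.2 (by simp))

theorem scale_apply (d : ℝ) (x : Fock) (n : ℕ) : scale d x n = Real.exp (-|d|) ^ n • x n := rfl

theorem scale_injective (d : ℝ) : Function.Injective (scale d) := by
  intro x y h
  ext n : 2
  have := congrArg (fun z : Fock => z n) h
  simp only [scale_apply] at this
  exact smul_right_injective _ (by positivity : Real.exp (-|d|) ^ n ≠ 0) this

/-- The weights at levels l ≤ l' differ by the factor e^{-(l'-l)n}. This contraction is what allows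
operators attached to different levels to be composed. -/
theorem scale_toFock {l l' : ℝ} (hl : l ≤ l') {Φ : ChaosSeq} (h : normSq l' Φ < ∞) :
    scale (l' - l) (toFock l' Φ) = toFock l Φ := by
  ext n : 2
  rw [scale_apply, toFock_apply h, toFock_apply ((normSq_mono hl Φ).trans_lt h), smul_smul,
    abs_of_nonneg (sub_nonneg.2 hl), wt_eq l (l' - l), add_sub_cancel]

/-! ### Exponential vectors -/

/-- The kernels `ξ^{⊗n} / n!` of the exponential functional. -/
def expVec (ξ : 𝓢(ℝ, ℝ)) : ChaosSeq := fun n => (n.factorial : ℝ)⁻¹ • tensorPow n ξ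

theorem hasSum_exp (x : ℝ) : HasSum (fun n : ℕ => x ^ n / n.factorial) (Real.exp x) := by
  rw [Real.exp_eq_exp_ℝ]; exact NormedSpace.expSeries_div_hasSum_exp x

theorem wt_inner_expVec (l l' : ℝ) (ξ η : 𝓢(ℝ, ℝ)) (n : ℕ) :
    inner ℝ (wt l n • expVec ξ n) (wt l' n • expVec η n) =
      (Real.exp (l + l') * inner ℝ (schwartzL2 ξ) (schwartzL2 η)) ^ n / n.factorial := by
  rw [expVec, expVec, symL2_inner_smul_left, symL2_inner_smul_right, symL2_inner_smul_left,
    symL2_inner_smul_right, inner_tensorPow, ← mul_assoc, wt_mul, mul_pow]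
  have : (n.factorial : ℝ) ≠ 0 := by positivity
  field_simp

theorem normSq_expVec (l : ℝ) (ξ : 𝓢(ℝ, ℝ)) : normSq l (expVec ξ) < ∞ := by
  rw [normSq_lt_top_iff, memℓp_iff_summable]
  simp_rw [← real_inner_self_eq_norm_sq, wt_inner_expVec]
  exact (hasSum_exp _).summable

/-- The exponential vector at level `l`. -/
def fexp (l : ℝ) (ξ : 𝓢(ℝ, ℝ)) : Fock := toFock l (expVec ξ)

theorem fexp_apply (l : ℝ) (ξ : 𝓢(ℝ, ℝ)) (n : ℕ) : fexp l ξ n = wt l n • expVec ξ n :=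
  toFock_apply (normSq_expVec l ξ) n

theorem inner_fexp (l l' : ℝ) (ξ η : 𝓢(ℝ, ℝ)) :
    inner ℝ (fexp l ξ) (fexp l' η) =
      Real.exp (Real.exp (l + l') * inner ℝ (schwartzL2 ξ) (schwartzL2 η)) := by
  rw [lp.inner_eq_tsum]
  simp_rw [fexp_apply, wt_inner_expVec]
  exact (hasSum_exp _).tsum_eq

theorem scale_fexp {l l' : ℝ} (hl : l ≤ l') (ξ : 𝓢(ℝ, ℝ)) :
    scale (l' - l) (fexp l' ξ) = fexp l ξ := scale_toFock hl (normSq_expVec l' ξ)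

theorem tensorPow_smul (n : ℕ) (t : ℝ) (ξ : 𝓢(ℝ, ℝ)) : tensorPow n (t • ξ) = t ^ n • tensorPow n ξ := by
  refine Subtype.ext (Lp.ext ?_)
  filter_upwards [coeFn_tensor fun _ : Fin n => t • ξ, coeFn_tensor fun _ : Fin n => ξ,
    Lp.coeFn_smul (t ^ n) (tensor fun _ : Fin n => ξ)] with x h1 h2 h3
  rw [tensorPow, tensorPow, h1]
  refine Eq.trans ?_ h3.symm
  rw [Pi.smul_apply, h2]
  simp [Finset.prod_mul_distrib]

/-- If x is orthogonal to the exponential vectors of all tξ, a power series in t vanishes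
identically; its coefficients are multiples of (ξ^{⊗n}, xₙ), and polarization gives xₙ = 0. -/
theorem dense_span_fexp (l : ℝ) : Dense (Submodule.span ℝ (range (fexp l)) : Set Fock) := by
  rw [Submodule.dense_iff_topologicalClosure_eq_top, Submodule.topologicalClosure_eq_top_iff,
    Submodule.eq_bot_iff]
  intro x hx
  have h0 : ∀ ξ, inner ℝ (fexp l ξ) x = 0 := fun ξ =>
    (Submodule.mem_orthogonal _ _).1 hx _ (Submodule.subset_span ⟨ξ, rfl⟩)
  ext n : 2
  refine eq_zero_of_inner_tensorPow fun ξ => ?_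
  have h1 : (fun n => wt l n * (n.factorial : ℝ)⁻¹ * inner ℝ (tensorPow n ξ) (x n)) =
      fun _ => 0 := by
    refine coeff_eq_of_hasSum (F := fun _ => 0) (fun t => ?_) fun t => by simp
    rw [← h0 (t • ξ)]
    refine (lp.hasSum_inner (𝕜 := ℝ) (fexp l (t • ξ)) x).of_eq fun n => ?_
    rw [fexp_apply, expVec, tensorPow_smul, symL2_inner_smul_left, symL2_inner_smul_left,
      symL2_inner_smul_left]
    ring
  have h2 := congrFun h1 n
  have h3 := wt_pos l n
  have h4 : (0 : ℝ) < (n.factorial : ℝ)⁻¹ := by positivity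
  exact (mul_eq_zero.1 h2).resolve_left (mul_pos h3 h4).ne'

theorem clm_ext_fexp {X : Type*} [TopologicalSpace X] [T2Space X] [AddCommMonoid X]
    [Module ℝ X] (l : ℝ) {T T' : Fock →L[ℝ] X} (h : ∀ ξ, T (fexp l ξ) = T' (fexp l ξ)) : T = T' :=
  ContinuousLinearMap.ext_on (dense_span_fexp l) (by rintro _ ⟨ξ, rfl⟩; exact h ξ)

/-! ### Wiener integrals -/

variable {μ : Measure TemperedDist} [IsProbabilityMeasure μ]

theorem mem_wienerGenerators_iff (hμ : IsWhiteNoiseMeasure μ) (n : ℕ) (p : KernelL2 n × Lp ℝ 2 μ) :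
    p ∈ wienerGenerators μ n ↔
      ∃ ξ, p = ((tensorPow n ξ : KernelL2 n), (n.factorial : ℝ) • wickPow hμ n ξ) := by
  have key : ∀ (ξ : 𝓢(ℝ, ℝ)) ω, Real.sqrt (∫ x, ξ x ^ 2) ^ n *
      Polynomial.aeval (TemperedDist.eval ω ξ / Real.sqrt (∫ x, ξ x ^ 2)) (Polynomial.hermite n) =
        n.factorial * wickPowFn n ξ ω := by
    intro ξ ω
    rw [← norm_sq_schwartzL2, Real.sqrt_sq (norm_nonneg _), pow_mul_aeval_hermite, wickPowFn]
    intro h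
    have h1 : schwartzL2 ξ = 0 := norm_eq_zero.1 h
    have h2 : ξ = 0 := SchwartzMap.injective_toLp (E := ℝ) (F := ℝ) 2 volume (by
      refine (show schwartzL2 ξ = schwartzL2 0 from ?_)
      rw [h1, map_zero])
    rw [h2, eval_zero]
  simp only [wienerGenerators, mem_ofPred_eq, key]
  refine exists_congr fun ξ => ⟨fun ⟨h1, h2⟩ => ?_, ?_⟩
  · refine Prod.ext (Lp.ext (h1.trans (coeFn_tensor _).symm)) (Lp.ext (h2.trans ?_))
    filter_upwards [Lp.coeFn_smul (n.factorial : ℝ) (wickPow hμ n ξ), coeFn_wickPow hμ n ξ]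
      with ω h3 h4
    rw [h3, Pi.smul_apply, h4, smul_eq_mul]
  · rintro rfl
    refine ⟨coeFn_tensor _, ?_⟩
    filter_upwards [Lp.coeFn_smul (n.factorial : ℝ) (wickPow hμ n ξ), coeFn_wickPow hμ n ξ]
      with ω h3 h4
    rw [h3, Pi.smul_apply, h4, smul_eq_mul]

/-- Both sides are continuous and linear in each of p and q, so an identity on generators passes to
the closed span in one argument at a time. It is used with L = n! (·, ·) for equal orders and L = 0
for different ones. -/
theorem wienerGraph_inner (hμ : IsWhiteNoiseMeasure μ) {n m : ℕ}
    (L : KernelL2 n →L[ℝ] KernelL2 m →L[ℝ] ℝ)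
    (hL : ∀ ξ η, inner ℝ (wickPow hμ n ξ) (wickPow hμ m η) * (n.factorial * m.factorial) =
      L (tensorPow n ξ) (tensorPow m η))
    {p : KernelL2 n × Lp ℝ 2 μ} {q : KernelL2 m × Lp ℝ 2 μ}
    (hp : p ∈ wienerGraph μ n) (hq : q ∈ wienerGraph μ m) :
    inner ℝ p.2 q.2 = L p.1 q.1 := by
  have h1 : ∀ p ∈ wienerGenerators μ n, ∀ q ∈ wienerGraph μ m, inner ℝ p.2 q.2 = L p.1 q.1 := by
    intro p hp q hq
    let T : KernelL2 m × Lp ℝ 2 μ →L[ℝ] ℝ :=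
      (innerSL ℝ p.2).comp (ContinuousLinearMap.snd ℝ _ _) -
        (L p.1).comp (ContinuousLinearMap.fst ℝ _ _)
    have hle : wienerGraph μ m ≤ T.ker := by
      refine Submodule.topologicalClosure_minimal _ (Submodule.span_le.2 fun q hq => ?_) T.isClosed_ker
      obtain ⟨ξ, rfl⟩ := (mem_wienerGenerators_iff hμ n p).1 hp
      obtain ⟨η, rfl⟩ := (mem_wienerGenerators_iff hμ m q).1 hq
      simp only [T, SetLike.mem_coe, LinearMap.mem_ker]
      change inner ℝ ((n.factorial : ℝ) • wickPow hμ n ξ) ((m.factorial : ℝ) • wickPow hμ m η) -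
        L (tensorPow n ξ) (tensorPow m η) = 0
      rw [← hL, real_inner_smul_left, real_inner_smul_right]
      ring
    exact sub_eq_zero.1 (hle hq)
  let T : KernelL2 n × Lp ℝ 2 μ →L[ℝ] ℝ :=
    (innerSL ℝ q.2).comp (ContinuousLinearMap.snd ℝ _ _) -
      (L.flip q.1).comp (ContinuousLinearMap.fst ℝ _ _)
  have hle : wienerGraph μ n ≤ T.ker := by
    refine Submodule.topologicalClosure_minimal _ (Submodule.span_le.2 fun p hp => ?_) T.isClosed_ker
    refine sub_eq_zero.2 ?_
    exact (real_inner_comm _ _).trans (h1 p hp q hq)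
  exact (real_inner_comm _ _).trans (sub_eq_zero.1 (hle hp))

theorem wienerGraph_inner_self (hμ : IsWhiteNoiseMeasure μ) {n : ℕ}
    {p q : KernelL2 n × Lp ℝ 2 μ} (hp : p ∈ wienerGraph μ n) (hq : q ∈ wienerGraph μ n) :
    inner ℝ p.2 q.2 = n.factorial * inner ℝ p.1 q.1 := by
  have := wienerGraph_inner hμ ((n.factorial : ℝ) • innerSL ℝ) (fun ξ η => ?_) hp hq
  · exact this
  · rw [inner_wickPow, if_pos rfl, ← inner_tensorPow]
    have h : (n.factorial : ℝ) ≠ 0 := by positivity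
    change _ = (n.factorial : ℝ) * inner ℝ (tensorPow n ξ : KernelL2 n) (tensorPow n η)
    rw [Submodule.coe_inner]
    field_simp

theorem wienerGraph_inner_of_ne (hμ : IsWhiteNoiseMeasure μ) {n m : ℕ} (hnm : n ≠ m)
    {p : KernelL2 n × Lp ℝ 2 μ} {q : KernelL2 m × Lp ℝ 2 μ} (hp : p ∈ wienerGraph μ n)
    (hq : q ∈ wienerGraph μ m) : inner ℝ p.2 q.2 = 0 := by
  have := wienerGraph_inner hμ 0 (fun ξ η => ?_) hp hq
  · simpa using this
  · rw [inner_wickPow, if_neg hnm]; simp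

theorem norm_of_mem_wienerGraph (hμ : IsWhiteNoiseMeasure μ) {n : ℕ}
    {p : KernelL2 n × Lp ℝ 2 μ} (hp : p ∈ wienerGraph μ n) :
    ‖p.2‖ = Real.sqrt n.factorial * ‖p.1‖ := by
  have := wienerGraph_inner_self hμ hp hp
  rw [real_inner_self_eq_norm_sq, real_inner_self_eq_norm_sq] at this
  rw [← Real.sqrt_sq (norm_nonneg p.2), this, Real.sqrt_mul (by positivity),
    Real.sqrt_sq (norm_nonneg _)]

/-- The relation scales norms by exactly √n!, so it is single-valued and bounded; its domain
contains the dense span of the powers ξ^{⊗n}. -/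
theorem exists_wienerIntegral (hμ : IsWhiteNoiseMeasure μ) (n : ℕ) :
    ∃ T : symL2 n →L[ℝ] Lp ℝ 2 μ, ∀ f : symL2 n, ((f : KernelL2 n), T f) ∈ wienerGraph μ n := by
  let A : symL2 n × Lp ℝ 2 μ →L[ℝ] KernelL2 n × Lp ℝ 2 μ :=
    (symL2 n).subtypeL.prodMap (ContinuousLinearMap.id ℝ _)
  have hgen : ∀ ξ, ((tensorPow n ξ : KernelL2 n), (n.factorial : ℝ) • wickPow hμ n ξ) ∈
      wienerGraph μ n := fun ξ => Submodule.le_topologicalClosure _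
    (Submodule.subset_span ((mem_wienerGenerators_iff hμ n _).2 ⟨ξ, rfl⟩))
  obtain ⟨T, hT⟩ := exists_clm_of_isClosed_graph ((wienerGraph μ n).comap A.toLinearMap)
    ((Submodule.isClosed_topologicalClosure _).preimage A.continuous)
    (fun y hy => by
      have h1 : ((0 : KernelL2 n), y) ∈ wienerGraph μ n := hy
      have := norm_of_mem_wienerGraph hμ h1
      simpa using this)
    (Real.sqrt n.factorial) _ (dense_span_tensorPow n) (fun x hx => by
      have h2 : ∃ y, (x, y) ∈ (wienerGraph μ n).comap A.toLinearMap := by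
        induction hx using Submodule.span_induction with
        | mem x hx => obtain ⟨ξ, rfl⟩ := hx; exact ⟨_, hgen ξ⟩
        | zero => exact ⟨0, Submodule.zero_mem _⟩
        | add x y _ _ hx hy =>
          obtain ⟨a, ha⟩ := hx
          obtain ⟨b, hb⟩ := hy
          exact ⟨a + b, Submodule.add_mem _ ha hb⟩
        | smul c x _ hx =>
          obtain ⟨a, ha⟩ := hx
          exact ⟨c • a, Submodule.smul_mem _ c ha⟩
      obtain ⟨y, hy⟩ := h2
      have h1 : ((x : KernelL2 n), y) ∈ wienerGraph μ n := hy
      exact ⟨y, hy, (norm_of_mem_wienerGraph hμ h1).le⟩)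
  exact ⟨T, fun f => (hT f).1⟩

/-- The `n`-fold Wiener integral. -/
def wienerIntegral (hμ : IsWhiteNoiseMeasure μ) (n : ℕ) : symL2 n →L[ℝ] Lp ℝ 2 μ :=
  (exists_wienerIntegral hμ n).choose

theorem wienerIntegral_mem (hμ : IsWhiteNoiseMeasure μ) (n : ℕ) (f : symL2 n) :
    ((f : KernelL2 n), wienerIntegral hμ n f) ∈ wienerGraph μ n :=
  (exists_wienerIntegral hμ n).choose_spec f

theorem eq_wienerIntegral (hμ : IsWhiteNoiseMeasure μ) {n : ℕ} {f : symL2 n} {Y : Lp ℝ 2 μ}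
    (h : ((f : KernelL2 n), Y) ∈ wienerGraph μ n) : Y = wienerIntegral hμ n f := by
  have h1 := Submodule.sub_mem _ h (wienerIntegral_mem hμ n f)
  have h2 := norm_of_mem_wienerGraph hμ h1
  simp only [Prod.fst_sub, Prod.snd_sub, sub_self, norm_zero, mul_zero] at h2
  exact sub_eq_zero.1 (norm_eq_zero.1 h2)

/-- The normalized Wiener integral, as an isometry. -/
def wienerIsometry (hμ : IsWhiteNoiseMeasure μ) (n : ℕ) : symL2 n →ₗᵢ[ℝ] Lp ℝ 2 μ where
  toLinearMap := ((Real.sqrt n.factorial)⁻¹ • wienerIntegral hμ n).toLinearMap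
  norm_map' f := by
    have h := norm_of_mem_wienerGraph hμ (wienerIntegral_mem hμ n f)
    have h2 : (0 : ℝ) < Real.sqrt n.factorial := by positivity
    change ‖(Real.sqrt n.factorial)⁻¹ • wienerIntegral hμ n f‖ = ‖f‖
    rw [norm_smul]
    simp only at h
    rw [h, norm_inv, Real.norm_eq_abs, abs_of_pos h2, ← mul_assoc, inv_mul_cancel₀ h2.ne', one_mul]
    rfl

theorem wienerIsometry_apply (hμ : IsWhiteNoiseMeasure μ) (n : ℕ) (f : symL2 n) :
    wienerIsometry hμ n f = (Real.sqrt n.factorial)⁻¹ • wienerIntegral hμ n f := rfl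

theorem orthogonalFamily_wienerIsometry (hμ : IsWhiteNoiseMeasure μ) :
    OrthogonalFamily ℝ (fun n => symL2 n) (wienerIsometry hμ) := by
  intro n m hnm f g
  rw [wienerIsometry_apply, wienerIsometry_apply, real_inner_smul_left, real_inner_smul_right,
    wienerGraph_inner_of_ne hμ hnm (wienerIntegral_mem hμ n f) (wienerIntegral_mem hμ m g)]
  simp

/-- The Wiener--Itô isometry of Fock space into `L²(μ)`. -/
def chaos (hμ : IsWhiteNoiseMeasure μ) : Fock →ₗᵢ[ℝ] Lp ℝ 2 μ :=
  (orthogonalFamily_wienerIsometry hμ).linearIsometry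

theorem hasSum_chaos (hμ : IsWhiteNoiseMeasure μ) {f : ChaosSeq} (hf : normSq 0 f < ∞) :
    HasSum (fun n => wienerIntegral hμ n (f n)) (chaos hμ (toFock 0 f)) := by
  refine ((orthogonalFamily_wienerIsometry hμ).hasSum_linearIsometry (toFock 0 f)).of_eq
    fun n => ?_
  have : (0 : ℝ) < Real.sqrt n.factorial := by positivity
  rw [toFock_apply hf, map_smul, wienerIsometry_apply, smul_smul, wt]
  simp [mul_inv_cancel₀ this.ne']

theorem hasChaosExpansion_iff (hμ : IsWhiteNoiseMeasure μ) {f : ChaosSeq} (hf : normSq 0 f < ∞)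
    (X : Lp ℝ 2 μ) : HasChaosExpansion μ f X ↔ chaos hμ (toFock 0 f) = X := by
  constructor
  · rintro ⟨Y, hY, hX⟩
    have : Y = fun n => wienerIntegral hμ n (f n) := funext fun n => eq_wienerIntegral hμ (hY n)
    rw [this] at hX
    exact (hasSum_chaos hμ hf).unique hX
  · rintro rfl
    exact ⟨_, fun n => wienerIntegral_mem hμ n (f n), hasSum_chaos hμ hf⟩

theorem wienerIntegral_tensorPow (hμ : IsWhiteNoiseMeasure μ) (n : ℕ) (ξ : 𝓢(ℝ, ℝ)) :
    wienerIntegral hμ n (tensorPow n ξ) = (n.factorial : ℝ) • wickPow hμ n ξ :=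
  (eq_wienerIntegral hμ (Submodule.le_topologicalClosure _
    (Submodule.subset_span ((mem_wienerGenerators_iff hμ n _).2 ⟨ξ, rfl⟩)))).symm

theorem chaos_fexp (hμ : IsWhiteNoiseMeasure μ) (ξ : 𝓢(ℝ, ℝ)) :
    chaos hμ (fexp 0 ξ) = expRV hμ ξ := by
  have h1 := hasSum_chaos hμ (normSq_expVec 0 ξ)
  have h2 := hasSum_wickPow hμ ξ 1
  rw [one_smul] at h2
  refine h1.unique ?_
  convert h2 using 2 with n
  have : (n.factorial : ℝ) ≠ 0 := by positivity
  rw [expVec, map_smul, wienerIntegral_tensorPow, smul_smul, inv_mul_cancel₀ this, one_pow]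

end

section

variable {μ : Measure TemperedDist} [IsProbabilityMeasure μ]

/-! ### Products of exponential vectors -/

section Estimates

variable {E E' : Type*} [NormedAddCommGroup E] [InnerProductSpace ℝ E]
  [NormedAddCommGroup E'] [InnerProductSpace ℝ E'] {ι κ : Type*}

theorem norm_sum_smul_sq (s : Finset ι) (f : ι → ℝ) (u : ι → E) :
    ‖∑ i ∈ s, f i • u i‖ ^ 2 = ∑ i ∈ s, ∑ j ∈ s, f i * f j * inner ℝ (u i) (u j) := by
  rw [← real_inner_self_eq_norm_sq, sum_inner]
  refine Finset.sum_congr rfl fun i _ => ?_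
  rw [inner_sum]
  refine Finset.sum_congr rfl fun j _ => ?_
  rw [real_inner_smul_left, real_inner_smul_right, mul_assoc]

theorem integrable_norm_sum_expFn (hμ : IsWhiteNoiseMeasure μ) (s : Finset ι) (d : ι → 𝓢(ℝ, ℝ))
    (u : ι → E) : Integrable (fun ω => ‖∑ i ∈ s, expFn (d i) ω • u i‖ ^ 2) μ := by
  simp_rw [norm_sum_smul_sq]
  exact integrable_finsetSum _ fun i _ => integrable_finsetSum _ fun j _ =>
    (integrable_expFn_mul hμ _ _).mul_const _

theorem integral_norm_sum_expFn (hμ : IsWhiteNoiseMeasure μ) (s : Finset ι) (d : ι → 𝓢(ℝ, ℝ))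
    (u : ι → E) : ∫ ω, ‖∑ i ∈ s, expFn (d i) ω • u i‖ ^ 2 ∂μ =
      ∑ i ∈ s, ∑ j ∈ s, Real.exp (inner ℝ (schwartzL2 (d i)) (schwartzL2 (d j))) *
        inner ℝ (u i) (u j) := by
  simp_rw [norm_sum_smul_sq]
  rw [integral_finsetSum _ fun i _ => integrable_finsetSum _ fun j _ =>
    (integrable_expFn_mul hμ _ _).mul_const _]
  refine Finset.sum_congr rfl fun i _ => ?_
  rw [integral_finsetSum _ fun j _ => (integrable_expFn_mul hμ _ _).mul_const _]
  refine Finset.sum_congr rfl fun j _ => ?_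
  rw [integral_mul_const, integral_expFn_mul hμ]

/-- Multiplication of a Gram matrix by an exponential kernel increases it. -/
theorem norm_sum_sq_le (hμ : IsWhiteNoiseMeasure μ) (s : Finset ι) (d : ι → 𝓢(ℝ, ℝ))
    (u : ι → E) : ‖∑ i ∈ s, u i‖ ^ 2 ≤
      ∑ i ∈ s, ∑ j ∈ s, Real.exp (inner ℝ (schwartzL2 (d i)) (schwartzL2 (d j))) *
        inner ℝ (u i) (u j) := by
  rw [← integral_norm_sum_expFn hμ]
  set m := ∑ i ∈ s, u i with hm
  -- Each `expFn` has mean 1, so m is the mean of the random vector ∑ expFn(dᵢ) uᵢ. The claim is |E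
  -- X|² ≤ E|X|², obtained by integrating 2(X, m) - |m|² ≤ |X|².
  have h1 : ∫ ω, inner ℝ (∑ i ∈ s, expFn (d i) ω • u i) m ∂μ = ‖m‖ ^ 2 := by
    simp_rw [sum_inner, real_inner_smul_left]
    rw [integral_finsetSum _ fun i _ => (integrable_expFn hμ _).mul_const _]
    simp_rw [integral_mul_const, integral_expFn hμ, one_mul]
    rw [← sum_inner, ← hm, real_inner_self_eq_norm_sq]
  have hint : Integrable (fun ω => inner ℝ (∑ i ∈ s, expFn (d i) ω • u i) m) μ := by
    simp_rw [sum_inner, real_inner_smul_left]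
    exact integrable_finsetSum _ fun i _ => (integrable_expFn hμ _).mul_const _
  have h2 : ∀ ω, 2 * inner ℝ (∑ i ∈ s, expFn (d i) ω • u i) m - ‖m‖ ^ 2 ≤
      ‖∑ i ∈ s, expFn (d i) ω • u i‖ ^ 2 := fun ω => by
    have := norm_sub_sq_real (∑ i ∈ s, expFn (d i) ω • u i) m
    nlinarith [sq_nonneg ‖∑ i ∈ s, expFn (d i) ω • u i - m‖]
  have h3 := integral_mono ((hint.const_mul 2).sub (integrable_const _))
    (integrable_norm_sum_expFn hμ s d u) h2
  simp only [Pi.sub_apply] at h3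
  rw [integral_sub (hint.const_mul 2) (integrable_const _), integral_const_mul, h1] at h3
  simp only [integral_const, probReal_univ, one_smul] at h3
  linarith

/-- The vectors w(i, j) behave like uᵢ ⊗ vⱼ. With F = ∑ expFn(ξᵢ) uᵢ and G = ∑ expFn(ηⱼ) vⱼ, the
vector on the left is the mean of F ⊗ G, because exp(ξ, η) is the mean of expFn(ξ) expFn(η). The
bound is Cauchy–Schwarz applied to |F| |G|. -/
theorem norm_sum_gram_le (hμ : IsWhiteNoiseMeasure μ) {W : Type*} [NormedAddCommGroup W]
    [InnerProductSpace ℝ W] (s : Finset ι) (t : Finset κ)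
    (ξ : ι → 𝓢(ℝ, ℝ)) (η : κ → 𝓢(ℝ, ℝ)) (u : ι → E) (v : κ → E') (w : ι × κ → W)
    (hw : ∀ p q, inner ℝ (w p) (w q) = inner ℝ (u p.1) (u q.1) * inner ℝ (v p.2) (v q.2)) :
    ‖∑ p ∈ s ×ˢ t, Real.exp (inner ℝ (schwartzL2 (ξ p.1)) (schwartzL2 (η p.2))) • w p‖ ^ 2 ≤
      (∫ ω, ‖∑ i ∈ s, expFn (ξ i) ω • u i‖ ^ 2 ∂μ) *
        ∫ ω, ‖∑ j ∈ t, expFn (η j) ω • v j‖ ^ 2 ∂μ := by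
  set m : W := ∑ p ∈ s ×ˢ t,
    Real.exp (inner ℝ (schwartzL2 (ξ p.1)) (schwartzL2 (η p.2))) • w p with hm
  let F : TemperedDist → E := fun ω => ∑ i ∈ s, expFn (ξ i) ω • u i
  let G : TemperedDist → E' := fun ω => ∑ j ∈ t, expFn (η j) ω • v j
  let H : TemperedDist → W := fun ω => ∑ p ∈ s ×ˢ t, (expFn (ξ p.1) ω * expFn (η p.2) ω) • w p
  have hFG : ∀ ω, ‖H ω‖ = ‖F ω‖ * ‖G ω‖ := fun ω => by
    rw [← sq_eq_sq₀ (norm_nonneg _) (by positivity), mul_pow]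
    simp only [H, F, G]
    rw [norm_sum_smul_sq, norm_sum_smul_sq, norm_sum_smul_sq, Finset.sum_mul_sum]
    simp_rw [Finset.sum_product, Finset.sum_mul_sum, hw]
    refine Finset.sum_congr rfl fun i _ => Finset.sum_congr rfl fun j _ =>
      Finset.sum_congr rfl fun k _ => Finset.sum_congr rfl fun l _ => ?_
    ring
  have h1 : ∫ ω, inner ℝ (H ω) m ∂μ = ‖m‖ ^ 2 := by
    simp_rw [H, sum_inner, real_inner_smul_left]
    rw [integral_finsetSum _ fun p _ => (integrable_expFn_mul hμ _ _).mul_const _]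
    simp_rw [integral_mul_const, integral_expFn_mul hμ, ← real_inner_smul_left]
    rw [← sum_inner, ← hm, real_inner_self_eq_norm_sq]
  have hint : Integrable (fun ω => inner ℝ (H ω) m) μ := by
    simp_rw [H, sum_inner, real_inner_smul_left]
    exact integrable_finsetSum _ fun p _ => (integrable_expFn_mul hμ _ _).mul_const _
  have hF := integrable_norm_sum_expFn hμ s ξ u
  have hG := integrable_norm_sum_expFn hμ t η v
  -- Cauchy–Schwarz is used through |F||G| ≤ (c|F|² + c⁻¹|G|²)/2 with c free; c = ‖m‖ / A gives the
  -- product bound when A > 0, and c = (B + 1) / ‖m‖ excludes A = 0.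
  have h2 : ∀ c : ℝ, 0 < c → ‖m‖ ^ 2 ≤
      ‖m‖ * ((c * (∫ ω, ‖F ω‖ ^ 2 ∂μ) + c⁻¹ * ∫ ω, ‖G ω‖ ^ 2 ∂μ) / 2) := fun c hc => by
    have h3 : ∀ ω, inner ℝ (H ω) m ≤
        ‖m‖ * ((c * ‖F ω‖ ^ 2 + c⁻¹ * ‖G ω‖ ^ 2) / 2) := fun ω => by
      refine (real_inner_le_norm _ _).trans ?_
      rw [hFG, mul_comm]
      refine mul_le_mul_of_nonneg_left ?_ (norm_nonneg _)
      have h4 : c * ‖F ω‖ ^ 2 + c⁻¹ * ‖G ω‖ ^ 2 - 2 * (‖F ω‖ * ‖G ω‖)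
          = c⁻¹ * (c * ‖F ω‖ - ‖G ω‖) ^ 2 := by field_simp; ring
      have h5 : 0 ≤ c⁻¹ * (c * ‖F ω‖ - ‖G ω‖) ^ 2 := by positivity
      linarith
    rw [← h1]
    refine (integral_mono hint ((((hF.const_mul c).add (hG.const_mul c⁻¹)).div_const 2).const_mul
      ‖m‖) h3).trans_eq ?_
    simp only [Pi.add_apply]
    rw [integral_const_mul, integral_div, integral_add (hF.const_mul c) (hG.const_mul c⁻¹),
      integral_const_mul, integral_const_mul]
  set A := ∫ ω, ‖F ω‖ ^ 2 ∂μ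
  set B := ∫ ω, ‖G ω‖ ^ 2 ∂μ
  have hA : 0 ≤ A := integral_nonneg fun ω => sq_nonneg _
  have hB : 0 ≤ B := integral_nonneg fun ω => sq_nonneg _
  change ‖m‖ ^ 2 ≤ A * B
  rcases (norm_nonneg m).eq_or_lt with h0 | h0
  · rw [← h0, zero_pow two_ne_zero]; positivity
  have h6 : ∀ c : ℝ, 0 < c → 2 * ‖m‖ ≤ c * A + c⁻¹ * B := fun c hc => by
    have := h2 c hc
    rw [sq, mul_le_mul_iff_right₀ h0] at this
    linarith
  rcases hA.eq_or_lt with hA0 | hA0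
  · exfalso
    have := h6 ((B + 1) / ‖m‖) (by positivity)
    rw [← hA0, mul_zero, zero_add, inv_div, div_mul_eq_mul_div, le_div_iff₀ (by positivity)] at this
    nlinarith
  · have := h6 (‖m‖ / A) (by positivity)
    rw [div_mul_cancel₀ _ hA0.ne', inv_div, div_mul_eq_mul_div] at this
    have h7 : ‖m‖ ≤ A * B / ‖m‖ := by linarith
    rwa [le_div_iff₀ h0, ← sq] at h7

-- The Gram form of the previous bound, with uᵢ ⊗ vⱼ in the tensor product of the two spaces.
open scoped TensorProduct in
theorem sum_gram_le (hμ : IsWhiteNoiseMeasure μ) (s : Finset ι) (t : Finset κ)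
    (ξ : ι → 𝓢(ℝ, ℝ)) (η : κ → 𝓢(ℝ, ℝ)) (u : ι → E) (v : κ → E') :
    ∑ p ∈ s ×ˢ t, ∑ q ∈ s ×ˢ t,
      Real.exp (inner ℝ (schwartzL2 (ξ p.1)) (schwartzL2 (η p.2))) *
        Real.exp (inner ℝ (schwartzL2 (ξ q.1)) (schwartzL2 (η q.2))) *
          (inner ℝ (u p.1) (u q.1) * inner ℝ (v p.2) (v q.2)) ≤
      (∫ ω, ‖∑ i ∈ s, expFn (ξ i) ω • u i‖ ^ 2 ∂μ) *
        ∫ ω, ‖∑ j ∈ t, expFn (η j) ω • v j‖ ^ 2 ∂μ := by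
  have hw : ∀ p q : ι × κ, inner ℝ (u p.1 ⊗ₜ[ℝ] v p.2) (u q.1 ⊗ₜ[ℝ] v q.2) =
      inner ℝ (u p.1) (u q.1) * inner ℝ (v p.2) (v q.2) := fun p q =>
    TensorProduct.inner_tmul ℝ _ _ _ _
  refine le_trans (le_of_eq ?_) (norm_sum_gram_le (W := E ⊗[ℝ] E') hμ s t ξ η u v
    (fun p => u p.1 ⊗ₜ[ℝ] v p.2) hw)
  rw [norm_sum_smul_sq]
  exact Finset.sum_congr rfl fun p _ => Finset.sum_congr rfl fun q _ =>
    congrArg _ (hw p q).symm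

end Estimates

/-- On the left the Gram matrix contains exp(e^{2l}(ξ+η, ξ'+η')), which couples ξ with η'.
Multiplying by exp(e^{2l}(ξ-η, ξ'-η')) only increases the norm and, as in the parallelogram law,
leaves exp(2e^{2l}((ξ, ξ') + (η, η'))), a product. `sum_gram_le` treats the weights exp(ξ, η) at the
price of another exp(ξ, ξ') for each factor, whence e^{2l'} = 1 + 2e^{2l}. -/
theorem norm_sum_fexp_mul_le_aux (hμ : IsWhiteNoiseMeasure μ) {l l' : ℝ}
    (hl : Real.exp (l' + l') = 1 + 2 * Real.exp (l + l)) (s t : Finset 𝓢(ℝ, ℝ))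
    (a b : 𝓢(ℝ, ℝ) → ℝ) :
    ‖∑ p ∈ s ×ˢ t, (a p.1 * b p.2 * Real.exp (inner ℝ (schwartzL2 p.1) (schwartzL2 p.2))) •
        fexp l (p.1 + p.2)‖ ^ 2 ≤
      ‖∑ ξ ∈ s, a ξ • fexp l' ξ‖ ^ 2 * ‖∑ η ∈ t, b η • fexp l' η‖ ^ 2 := by
  -- The shift by log 2 / 2 doubles e^{2l}; it produces the 2 in 1 + 2e^{2l}.
  have key : ∀ (s : Finset 𝓢(ℝ, ℝ)) (a : 𝓢(ℝ, ℝ) → ℝ),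
      ∫ ω, ‖∑ ξ ∈ s, expFn ξ ω • a ξ • fexp (l + Real.log 2 / 2) ξ‖ ^ 2 ∂μ =
        ‖∑ ξ ∈ s, a ξ • fexp l' ξ‖ ^ 2 := fun s a => by
    rw [integral_norm_sum_expFn hμ s (fun ξ => ξ), norm_sum_smul_sq]
    refine Finset.sum_congr rfl fun ξ _ => Finset.sum_congr rfl fun η _ => ?_
    rw [real_inner_smul_left, real_inner_smul_right, inner_fexp, inner_fexp, hl,
      show l + Real.log 2 / 2 + (l + Real.log 2 / 2) = Real.log 2 + (l + l) by ring, Real.exp_add,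
      Real.exp_log two_pos, add_mul 1, one_mul, Real.exp_add (inner ℝ _ _)]
    ring
  rw [← key s a, ← key t b]
  refine le_trans ?_ (sum_gram_le hμ s t (fun ξ => ξ) (fun η => η) _ _)
  refine (norm_sum_sq_le hμ _ (fun p => Real.exp l • (p.1 - p.2)) _).trans_eq ?_
  refine Finset.sum_congr rfl fun p _ => Finset.sum_congr rfl fun q _ => ?_
  simp only [real_inner_smul_left, real_inner_smul_right, inner_fexp, map_smul, map_add, map_sub,
    inner_add_left, inner_add_right, inner_sub_left, inner_sub_right]
  rw [show l + Real.log 2 / 2 + (l + Real.log 2 / 2) = Real.log 2 + (l + l) by ring, Real.exp_add (Real.log 2),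
    Real.exp_log two_pos, Real.exp_add l l]
  set x := inner ℝ (schwartzL2 p.1) (schwartzL2 q.1)
  set y := inner ℝ (schwartzL2 p.2) (schwartzL2 q.2)
  set z := inner ℝ (schwartzL2 p.1) (schwartzL2 q.2)
  set w := inner ℝ (schwartzL2 p.2) (schwartzL2 q.1)
  have : ∀ r : ℝ, Real.exp (r * (r * (x - w) - r * (z - y))) *
      Real.exp (r * r * (x + w + (z + y))) =
        Real.exp (2 * (r * r) * x) * Real.exp (2 * (r * r) * y) := fun r => by
    rw [← Real.exp_add, ← Real.exp_add]
    congr 1; ring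
  linear_combination (a p.1 * b p.2 * Real.exp (inner ℝ (schwartzL2 p.1) (schwartzL2 p.2))) *
    (a q.1 * b q.2 * Real.exp (inner ℝ (schwartzL2 q.1) (schwartzL2 q.2))) * this (Real.exp l)

theorem norm_scale_le (d : ℝ) (x : Fock) : ‖scale d x‖ ≤ ‖x‖ := by
  refine fock_norm_le_of_forall fun n => ?_
  rw [scale_apply, norm_smul, Real.norm_eq_abs, abs_of_nonneg (by positivity)]
  exact mul_le_of_le_one_left (norm_nonneg _)
    (pow_le_one₀ (Real.exp_pos _).le (Real.exp_le_one_iff.2 (by simp)))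

/-- One level suffices for l ≥ 0: then e^{2l} ≥ 1, so 1 + 2e^{2l} ≤ 3e^{2l} ≤ e^{2(l+1)}. -/
theorem norm_sum_fexp_mul_le (hμ : IsWhiteNoiseMeasure μ) {l : ℝ} (hl : 0 ≤ l)
    (s t : Finset 𝓢(ℝ, ℝ)) (a b : 𝓢(ℝ, ℝ) → ℝ) :
    ‖∑ p ∈ s ×ˢ t, (a p.1 * b p.2 * Real.exp (inner ℝ (schwartzL2 p.1) (schwartzL2 p.2))) •
        fexp l (p.1 + p.2)‖ ≤
      ‖∑ ξ ∈ s, a ξ • fexp (l + 1) ξ‖ * ‖∑ η ∈ t, b η • fexp (l + 1) η‖ := by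
  have hpos : 0 < 1 + 2 * Real.exp (l + l) := by positivity
  set l' := Real.log (1 + 2 * Real.exp (l + l)) / 2 with hl'
  have h1 : Real.exp (l' + l') = 1 + 2 * Real.exp (l + l) := by
    rw [hl', add_halves, Real.exp_log hpos]
  have h2 : l' ≤ l + 1 := by
    have h3 : 1 ≤ Real.exp (l + l) := Real.one_le_exp (by linarith)
    have h4 : 3 ≤ Real.exp (1 + 1) := by
      have := Real.add_one_le_exp (1 + 1 : ℝ); linarith
    have h5 : Real.exp (l' + l') ≤ Real.exp ((l + 1) + (l + 1)) := by
      rw [h1, show l + 1 + (l + 1) = (l + l) + (1 + 1) by ring, Real.exp_add (l + l)]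
      nlinarith
    have := Real.exp_le_exp.1 h5
    linarith
  have h3 : ∀ (s : Finset 𝓢(ℝ, ℝ)) (a : 𝓢(ℝ, ℝ) → ℝ),
      ‖∑ ξ ∈ s, a ξ • fexp l' ξ‖ ≤ ‖∑ ξ ∈ s, a ξ • fexp (l + 1) ξ‖ := fun s a => by
    have := norm_scale_le (l + 1 - l') (∑ ξ ∈ s, a ξ • fexp (l + 1) ξ)
    simpa only [map_sum, map_smul, scale_fexp h2] using this
  refine le_trans ?_ (mul_le_mul (h3 s a) (h3 t b) (norm_nonneg _) (norm_nonneg _))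
  rw [← sq_le_sq₀ (norm_nonneg _) (by positivity), mul_pow]
  exact norm_sum_fexp_mul_le_aux hμ h1 s t a b

/-! ### The product on Fock space -/

/-- The random variable with given Fock space coordinates at level `l`. -/
def rv (hμ : IsWhiteNoiseMeasure μ) (l : ℝ) : Fock →L[ℝ] Lp ℝ 2 μ :=
  (chaos hμ).toContinuousLinearMap.comp (scale l)

theorem rv_toFock (hμ : IsWhiteNoiseMeasure μ) {l : ℝ} (hl : 0 ≤ l) {f : ChaosSeq}
    (hf : normSq l f < ∞) : rv hμ l (toFock l f) = chaos hμ (toFock 0 f) := by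
  have := scale_toFock hl hf
  rw [sub_zero] at this
  rw [← this]
  rfl

theorem rv_fexp (hμ : IsWhiteNoiseMeasure μ) {l : ℝ} (hl : 0 ≤ l) (ξ : 𝓢(ℝ, ℝ)) :
    rv hμ l (fexp l ξ) = expRV hμ ξ :=
  (rv_toFock hμ hl (normSq_expVec l ξ)).trans (chaos_fexp hμ ξ)

theorem rv_injective (hμ : IsWhiteNoiseMeasure μ) (l : ℝ) : Function.Injective (rv hμ l) :=
  (chaos hμ).injective.comp (scale_injective l)

/-- Pointwise multiplication `L² × L² → L¹`. -/
def mulL1 (μ : Measure TemperedDist) : Lp ℝ 2 μ →L[ℝ] Lp ℝ 2 μ →L[ℝ] Lp ℝ 1 μ :=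
  (ContinuousLinearMap.mul ℝ ℝ).holderL μ 2 2 1

theorem coeFn_mulL1 (f g : Lp ℝ 2 μ) : mulL1 μ f g =ᵐ[μ] fun ω => f ω * g ω :=
  (ContinuousLinearMap.mul ℝ ℝ).coeFn_holder f g

/-- The constant `1` as an element of `L²`. -/
def oneL2 (μ : Measure TemperedDist) [IsProbabilityMeasure μ] : Lp ℝ 2 μ :=
  (memLp_const (1 : ℝ)).toLp _

theorem coeFn_mulL1_one (f : Lp ℝ 2 μ) : mulL1 μ f (oneL2 μ) =ᵐ[μ] f := by
  filter_upwards [coeFn_mulL1 f (oneL2 μ), (memLp_const (μ := μ) (p := 2) (1 : ℝ)).coeFn_toLp]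
    with ω h1 h2
  rw [h1, oneL2, h2, mul_one]

/-- Multiplication by 1 embeds L² in L¹, where products live; this makes "z equals xy" an equation
between continuous maps. -/
theorem mulL1_one_injective {f g : Lp ℝ 2 μ} (h : mulL1 μ f (oneL2 μ) = mulL1 μ g (oneL2 μ)) :
    f = g := by
  ext1
  exact (coeFn_mulL1_one f).symm.trans ((by rw [h] : _ =ᵐ[μ] _).trans (coeFn_mulL1_one g))

theorem mulL1_expRV (hμ : IsWhiteNoiseMeasure μ) (ξ η : 𝓢(ℝ, ℝ)) :
    mulL1 μ (expRV hμ ξ) (expRV hμ η) =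
      mulL1 μ (Real.exp (inner ℝ (schwartzL2 ξ) (schwartzL2 η)) • expRV hμ (ξ + η)) (oneL2 μ) := by
  ext1
  filter_upwards [coeFn_mulL1 (expRV hμ ξ) (expRV hμ η), coeFn_mulL1_one
    (Real.exp (inner ℝ (schwartzL2 ξ) (schwartzL2 η)) • expRV hμ (ξ + η)), coeFn_expRV hμ ξ,
    coeFn_expRV hμ η, coeFn_expRV hμ (ξ + η), Lp.coeFn_smul
      (Real.exp (inner ℝ (schwartzL2 ξ) (schwartzL2 η))) (expRV hμ (ξ + η))] with ω h1 h2 h3 h4 h5 h6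
  rw [h1, h2, h3, h4, h6, Pi.smul_apply, h5, expFn_mul, smul_eq_mul]

/-- The relation `z = x · y`, with `x`, `y` given at level `l + 1` and `z` at level `l`. -/
def IsMul (hμ : IsWhiteNoiseMeasure μ) (l : ℝ) (x y z : Fock) : Prop :=
  mulL1 μ (rv hμ (l + 1) x) (rv hμ (l + 1) y) = mulL1 μ (rv hμ l z) (oneL2 μ)

theorem IsMul.unique {hμ : IsWhiteNoiseMeasure μ} {l : ℝ} {x y z z' : Fock}
    (h : IsMul hμ l x y z) (h' : IsMul hμ l x y z') : z = z' :=
  rv_injective hμ l (mulL1_one_injective (h.symm.trans h'))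

theorem IsMul.symm {hμ : IsWhiteNoiseMeasure μ} {l : ℝ} {x y z : Fock}
    (h : IsMul hμ l x y z) : IsMul hμ l y x z := by
  refine Eq.trans ?_ h
  ext1
  filter_upwards [coeFn_mulL1 (rv hμ (l + 1) x) (rv hμ (l + 1) y),
    coeFn_mulL1 (rv hμ (l + 1) y) (rv hμ (l + 1) x)] with ω h1 h2
  rw [h1, h2, mul_comm]

theorem IsMul.add_right {hμ : IsWhiteNoiseMeasure μ} {l : ℝ} {x y y' z z' : Fock}
    (h : IsMul hμ l x y z) (h' : IsMul hμ l x y' z') : IsMul hμ l x (y + y') (z + z') := by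
  unfold IsMul at *
  rw [map_add, map_add, map_add, map_add, h, h', add_apply]

theorem IsMul.smul_right {hμ : IsWhiteNoiseMeasure μ} {l : ℝ} {x y z : Fock}
    (h : IsMul hμ l x y z) (c : ℝ) : IsMul hμ l x (c • y) (c • z) := by
  unfold IsMul at *
  rw [map_smul, map_smul, map_smul, map_smul, h, smul_apply]

theorem isMul_fexp (hμ : IsWhiteNoiseMeasure μ) {l : ℝ} (hl : 0 ≤ l) (ξ η : 𝓢(ℝ, ℝ)) :
    IsMul hμ l (fexp (l + 1) ξ) (fexp (l + 1) η)
      (Real.exp (inner ℝ (schwartzL2 ξ) (schwartzL2 η)) • fexp l (ξ + η)) := by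
  rw [IsMul, rv_fexp hμ (by linarith), rv_fexp hμ (by linarith), map_smul, rv_fexp hμ hl,
    mulL1_expRV]

theorem exists_isMul_of_mem_span (hμ : IsWhiteNoiseMeasure μ) {l : ℝ} (hl : 0 ≤ l) {x y : Fock}
    (hx : x ∈ Submodule.span ℝ (range (fexp (l + 1))))
    (hy : y ∈ Submodule.span ℝ (range (fexp (l + 1)))) :
    ∃ z, IsMul hμ l x y z ∧ ‖z‖ ≤ ‖x‖ * ‖y‖ := by
  obtain ⟨a, rfl⟩ := (Finsupp.mem_span_range_iff_exists_finsupp).1 hx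
  obtain ⟨b, rfl⟩ := (Finsupp.mem_span_range_iff_exists_finsupp).1 hy
  refine ⟨_, ?_, norm_sum_fexp_mul_le hμ hl a.support b.support a b⟩
  simp only [Finsupp.sum]
  have h := fun ξ η => isMul_fexp hμ hl ξ η
  unfold IsMul at *
  simp only [map_sum, map_smul, sum_apply, smul_apply] at h ⊢
  rw [Finset.sum_product_right]
  refine Finset.sum_congr rfl fun ξ _ => ?_
  rw [Finset.smul_sum]
  refine Finset.sum_congr rfl fun η _ => ?_
  rw [h, smul_smul, smul_smul]
  congr 1; ring

/-- For fixed x the relation between y and z is the kernel of a continuous operator, and uniqueness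
of the product makes it single-valued, so the bound on exponentials extends to every y. -/
theorem exists_isMul_clm (hμ : IsWhiteNoiseMeasure μ) {l : ℝ} {x : Fock}
    (hx : ∀ y ∈ Submodule.span ℝ (range (fexp (l + 1))),
      ∃ z, IsMul hμ l x y z ∧ ‖z‖ ≤ ‖x‖ * ‖y‖) (y : Fock) :
    ∃ z, IsMul hμ l x y z ∧ ‖z‖ ≤ ‖x‖ * ‖y‖ := by
  let A : Fock × Fock →L[ℝ] Lp ℝ 1 μ :=
    ((mulL1 μ (rv hμ (l + 1) x)).comp (rv hμ (l + 1))).comp (ContinuousLinearMap.fst ℝ _ _) -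
      (((mulL1 μ).flip (oneL2 μ)).comp (rv hμ l)).comp (ContinuousLinearMap.snd ℝ _ _)
  have hA : ∀ y z, (y, z) ∈ A.ker ↔ IsMul hμ l x y z := fun y z => by
    rw [LinearMap.mem_ker]
    exact sub_eq_zero
  obtain ⟨T, hT⟩ := exists_clm_of_isClosed_graph A.ker A.isClosed_ker
    (fun z hz => ((hA _ _).1 hz).unique (by simp [IsMul])) ‖x‖ _ (dense_span_fexp (l + 1))
    (fun y hy => by
      obtain ⟨z, hz, hz'⟩ := hx y hy
      exact ⟨z, (hA _ _).2 hz, hz'⟩)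
  exact ⟨T y, (hA _ _).1 (hT y).1, (hT y).2⟩

theorem exists_isMul (hμ : IsWhiteNoiseMeasure μ) {l : ℝ} (hl : 0 ≤ l) (x y : Fock) :
    ∃ z, IsMul hμ l x y z ∧ ‖z‖ ≤ ‖x‖ * ‖y‖ := by
  refine exists_isMul_clm hμ (fun y hy => ?_) y
  -- The extension is used twice: with one factor in the span of exponentials, and, by symmetry of
  -- the product, with an arbitrary one.
  obtain ⟨z, hz, hz'⟩ := exists_isMul_clm hμ (x := y)
    (fun x hx => exists_isMul_of_mem_span hμ hl hy hx) x
  exact ⟨z, hz.symm, by rwa [mul_comm]⟩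

/-- The product of random variables in Fock space coordinates: the factors are given at level
`l + 1`, the product at level `l`. -/
def mulFock (hμ : IsWhiteNoiseMeasure μ) {l : ℝ} (hl : 0 ≤ l) : Fock →L[ℝ] Fock →L[ℝ] Fock :=
  have hz := fun x y => (exists_isMul hμ hl x y).choose_spec
  LinearMap.mkContinuous₂
    (LinearMap.mk₂ ℝ (fun x y => (exists_isMul hμ hl x y).choose)
      (fun x x' y => (hz _ _).1.unique ((hz x y).1.symm.add_right (hz x' y).1.symm).symm)
      (fun c x y => (hz _ _).1.unique ((hz x y).1.symm.smul_right c).symm)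
      (fun x y y' => (hz _ _).1.unique ((hz x y).1.add_right (hz x y').1))
      (fun c x y => (hz _ _).1.unique ((hz x y).1.smul_right c))) 1
    fun x y => by rw [one_mul]; exact (hz x y).2

theorem isMul_mulFock (hμ : IsWhiteNoiseMeasure μ) {l : ℝ} (hl : 0 ≤ l) (x y : Fock) :
    IsMul hμ l x y (mulFock hμ hl x y) := (exists_isMul hμ hl x y).choose_spec.1

theorem mulFock_comm (hμ : IsWhiteNoiseMeasure μ) {l : ℝ} (hl : 0 ≤ l) (x y : Fock) :
    mulFock hμ hl x y = mulFock hμ hl y x :=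
  (isMul_mulFock hμ hl x y).unique (isMul_mulFock hμ hl y x).symm

theorem mulFock_fexp (hμ : IsWhiteNoiseMeasure μ) {l : ℝ} (hl : 0 ≤ l) (ξ η : 𝓢(ℝ, ℝ)) :
    mulFock hμ hl (fexp (l + 1) ξ) (fexp (l + 1) η) =
      Real.exp (inner ℝ (schwartzL2 ξ) (schwartzL2 η)) • fexp l (ξ + η) :=
  (isMul_mulFock hμ hl _ _).unique (isMul_fexp hμ hl ξ η)

theorem rv_mulFock (hμ : IsWhiteNoiseMeasure μ) {l : ℝ} (hl : 0 ≤ l) (x y : Fock) :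
    rv hμ l (mulFock hμ hl x y) =ᵐ[μ] fun ω => rv hμ (l + 1) x ω * rv hμ (l + 1) y ω := by
  refine (coeFn_mulL1_one _).symm.trans ?_
  rw [← isMul_mulFock hμ hl x y]
  exact coeFn_mulL1 _ _

end

section

variable {μ : Measure TemperedDist}

/-! ### Pairing of generalized and test random variables -/

theorem TestRV.normSq_kernel (ψ : TestRV μ) (l : ℝ) : normSq l ψ.kernel < ∞ :=
  (normSq_mono (le_max_left l 1) _).trans_lt
    (ψ.normSq_lt_top _ (lt_max_of_lt_right one_pos))

/-- The coordinates of a test random variable in Fock space, at level `l`. -/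
def TestRV.toFock (ψ : TestRV μ) (l : ℝ) : Fock := WhiteNoise.toFock l ψ.kernel

theorem hasSum_pairing {l : ℝ} {Φ : GStar} (hΦ : normSq (-l) Φ.1 < ∞) (ψ : TestRV μ) :
    HasSum (fun n => (n.factorial : ℝ) * inner ℝ (Φ.1 n) (ψ.kernel n))
      (inner ℝ (toFock (-l) Φ.1) (ψ.toFock l)) :=
  hasSum_inner_toFock hΦ (ψ.normSq_kernel l)

theorem pairing_eq {l : ℝ} {Φ : GStar} (hΦ : normSq (-l) Φ.1 < ∞) (ψ : TestRV μ) :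
    pairing Φ ψ = inner ℝ (toFock (-l) Φ.1) (ψ.toFock l) := (hasSum_pairing hΦ ψ).tsum_eq

theorem summable_pairing (Φ : GStar) (ψ : TestRV μ) :
    Summable fun n => (n.factorial : ℝ) * inner ℝ (Φ.1 n) (ψ.kernel n) := by
  obtain ⟨l, _, hl⟩ := Φ.2
  exact (hasSum_pairing hl ψ).summable

theorem pairing_add (Φ Ψ : GStar) (ψ : TestRV μ) :
    pairing (Φ + Ψ) ψ = pairing Φ ψ + pairing Ψ ψ := by
  rw [pairing, pairing, pairing, ← (summable_pairing Φ ψ).tsum_add (summable_pairing Ψ ψ)]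
  refine tsum_congr fun n => ?_
  rw [← mul_add, ← inner_add_left]
  rfl

theorem pairing_smul (c : ℝ) (Φ : GStar) (ψ : TestRV μ) :
    pairing (c • Φ) ψ = c * pairing Φ ψ := by
  rw [pairing, pairing, ← tsum_mul_left]
  refine tsum_congr fun n => ?_
  have : inner ℝ ((c • Φ).1 n) (ψ.kernel n) = c * inner ℝ (Φ.1 n) (ψ.kernel n) :=
    symL2_inner_smul_left c _ _
  rw [this, mul_left_comm]

theorem pairing_sub (Φ Ψ : GStar) (ψ : TestRV μ) :
    pairing (Φ - Ψ) ψ = pairing Φ ψ - pairing Ψ ψ := by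
  have := pairing_add (Φ - Ψ) Ψ ψ
  rw [sub_add_cancel] at this
  linarith

variable [IsProbabilityMeasure μ]

/-- The test random variable with given kernels. -/
def TestRV.ofKernel (hμ : IsWhiteNoiseMeasure μ) (f : ChaosSeq)
    (hf : ∀ l : ℝ, 0 < l → normSq l f < ∞) : TestRV μ where
  toLp := chaos hμ (WhiteNoise.toFock 0 f)
  kernel := f
  hasChaosExpansion := (hasChaosExpansion_iff hμ
    ((normSq_mono zero_le_one f).trans_lt (hf 1 one_pos)) _).2 rfl
  normSq_lt_top := hf

theorem TestRV.toLp_eq (hμ : IsWhiteNoiseMeasure μ) (ψ : TestRV μ) :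
    ψ.toLp = chaos hμ (ψ.toFock 0) :=
  ((hasChaosExpansion_iff hμ (ψ.normSq_kernel 0) _).1 ψ.hasChaosExpansion).symm

theorem TestRV.rv_toFock (hμ : IsWhiteNoiseMeasure μ) (ψ : TestRV μ) {l : ℝ} (hl : 0 ≤ l) :
    rv hμ l (ψ.toFock l) = ψ.toLp :=
  (WhiteNoise.rv_toFock hμ hl (ψ.normSq_kernel l)).trans (ψ.toLp_eq hμ).symm

theorem TestRV.kernel_eq (hμ : IsWhiteNoiseMeasure μ) {χ χ' : TestRV μ} (h : χ.toLp = χ'.toLp) :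
    χ.kernel = χ'.kernel := by
  rw [χ.toLp_eq hμ, χ'.toLp_eq hμ] at h
  rw [← ofFock_toFock (χ.normSq_kernel 0), ← ofFock_toFock (χ'.normSq_kernel 0)]
  exact congrArg (ofFock 0) ((chaos hμ).injective h)

theorem pairing_congr (hμ : IsWhiteNoiseMeasure μ) {χ χ' : TestRV μ} (h : χ.toLp = χ'.toLp)
    (Φ : GStar) : pairing Φ χ = pairing Φ χ' := by
  rw [pairing, pairing, TestRV.kernel_eq hμ h]

theorem normSq_single (l : ℝ) (n : ℕ) (f : symL2 n) : normSq l (Pi.single n f) < ∞ := by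
  rw [normSq_lt_top_iff, memℓp_iff_summable]
  refine summable_of_hasFiniteSupport ((finite_singleton n).subset fun m hm => ?_)
  by_contra hmn
  have : (Pi.single n f : ChaosSeq) m = 0 :=
    Function.update_of_ne (β := fun n => symL2 n) hmn f 0
  simp [this] at hm

/-- The test random variable `Iₙ(f)`. -/
def TestRV.single (hμ : IsWhiteNoiseMeasure μ) (n : ℕ) (f : symL2 n) : TestRV μ :=
  TestRV.ofKernel hμ (Pi.single n f) fun l _ => normSq_single l n f

theorem pairing_single (hμ : IsWhiteNoiseMeasure μ) (n : ℕ) (f : symL2 n) (Φ : GStar) :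
    pairing Φ (TestRV.single hμ n f) = n.factorial * inner ℝ (Φ.1 n) f := by
  rw [pairing, tsum_eq_single n]
  · simp [TestRV.single, TestRV.ofKernel]
  · intro m hm
    have : (Pi.single n f : ChaosSeq) m = 0 :=
      Function.update_of_ne (β := fun n => symL2 n) hm f 0
    simp [TestRV.single, TestRV.ofKernel, this]

/-- Test random variables separate the points of `𝒢*`. -/
theorem pairing_ext (hμ : IsWhiteNoiseMeasure μ) {Φ Ψ : GStar}
    (h : ∀ ψ : TestRV μ, pairing Φ ψ = pairing Ψ ψ) : Φ = Ψ := by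
  refine Subtype.ext (funext fun n => ext_inner_right ℝ fun f => ?_)
  have h1 := h (TestRV.single hμ n f)
  rw [pairing_single, pairing_single] at h1
  exact mul_left_cancel₀ (by positivity) h1

/-! ### The product -/

theorem rv_mulFock_testRV (hμ : IsWhiteNoiseMeasure μ) {l : ℝ} (hl : 0 ≤ l) (φ ψ : TestRV μ) :
    rv hμ l (mulFock hμ hl (φ.toFock (l + 1)) (ψ.toFock (l + 1))) =ᵐ[μ]
      fun ω => φ.toLp ω * ψ.toLp ω := by
  have := rv_mulFock hμ hl (φ.toFock (l + 1)) (ψ.toFock (l + 1))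
  rwa [φ.rv_toFock hμ (by linarith), ψ.rv_toFock hμ (by linarith)] at this

/-- Both sides are the kernels of one random variable, the pointwise product. Hence its kernels have
finite norm at every level, so 𝒢 is closed under multiplication. -/
theorem toFock_ofFock_mulFock (hμ : IsWhiteNoiseMeasure μ) {l : ℝ} (hl : 0 ≤ l) (φ ψ : TestRV μ) :
    ofFock 0 (mulFock hμ le_rfl (φ.toFock (0 + 1)) (ψ.toFock (0 + 1))) =
      ofFock l (mulFock hμ hl (φ.toFock (l + 1)) (ψ.toFock (l + 1))) := by
  set z := mulFock hμ hl (φ.toFock (l + 1)) (ψ.toFock (l + 1)) with hz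
  set z0 := mulFock hμ le_rfl (φ.toFock (0 + 1)) (ψ.toFock (0 + 1)) with hz0
  have h1 : rv hμ l z = rv hμ 0 z0 := by
    ext1
    exact (rv_mulFock_testRV hμ hl φ ψ).trans (rv_mulFock_testRV hμ le_rfl φ ψ).symm
  have h2 := rv_toFock hμ hl (normSq_ofFock l z)
  have h3 := rv_toFock hμ le_rfl (normSq_ofFock 0 z0)
  rw [toFock_ofFock] at h2 h3
  rw [h2, h3] at h1
  have h4 := (chaos hμ).injective h1
  rw [← ofFock_toFock ((normSq_mono hl _).trans_lt (normSq_ofFock l z)), h4]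

/-- The pointwise product of test random variables. -/
def TestRV.mul (hμ : IsWhiteNoiseMeasure μ) (φ ψ : TestRV μ) : TestRV μ :=
  TestRV.ofKernel hμ (ofFock 0 (mulFock hμ le_rfl (φ.toFock (0 + 1)) (ψ.toFock (0 + 1))))
    fun l hl => by
      rw [toFock_ofFock_mulFock hμ hl.le]
      exact normSq_ofFock _ _

theorem TestRV.toFock_mul (hμ : IsWhiteNoiseMeasure μ) {l : ℝ} (hl : 0 ≤ l) (φ ψ : TestRV μ) :
    (TestRV.mul hμ φ ψ).toFock l = mulFock hμ hl (φ.toFock (l + 1)) (ψ.toFock (l + 1)) := by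
  change WhiteNoise.toFock l (ofFock 0 _) = _
  rw [toFock_ofFock_mulFock hμ hl, toFock_ofFock]

theorem TestRV.toLp_mul (hμ : IsWhiteNoiseMeasure μ) (φ ψ : TestRV μ) :
    (TestRV.mul hμ φ ψ).toLp =ᵐ[μ] fun ω => φ.toLp ω * ψ.toLp ω := by
  rw [← TestRV.rv_toFock hμ _ le_rfl, TestRV.toFock_mul hμ le_rfl]
  exact rv_mulFock_testRV hμ le_rfl φ ψ

theorem TestRV.toLp_mul_left_comm (hμ : IsWhiteNoiseMeasure μ) (φ ψ χ : TestRV μ) :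
    (TestRV.mul hμ φ (TestRV.mul hμ ψ χ)).toLp = (TestRV.mul hμ ψ (TestRV.mul hμ φ χ)).toLp := by
  ext1
  filter_upwards [TestRV.toLp_mul hμ φ (TestRV.mul hμ ψ χ), TestRV.toLp_mul hμ ψ χ,
    TestRV.toLp_mul hμ ψ (TestRV.mul hμ φ χ), TestRV.toLp_mul hμ φ χ] with ω h1 h2 h3 h4
  rw [h1, h2, h3, h4]
  ring

/-- A test variable's kernels are determined by its random variable, so the choice of χ in
`IsProduct` does not affect the pairing. -/
theorem isProduct_iff (hμ : IsWhiteNoiseMeasure μ) (φ : TestRV μ) (Φ Ξ : GStar) :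
    IsProduct φ Φ Ξ ↔ ∀ ψ : TestRV μ, pairing Ξ ψ = pairing Φ (TestRV.mul hμ φ ψ) := by
  refine forall_congr' fun ψ => ⟨fun ⟨χ, h1, h2⟩ => ?_, fun h => ⟨TestRV.mul hμ φ ψ, ?_, h⟩⟩
  · rw [h2]
    refine pairing_congr hμ (Lp.ext (h1.trans ?_)) Φ
    filter_upwards [TestRV.toLp_mul hμ φ ψ] with ω h3
    rw [h3, mul_comm]
  · filter_upwards [TestRV.toLp_mul hμ φ ψ] with ω h3
    rw [h3, mul_comm]

/-- The operator adjoint to multiplication by `φ`, from level `-l` to level `-(l + 1)`. -/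
def mulAdj (hμ : IsWhiteNoiseMeasure μ) {l : ℝ} (hl : 0 ≤ l) (φ : TestRV μ) : Fock →L[ℝ] Fock :=
  ContinuousLinearMap.adjoint (mulFock hμ hl (φ.toFock (l + 1)))

/-- The generalized random variable with given coordinates at level `-l`. -/
def GStar.ofFock {l : ℝ} (hl : 0 < l) (x : Fock) : GStar :=
  ⟨WhiteNoise.ofFock (-l) x, l, hl, WhiteNoise.normSq_ofFock _ _⟩

theorem GStar.normSq_ofFock {l : ℝ} (hl : 0 < l) (x : Fock) :
    normSq (-l) (GStar.ofFock hl x).1 < ∞ := WhiteNoise.normSq_ofFock _ _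

theorem GStar.toFock_ofFock {l : ℝ} (hl : 0 < l) (x : Fock) :
    toFock (-l) (GStar.ofFock hl x).1 = x := WhiteNoise.toFock_ofFock _ _

/-- Multiplication by φ maps level l + 1 to level l, so its adjoint maps level -l to level -(l + 1);
that is the product in 𝒢*. -/
theorem isProduct_ofFock (hμ : IsWhiteNoiseMeasure μ) {l : ℝ} (hl : 0 < l) (φ : TestRV μ)
    {Φ : GStar} (hΦ : normSq (-l) Φ.1 < ∞) :
    IsProduct φ Φ (GStar.ofFock (add_pos hl one_pos) (mulAdj hμ hl.le φ (toFock (-l) Φ.1))) := by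
  rw [isProduct_iff hμ]
  intro ψ
  rw [pairing_eq hΦ, pairing_eq (GStar.normSq_ofFock _ _), GStar.toFock_ofFock, mulAdj,
    ContinuousLinearMap.adjoint_inner_left, TestRV.toFock_mul hμ hl.le]

theorem IsProduct.unique (hμ : IsWhiteNoiseMeasure μ) {φ : TestRV μ} {Φ Ξ Ξ' : GStar}
    (h : IsProduct φ Φ Ξ) (h' : IsProduct φ Φ Ξ') : Ξ = Ξ' :=
  pairing_ext hμ fun ψ => ((isProduct_iff hμ _ _ _).1 h ψ).trans
    ((isProduct_iff hμ _ _ _).1 h' ψ).symm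

theorem isProduct_testMul (hμ : IsWhiteNoiseMeasure μ) (φ : TestRV μ) (Φ : GStar) :
    IsProduct φ Φ (testMul φ Φ) := by
  obtain ⟨l, hl, hΦ⟩ := Φ.2
  have h : ∃ Ξ, IsProduct φ Φ Ξ := ⟨_, isProduct_ofFock hμ hl φ hΦ⟩
  rw [testMul, dif_pos h]
  exact h.choose_spec

theorem pairing_testMul (hμ : IsWhiteNoiseMeasure μ) (φ : TestRV μ) (Φ : GStar) (ψ : TestRV μ) :
    pairing (testMul φ Φ) ψ = pairing Φ (TestRV.mul hμ φ ψ) :=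
  (isProduct_iff hμ _ _ _).1 (isProduct_testMul hμ φ Φ) ψ

theorem testMul_val (hμ : IsWhiteNoiseMeasure μ) {l : ℝ} (hl : 0 < l) (φ : TestRV μ) {Φ : GStar}
    (hΦ : normSq (-l) Φ.1 < ∞) :
    (testMul φ Φ).1 = ofFock (-(l + 1)) (mulAdj hμ hl.le φ (toFock (-l) Φ.1)) :=
  congrArg Subtype.val ((isProduct_testMul hμ φ Φ).unique hμ (isProduct_ofFock hμ hl φ hΦ))

theorem normSq_testMul_lt_top (hμ : IsWhiteNoiseMeasure μ) {l : ℝ} (hl : 0 < l) (φ : TestRV μ)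
    {Φ : GStar} (hΦ : normSq (-l) Φ.1 < ∞) : normSq (-(l + 1)) (testMul φ Φ).1 < ∞ := by
  rw [testMul_val hμ hl φ hΦ]; exact normSq_ofFock _ _

theorem toFock_testMul (hμ : IsWhiteNoiseMeasure μ) {l : ℝ} (hl : 0 < l) (φ : TestRV μ) {Φ : GStar}
    (hΦ : normSq (-l) Φ.1 < ∞) :
    toFock (-(l + 1)) (testMul φ Φ).1 = mulAdj hμ hl.le φ (toFock (-l) Φ.1) := by
  rw [testMul_val hμ hl φ hΦ, toFock_ofFock]

theorem normSq_testMul_le (hμ : IsWhiteNoiseMeasure μ) {l : ℝ} (hl : 0 < l) (φ : TestRV μ)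
    {Φ : GStar} (hΦ : normSq (-l) Φ.1 < ∞) :
    normSq (-(l + 1)) (testMul φ Φ).1 ≤
      ENNReal.ofReal (‖mulAdj hμ hl.le φ‖ ^ 2) * normSq (-l) Φ.1 := by
  rw [normSq_eq_ofReal (normSq_testMul_lt_top hμ hl φ hΦ), normSq_eq_ofReal hΦ,
    toFock_testMul hμ hl φ hΦ, ← ENNReal.ofReal_mul (sq_nonneg _), ← mul_pow]
  exact ENNReal.ofReal_le_ofReal
    (pow_le_pow_left₀ (norm_nonneg _) (ContinuousLinearMap.le_opNorm _ _) 2)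

theorem testMul_add (hμ : IsWhiteNoiseMeasure μ) (φ : TestRV μ) (Φ Ψ : GStar) :
    testMul φ (Φ + Ψ) = testMul φ Φ + testMul φ Ψ :=
  pairing_ext hμ fun ψ => by
    rw [pairing_add, pairing_testMul hμ, pairing_testMul hμ, pairing_testMul hμ, pairing_add]

theorem testMul_smul (hμ : IsWhiteNoiseMeasure μ) (φ : TestRV μ) (c : ℝ) (Φ : GStar) :
    testMul φ (c • Φ) = c • testMul φ Φ :=
  pairing_ext hμ fun ψ => by
    rw [pairing_smul, pairing_testMul hμ, pairing_testMul hμ, pairing_smul]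

theorem testMul_sub (hμ : IsWhiteNoiseMeasure μ) (φ : TestRV μ) (Φ Ψ : GStar) :
    testMul φ (Φ - Ψ) = testMul φ Φ - testMul φ Ψ :=
  pairing_ext hμ fun ψ => by
    rw [pairing_sub, pairing_testMul hμ, pairing_testMul hμ, pairing_testMul hμ, pairing_sub]

theorem testMul_comm (hμ : IsWhiteNoiseMeasure μ) (φ ψ : TestRV μ) (Φ : GStar) :
    testMul φ (testMul ψ Φ) = testMul ψ (testMul φ Φ) :=
  pairing_ext hμ fun χ => by
    rw [pairing_testMul hμ, pairing_testMul hμ, pairing_testMul hμ, pairing_testMul hμ]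
    exact pairing_congr hμ (TestRV.toLp_mul_left_comm hμ _ _ _) Φ

theorem TestRV.scale_toFock (ψ : TestRV μ) {l l' : ℝ} (hl : l ≤ l') :
    scale (l' - l) (ψ.toFock l') = ψ.toFock l := WhiteNoise.scale_toFock hl (ψ.normSq_kernel l')

end

section

/-! ### The gradient -/

/-- The kernel of the gradient: `f ↦ (s ↦ f(·, s))`. -/
def kernelGrad (n : ℕ) : symL2 (n + 1) →L[ℝ] Lp (symL2 n) 2 (volume : Measure ℝ) :=
  (symProj n).compLpL 2 volume ∘L (kcurry n).toContinuousLinearMap ∘L (symL2 (n + 1)).subtypeL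

/-- The projection keeps values in the symmetric kernels; inner products with symmetric kernels are
unaffected by it. -/
theorem coeFn_kernelGrad (n : ℕ) (f : symL2 (n + 1)) :
    ∀ᵐ s : ℝ, kernelGrad n f s = symProj n (kcurry n f s) :=
  (symProj n).coeFn_compLpL _

theorem norm_symProj_le (n : ℕ) : ‖symProj n‖ ≤ 1 := (symL2 n).orthogonalProjectionOnto_norm_le

theorem norm_kernelGrad_le (n : ℕ) (f : symL2 (n + 1)) : ‖kernelGrad n f‖ ≤ ‖f‖ := by
  refine ((symProj n).norm_compLp_le _).trans ?_
  refine (mul_le_of_le_one_left (norm_nonneg _) (norm_symProj_le n)).trans ?_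
  exact ((kcurry n).norm_map _).le

theorem symProj_coe {n : ℕ} (f : symL2 n) : symProj n f = f :=
  (symL2 n).orthogonalProjectionOnto_mem_subspace_eq_self f

theorem kernelGrad_tensorPow (n : ℕ) (ξ : 𝓢(ℝ, ℝ)) :
    ∀ᵐ s : ℝ, kernelGrad n (tensorPow (n + 1) ξ) s = ξ s • tensorPow n ξ := by
  filter_upwards [coeFn_kernelGrad n (tensorPow (n + 1) ξ),
    kcurry_tensor fun _ : Fin (n + 1) => ξ] with s h1 h2
  have h3 : kcurry n (tensorPow (n + 1) ξ : KernelL2 (n + 1)) s =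
      ξ s • (tensorPow n ξ : KernelL2 n) := h2
  rw [h1, h3, map_smul, symProj_coe]

/-- The `n`-th coefficient of the gradient from level `l + 1` to level `l`. -/
def gradCoeff (l : ℝ) (n : ℕ) : ℝ := (n + 1) * wt l n * (wt (l + 1) (n + 1))⁻¹

theorem gradCoeff_mul (l : ℝ) (n : ℕ) : gradCoeff l n * wt (l + 1) (n + 1) = (n + 1) * wt l n := by
  rw [gradCoeff, inv_mul_cancel_right₀ (wt_pos _ _).ne']

theorem gradCoeff_nonneg (l : ℝ) (n : ℕ) : 0 ≤ gradCoeff l n :=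
  mul_nonneg (mul_nonneg (by positivity) (wt_pos _ _).le) (inv_nonneg.2 (wt_pos _ _).le)

/-- Dropping one level gains e^{-n}, which beats the factor n + 1 of the derivative; the series of
operators defining the gradient converges absolutely. -/
theorem gradCoeff_le (l : ℝ) (n : ℕ) :
    gradCoeff l n ≤ (n + 1) * Real.exp (-1) ^ n * Real.exp (-(l + 1)) := by
  have h1 : wt l n ≤ Real.exp (-1) ^ n * Real.exp (-(l + 1)) * wt (l + 1) (n + 1) := by
    have h2 : Real.exp (l * n) = Real.exp (-1) ^ n * Real.exp (-(l + 1)) *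
        Real.exp ((l + 1) * ((n + 1 : ℕ) : ℝ)) := by
      rw [← Real.exp_nat_mul, ← Real.exp_add, ← Real.exp_add]
      congr 1; push_cast; ring
    rw [wt, wt, h2, mul_left_comm]
    have h3 : Real.sqrt n.factorial ≤ Real.sqrt (n + 1).factorial :=
      Real.sqrt_le_sqrt (by exact_mod_cast Nat.factorial_le n.le_succ)
    have h4 := Real.exp_pos ((l + 1) * ((n + 1 : ℕ) : ℝ))
    exact mul_le_mul_of_nonneg_left (mul_le_mul_of_nonneg_right h3 h4.le) (by positivity)
  rw [gradCoeff, mul_assoc, mul_assoc]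
  refine mul_le_mul_of_nonneg_left ?_ (by positivity)
  rwa [← div_eq_mul_inv, div_le_iff₀ (wt_pos _ _)]

theorem summable_gradCoeff (l : ℝ) : Summable (gradCoeff l) := by
  refine Summable.of_nonneg_of_le (gradCoeff_nonneg l) (gradCoeff_le l) ?_
  refine Summable.mul_right _ ?_
  have h : ‖Real.exp (-1)‖ < 1 := by
    rw [Real.norm_eq_abs, abs_of_pos (Real.exp_pos _)]
    exact Real.exp_lt_one_iff.2 (by norm_num)
  have := (summable_pow_mul_geometric_of_norm_lt_one 1 h).add
    (summable_geometric_of_norm_lt_one h)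
  refine this.congr fun n => ?_
  simp [add_mul]

/-- The inclusion of the `n`-th chaos in Fock space. -/
def fockSingle (n : ℕ) : symL2 n →L[ℝ] Fock :=
  lp.singleContinuousLinearMap ℝ (fun n => symL2 n) 2 n

/-- The `n`-th component of an element of Fock space. -/
def fockEval (n : ℕ) : Fock →L[ℝ] symL2 n := lp.evalCLM ℝ (fun n => symL2 n) 2 n

theorem fockEval_apply (n : ℕ) (x : Fock) : fockEval n x = x n := rfl

theorem fockEval_single (n : ℕ) (f : symL2 n) : fockEval n (fockSingle n f) = f :=
  lp.single_apply_self (E := fun n => symL2 n) 2 n f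

theorem fockEval_single_of_ne {n m : ℕ} (h : n ≠ m) (f : symL2 m) :
    fockEval n (fockSingle m f) = 0 := lp.single_apply_ne (E := fun n => symL2 n) 2 m f h

theorem norm_fockSingle (n : ℕ) (f : symL2 n) : ‖fockSingle n f‖ = ‖f‖ :=
  lp.norm_single (E := fun n => symL2 n) (by norm_num) n f

theorem norm_fockEval_le (n : ℕ) (x : Fock) : ‖fockEval n x‖ ≤ ‖x‖ :=
  lp.norm_apply_le_norm (E := fun n => symL2 n) (by norm_num) x n

theorem inner_fockSingle (n : ℕ) (f : symL2 n) (x : Fock) :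
    inner ℝ (fockSingle n f) x = inner ℝ f (x n) := lp.inner_single_left (G := fun n => symL2 n) n f x

/-- The `n`-th term of the gradient. -/
def gradTerm (n : ℕ) : Fock →L[ℝ] Lp Fock 2 (volume : Measure ℝ) :=
  (fockSingle n).compLpL 2 volume ∘L kernelGrad n ∘L fockEval (n + 1)

theorem coeFn_gradTerm (n : ℕ) (x : Fock) :
    ∀ᵐ s : ℝ, gradTerm n x s = fockSingle n (kernelGrad n (x (n + 1)) s) :=
  (fockSingle n).coeFn_compLpL _

theorem norm_gradTerm_le (n : ℕ) : ‖gradTerm n‖ ≤ 1 := by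
  refine ContinuousLinearMap.opNorm_le_bound _ zero_le_one fun x => ?_
  rw [one_mul]
  have h1 : ‖fockSingle n‖ ≤ 1 := ContinuousLinearMap.opNorm_le_bound _ zero_le_one fun f => by
    rw [one_mul, norm_fockSingle]
  have h2 : ‖gradTerm n x‖ ≤ ‖fockSingle n‖ * ‖kernelGrad n (fockEval (n + 1) x)‖ :=
    (fockSingle n).norm_compLp_le _
  have h3 := norm_kernelGrad_le n (fockEval (n + 1) x)
  have h4 := norm_fockEval_le (n + 1) x
  exact (h2.trans (mul_le_of_le_one_left (norm_nonneg (kernelGrad n (fockEval (n + 1) x))) h1)).trans (h3.trans h4)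

theorem hasSum_clm_apply {X Y : Type*} [NormedAddCommGroup X] [NormedSpace ℝ X]
    [NormedAddCommGroup Y] [NormedSpace ℝ Y] {T : ℕ → X →L[ℝ] Y} (h : Summable T) (x : X) :
    HasSum (fun n => T n x) ((∑' n, T n) x) := by
  have := ContinuousLinearMap.hasSum (ContinuousLinearMap.apply ℝ Y x) h.hasSum
  exact this

theorem summable_smul_of_norm_le_one {Y : Type*} [NormedAddCommGroup Y] [NormedSpace ℝ Y]
    [CompleteSpace Y] {c : ℕ → ℝ} (hc : Summable c) (h0 : ∀ n, 0 ≤ c n) {T : ℕ → Y}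
    (hT : ∀ n, ‖T n‖ ≤ 1) : Summable fun n => c n • T n := by
  refine Summable.of_norm_bounded hc fun n => ?_
  rw [norm_smul, Real.norm_of_nonneg (h0 n)]
  exact mul_le_of_le_one_right (h0 n) (hT n)

/-- The gradient `D`, from level `l + 1` to level `l`. -/
def grad (l : ℝ) : Fock →L[ℝ] Lp Fock 2 (volume : Measure ℝ) :=
  ∑' n, gradCoeff l n • gradTerm n

theorem hasSum_grad (l : ℝ) (x : Fock) : HasSum (fun n => gradCoeff l n • gradTerm n x) (grad l x) :=
  hasSum_clm_apply (summable_smul_of_norm_le_one (summable_gradCoeff l) (gradCoeff_nonneg l)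
    norm_gradTerm_le) x

theorem coeFn_grad (l : ℝ) (x : Fock) :
    ∀ᵐ s : ℝ, ∀ n, (grad l x s) n = gradCoeff l n • symProj n (kcurry n (x (n + 1)) s) := by
  refine ae_all_iff.2 fun n => ?_
  have h1 := ((fockEval n).compLpL 2 (volume : Measure ℝ)).hasSum (hasSum_grad l x)
  have h2 : ∀ m, m ≠ n → (fockEval n).compLpL 2 (volume : Measure ℝ)
      (gradCoeff l m • gradTerm m x) = 0 := by
    intro m hm
    rw [map_smul]
    refine smul_eq_zero_of_right _ ?_
    ext1
    filter_upwards [(fockEval n).coeFn_compLpL (gradTerm m x), coeFn_gradTerm m x,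
      Lp.coeFn_zero (symL2 n) 2 (volume : Measure ℝ)] with s k1 k2 k3
    rw [k1, k2, fockEval_single_of_ne hm.symm, k3, Pi.zero_apply]
  have h3 : gradCoeff l n • (fockEval n).compLpL 2 (volume : Measure ℝ) (gradTerm n x) =
      (fockEval n).compLpL 2 (volume : Measure ℝ) (grad l x) := by
    rw [← map_smul]
    exact (hasSum_single n h2).unique h1
  filter_upwards [(fockEval n).coeFn_compLpL (gradTerm n x), coeFn_gradTerm n x,
    (fockEval n).coeFn_compLpL (grad l x), coeFn_kernelGrad n (x (n + 1)),
    Lp.coeFn_smul (gradCoeff l n) ((fockEval n).compLpL 2 (volume : Measure ℝ) (gradTerm n x))]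
    with s k1 k2 k3 k4 k5
  rw [← fockEval_apply, ← k3, ← h3, k5, Pi.smul_apply, k1, k2, fockEval_single, k4]

/-- Exponential functionals are eigenvectors: D_s acts on them by multiplication with ξ(s). -/
theorem grad_fexp (l : ℝ) (ξ : 𝓢(ℝ, ℝ)) :
    ∀ᵐ s : ℝ, grad l (fexp (l + 1) ξ) s = ξ s • fexp l ξ := by
  filter_upwards [coeFn_grad l (fexp (l + 1) ξ), ae_all_iff.2 fun n => kernelGrad_tensorPow n ξ,
    ae_all_iff.2 fun n => coeFn_kernelGrad n (tensorPow (n + 1) ξ),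
    ae_all_iff.2 fun n => coeFn_kernelGrad n (fexp (l + 1) ξ (n + 1)),
    ae_all_iff.2 fun n => Lp.coeFn_smul (wt (l + 1) (n + 1) * ((n + 1).factorial : ℝ)⁻¹)
      (kernelGrad n (tensorPow (n + 1) ξ))]
    with s h1 h2 h3 h4 h5
  ext n : 2
  have h6 : fexp (l + 1) ξ (n + 1) =
      (wt (l + 1) (n + 1) * ((n + 1).factorial : ℝ)⁻¹) • tensorPow (n + 1) ξ := by
    rw [fexp_apply, expVec, smul_smul]
  have h7 : (ξ s • fexp l ξ) n = ξ s • fexp l ξ n := rfl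
  rw [h1, ← h4, h6, map_smul, h5, Pi.smul_apply, h2, h7, fexp_apply, expVec, smul_smul, smul_smul,
    smul_smul, smul_smul]
  congr 1
  rw [← mul_assoc, gradCoeff_mul, Nat.factorial_succ]
  have : (n.factorial : ℝ) ≠ 0 := by positivity
  have : (n + 1 : ℝ) ≠ 0 := by positivity
  push_cast
  field_simp

/-! ### Directional derivatives -/

/-- The weighted average `G ↦ ∫ H(s) G(s) ds`. -/
def avg (H : Lp ℝ 2 (volume : Measure ℝ)) : Lp Fock 2 (volume : Measure ℝ) →L[ℝ] Fock :=
  ContinuousLinearMap.lpPairing volume 2 2 (ContinuousLinearMap.lsmul ℝ ℝ : ℝ →L[ℝ] Fock →L[ℝ] Fock) H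

theorem avg_apply (H : Lp ℝ 2 (volume : Measure ℝ)) (G : Lp Fock 2 (volume : Measure ℝ)) :
    avg H G = ∫ s, H s • G s :=
  ContinuousLinearMap.lpPairing_eq_integral _ _ _

theorem integrable_smul_Lp (H : Lp ℝ 2 (volume : Measure ℝ)) (G : Lp Fock 2 (volume : Measure ℝ)) :
    Integrable fun s => H s • G s :=
  memLp_one_iff_integrable.1 ((Lp.memLp G).smul (Lp.memLp H))

/-- The derivative in direction `H`, from level `l + 1` to level `l`. -/
def dirGrad (l : ℝ) (H : Lp ℝ 2 (volume : Measure ℝ)) : Fock →L[ℝ] Fock := avg H ∘L grad l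

theorem dirGrad_fexp (l : ℝ) (H : Lp ℝ 2 (volume : Measure ℝ)) (ξ : 𝓢(ℝ, ℝ)) :
    dirGrad l H (fexp (l + 1) ξ) = (inner ℝ H (schwartzL2 ξ) : ℝ) • fexp l ξ := by
  change avg H (grad l _) = _
  have h1 : inner ℝ H (schwartzL2 ξ) = ∫ s, H s * ξ s :=
    integral_mul_eq_inner ae_eq_rfl (coeFn_schwartzL2 ξ)
  rw [avg_apply, h1, ← integral_smul_const]
  refine integral_congr_ae ?_
  filter_upwards [grad_fexp l ξ] with s hs
  rw [hs, smul_smul]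

/-- Indicators of sets of finite measure among the weights H recover all set integrals. Pointwise
rules for the gradient thus follow from rules for directional derivatives. -/
theorem Lp_fock_ext {G G' : Lp Fock 2 (volume : Measure ℝ)} (h : ∀ H, avg H G = avg H G') :
    G = G' := by
  ext1
  have hi : ∀ (G : Lp Fock 2 (volume : Measure ℝ)) (s : Set ℝ), MeasurableSet s → volume s < ∞ →
      IntegrableOn G s := fun G s hs hs' =>
    haveI : IsFiniteMeasure (volume.restrict s) := ⟨by simpa using hs'⟩
    ((Lp.memLp G).restrict s).integrable (by norm_num)
  refine Lp.ae_eq_of_forall_setIntegral_eq G G' (by norm_num) (by norm_num) (hi G) (hi G') ?_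
  intro s hs hs'
  have h1 : ∀ G : Lp Fock 2 (volume : Measure ℝ),
      avg (indicatorConstLp 2 hs hs'.ne (1 : ℝ)) G = ∫ x in s, G x := by
    intro G
    rw [avg_apply, ← integral_indicator hs]
    refine integral_congr_ae ?_
    filter_upwards [indicatorConstLp_coeFn (p := 2) (hs := hs) (hμs := hs'.ne) (c := (1 : ℝ))]
      with x hx
    rw [hx]
    by_cases hxs : x ∈ s <;> simp [hxs]
  rw [← h1, ← h1, h]

theorem avg_compLp (H : Lp ℝ 2 (volume : Measure ℝ)) (G : Lp Fock 2 (volume : Measure ℝ))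
    (T : Fock →L[ℝ] Fock) : avg H (T.compLp G) = T (avg H G) := by
  rw [avg_apply, avg_apply, ← T.integral_comp_comm (integrable_smul_Lp H G)]
  refine integral_congr_ae ?_
  filter_upwards [T.coeFn_compLp G] with s hs
  rw [hs, map_smul]

theorem integral_kernel_swap (n : ℕ) (H : Lp ℝ 2 (volume : Measure ℝ)) (F : KernelL2 (n + 1))
    (f : KernelL2 n) :
    ∫ u, (∫ r, H r * F (Fin.snoc u r)) * f u = ∫ r, H r * inner ℝ (kcurry n F r) f := by
  have h1 : MemLp (fun p : ℝ × (Fin n → ℝ) => F (Fin.snoc p.2 p.1)) 2 (volume.prod volume) :=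
    (Lp.memLp F).comp_measurePreserving (measurePreserving_snoc n)
  have h2 := (memLp_prod_mul (Lp.memLp H) (Lp.memLp f)).integrable_mul h1
  have h3 := integral_integral_swap (μ := (volume : Measure ℝ))
    (ν := (volume : Measure (Fin n → ℝ)))
    (f := fun r u => (H r * f u) * F (Fin.snoc u r)) h2
  calc _ = ∫ u, ∫ r, (H r * f u) * F (Fin.snoc u r) := by
        refine integral_congr_ae (Eventually.of_forall fun u => ?_)
        change (∫ r, H r * F (Fin.snoc u r)) * f u = _
        rw [← integral_mul_const]
        exact integral_congr_ae (Eventually.of_forall fun r => by ring)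
    _ = _ := h3.symm
    _ = _ := by
        refine integral_congr_ae ?_
        filter_upwards [coeFn_kcurry F] with r hr
        have h4 : inner ℝ (kcurry n F r) f = ∫ u, F (Fin.snoc u r) * f u :=
          integral_mul_eq_inner hr ae_eq_rfl
        rw [h4, ← integral_const_mul]
        exact integral_congr_ae (Eventually.of_forall fun r => by ring)

variable {μ : Measure TemperedDist}

/-- Termwise Fubini turns the defining series into Fock inner products. Differentiation costs one
level, from -l to -(l + 1), so ψ is read at level l + 1. -/
theorem dirDerivPairing_eq {h : ℝ → ℝ} {H : Lp ℝ 2 (volume : Measure ℝ)} (hH : H =ᵐ[volume] h)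
    {l : ℝ} {Φ : GStar} (hΦ : normSq (-l) Φ.1 < ∞) (ψ : TestRV μ) :
    dirDerivPairing h Φ ψ =
      inner ℝ (dirGrad (-(l + 1)) H (toFock (-l) Φ.1)) (ψ.toFock (l + 1)) := by
  have h1 := (((innerSL ℝ (ψ.toFock (l + 1))) ∘L avg H).hasSum
    (hasSum_grad (-(l + 1)) (toFock (-l) Φ.1)))
  rw [real_inner_comm]
  refine Eq.trans (tsum_congr fun n => ?_) h1.tsum_eq
  have e1 : ∫ u : Fin n → ℝ, ((n + 1 : ℝ) *
        ∫ r : ℝ, h r * (Φ.1 (n + 1) : KernelL2 (n + 1)) (Fin.snoc u r)) *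
          (ψ.kernel n : KernelL2 n) u =
      (n + 1 : ℝ) * ∫ r, H r * inner ℝ (kcurry n (Φ.1 (n + 1)) r) (ψ.kernel n : KernelL2 n) := by
    rw [← integral_kernel_swap, ← integral_const_mul]
    refine integral_congr_ae (Eventually.of_forall fun u => ?_)
    simp only [mul_assoc]
    congr 2
    refine integral_congr_ae ?_
    filter_upwards [hH] with r hr
    rw [hr]
  have e2 : ((innerSL ℝ (ψ.toFock (l + 1))) ∘L avg H)
      (gradCoeff (-(l + 1)) n • gradTerm n (toFock (-l) Φ.1)) =
      gradCoeff (-(l + 1)) n * ∫ r, H r *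
        (wt (-l) (n + 1) * wt (l + 1) n *
          inner ℝ (kcurry n (Φ.1 (n + 1)) r) (ψ.kernel n : KernelL2 n)) := by
    rw [map_smul, smul_eq_mul]
    congr 1
    change innerSL ℝ (ψ.toFock (l + 1)) (avg H _) = _
    rw [avg_apply, ← (innerSL ℝ (ψ.toFock (l + 1))).integral_comp_comm (integrable_smul_Lp H _)]
    refine integral_congr_ae ?_
    filter_upwards [coeFn_gradTerm n (toFock (-l) Φ.1),
      coeFn_kernelGrad n (toFock (-l) Φ.1 (n + 1)),
      Lp.coeFn_smul (wt (-l) (n + 1)) (kcurry n (Φ.1 (n + 1)))] with r k1 k2 k3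
    have k4 : kcurry n (toFock (-l) Φ.1 (n + 1)) =
        wt (-l) (n + 1) • kcurry n (Φ.1 (n + 1)) := by
      rw [toFock_apply hΦ, ← map_smul]; rfl
    rw [k1, k2, k4, k3, map_smul, smul_eq_mul, innerSL_apply_apply, real_inner_comm,
      inner_fockSingle, inner_symProj, TestRV.toFock, toFock_apply (ψ.normSq_kernel _),
      Pi.smul_apply, Submodule.coe_smul, real_inner_smul_left, real_inner_smul_right]
    ring
  rw [e1, e2, ← integral_const_mul, ← integral_const_mul, ← integral_const_mul]
  refine integral_congr_ae (Eventually.of_forall fun r => ?_)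
  have e3 := gradCoeff_mul (-(l + 1)) n
  rw [show -(l + 1) + 1 = -l by ring] at e3
  have e4 := wt_mul_neg (l + 1) n
  simp only []
  calc _ = (wt (-(l + 1)) n * wt (l + 1) n) * ((n + 1 : ℝ) *
        (H r * inner ℝ (kcurry n (Φ.1 (n + 1)) r) (ψ.kernel n : KernelL2 n))) := by rw [e4]
    _ = (((n : ℝ) + 1) * wt (-(l + 1)) n) * (wt (l + 1) n *
        (H r * inner ℝ (kcurry n (Φ.1 (n + 1)) r) (ψ.kernel n : KernelL2 n))) := by ring
    _ = _ := by rw [← e3]; ring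

end

section

/-! ### The Leibniz rule -/

variable {μ : Measure TemperedDist} [IsProbabilityMeasure μ]

theorem scale_one_fexp (l : ℝ) (ξ : 𝓢(ℝ, ℝ)) : scale 1 (fexp (l + 1) ξ) = fexp l ξ := by
  have := scale_fexp (le_add_of_nonneg_right zero_le_one : l ≤ l + 1) ξ
  rwa [add_sub_cancel_left] at this

theorem bilinear_ext_fexp {X : Type*} [NormedAddCommGroup X] [NormedSpace ℝ X] (l l' : ℝ)
    {B B' : Fock →L[ℝ] Fock →L[ℝ] X}
    (h : ∀ ξ η, B (fexp l ξ) (fexp l' η) = B' (fexp l ξ) (fexp l' η)) : B = B' :=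
  clm_ext_fexp l fun ξ => clm_ext_fexp l' fun η => h ξ η

/-- On exponentials of ξ and η both sides equal ((H, ξ) + (H, η)) e^{(ξ, η)} times the exponential
of ξ + η. `scale 1` brings the undifferentiated factor down to the level of the differentiated one.
-/
theorem dirGrad_mulFock (hμ : IsWhiteNoiseMeasure μ) {l : ℝ} (hl : 0 ≤ l)
    (H : Lp ℝ 2 (volume : Measure ℝ)) (x y : Fock) :
    dirGrad l H (mulFock hμ (add_nonneg hl zero_le_one) x y) =
      mulFock hμ hl (scale 1 x) (dirGrad (l + 1) H y) +
        mulFock hμ hl (scale 1 y) (dirGrad (l + 1) H x) := by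
  let B1 : Fock →L[ℝ] Fock →L[ℝ] Fock :=
    (ContinuousLinearMap.compL ℝ Fock Fock Fock (dirGrad l H)) ∘L
      mulFock hμ (add_nonneg hl zero_le_one)
  let B2 : Fock →L[ℝ] Fock →L[ℝ] Fock :=
    (mulFock hμ hl).bilinearComp (scale 1) (dirGrad (l + 1) H) +
      ((mulFock hμ hl).bilinearComp (scale 1) (dirGrad (l + 1) H)).flip
  have h : B1 = B2 := by
    refine bilinear_ext_fexp (l + 1 + 1) (l + 1 + 1) fun ξ η => ?_
    change dirGrad l H (mulFock hμ _ (fexp (l + 1 + 1) ξ) (fexp (l + 1 + 1) η)) =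
      mulFock hμ hl (scale 1 (fexp (l + 1 + 1) ξ)) (dirGrad (l + 1) H (fexp (l + 1 + 1) η)) +
      mulFock hμ hl (scale 1 (fexp (l + 1 + 1) η)) (dirGrad (l + 1) H (fexp (l + 1 + 1) ξ))
    rw [mulFock_fexp, map_smul, dirGrad_fexp, dirGrad_fexp, dirGrad_fexp, scale_one_fexp,
      scale_one_fexp, map_smul, map_smul, mulFock_fexp, mulFock_fexp, map_add, inner_add_right,
      add_comm η ξ, real_inner_comm (schwartzL2 ξ) (schwartzL2 η), smul_smul, smul_smul, smul_smul,
      ← add_smul]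
    congr 1
    ring
  exact congrArg (fun B : Fock →L[ℝ] Fock →L[ℝ] Fock => B x y) h

/-- The Leibniz rule for the gradient. -/
theorem grad_mulFock (hμ : IsWhiteNoiseMeasure μ) {l : ℝ} (hl : 0 ≤ l) (x y : Fock) :
    ∀ᵐ s : ℝ, grad l (mulFock hμ (add_nonneg hl zero_le_one) x y) s =
      mulFock hμ hl (scale 1 x) (grad (l + 1) y s) +
        mulFock hμ hl (scale 1 y) (grad (l + 1) x s) := by
  have h : grad l (mulFock hμ (add_nonneg hl zero_le_one) x y) =
      (mulFock hμ hl (scale 1 x)).compLp (grad (l + 1) y) +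
        (mulFock hμ hl (scale 1 y)).compLp (grad (l + 1) x) :=
    Lp_fock_ext fun H => by
      rw [map_add, avg_compLp, avg_compLp]
      exact dirGrad_mulFock hμ hl H x y
  rw [h]
  filter_upwards [Lp.coeFn_add ((mulFock hμ hl (scale 1 x)).compLp (grad (l + 1) y))
    ((mulFock hμ hl (scale 1 y)).compLp (grad (l + 1) x)),
    (mulFock hμ hl (scale 1 x)).coeFn_compLp (grad (l + 1) y),
    (mulFock hμ hl (scale 1 y)).coeFn_compLp (grad (l + 1) x)] with s h1 h2 h3
  rw [h1, Pi.add_apply, h2, h3]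

theorem inner_eq_of_fexp (l : ℝ) {x y : Fock}
    (h : ∀ ξ, inner ℝ x (fexp l ξ) = inner ℝ y (fexp l ξ)) : x = y := by
  have : innerSL ℝ x = innerSL ℝ y := clm_ext_fexp l h
  exact ext_inner_right ℝ fun v => congrArg (fun T : Fock →L[ℝ] ℝ => T v) this

theorem adjoint_mulFock_fexp (hμ : IsWhiteNoiseMeasure μ) {l : ℝ} (hl : 0 ≤ l)
    (ξ ζ : 𝓢(ℝ, ℝ)) :
    ContinuousLinearMap.adjoint (mulFock hμ hl (fexp (l + 1) ξ)) (fexp (-l) ζ) =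
      Real.exp (inner ℝ (schwartzL2 ζ) (schwartzL2 ξ)) • fexp (-(l + 1)) (ζ + ξ) := by
  refine inner_eq_of_fexp (l + 1) fun η => ?_
  rw [ContinuousLinearMap.adjoint_inner_left, mulFock_fexp, real_inner_smul_left,
    real_inner_smul_right, inner_fexp, inner_fexp, neg_add_cancel, neg_add_cancel, Real.exp_zero,
    one_mul, one_mul, ← Real.exp_add, ← Real.exp_add, map_add, map_add, inner_add_right,
    inner_add_left]
  congr 1
  ring

/-- The dual Leibniz rule: `φ · D_H^* ψ = D_H^*(φ ψ) + ψ · D_H φ`. -/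
theorem mulFock_adjoint_dirGrad (hμ : IsWhiteNoiseMeasure μ) {l : ℝ} (hl : 0 ≤ l)
    (H : Lp ℝ 2 (volume : Measure ℝ)) (y z : Fock) :
    mulFock hμ hl (scale 1 y) (ContinuousLinearMap.adjoint (dirGrad (-(l + 1 + 1)) H) z) =
      ContinuousLinearMap.adjoint (dirGrad (-(l + 1)) H)
        (mulFock hμ (add_nonneg hl zero_le_one) y z) +
      mulFock hμ hl (scale 1 z) (dirGrad (l + 1) H y) := by
  let B1 : Fock →L[ℝ] Fock →L[ℝ] Fock := (mulFock hμ hl).bilinearComp (scale 1)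
    (ContinuousLinearMap.adjoint (dirGrad (-(l + 1 + 1)) H))
  let B2 : Fock →L[ℝ] Fock →L[ℝ] Fock :=
    (ContinuousLinearMap.compL ℝ Fock Fock Fock
      (ContinuousLinearMap.adjoint (dirGrad (-(l + 1)) H))) ∘L
      mulFock hμ (add_nonneg hl zero_le_one) +
    ((mulFock hμ hl).bilinearComp (scale 1) (dirGrad (l + 1) H)).flip
  have h : B1 = B2 := by
    refine bilinear_ext_fexp (l + 1 + 1) (l + 1 + 1) fun ξ η => ?_
    change mulFock hμ hl (scale 1 (fexp (l + 1 + 1) ξ))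
        (ContinuousLinearMap.adjoint (dirGrad (-(l + 1 + 1)) H) (fexp (l + 1 + 1) η)) =
      ContinuousLinearMap.adjoint (dirGrad (-(l + 1)) H)
        (mulFock hμ (add_nonneg hl zero_le_one) (fexp (l + 1 + 1) ξ) (fexp (l + 1 + 1) η)) +
      mulFock hμ hl (scale 1 (fexp (l + 1 + 1) η)) (dirGrad (l + 1) H (fexp (l + 1 + 1) ξ))
    -- Pairing with a third exponential at level -l moves both adjoints onto it, where they act
    -- explicitly.
    refine inner_eq_of_fexp (-l) fun ζ => ?_
    have e1 := dirGrad_fexp (-(l + 1 + 1)) H (ζ + ξ)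
    have e2 := dirGrad_fexp (-(l + 1)) H ζ
    rw [show -(l + 1 + 1) + 1 = -(l + 1) by ring] at e1
    rw [show -(l + 1) + 1 = -l by ring] at e2
    rw [inner_add_left, scale_one_fexp, scale_one_fexp,
      ← ContinuousLinearMap.adjoint_inner_right, adjoint_mulFock_fexp,
      ContinuousLinearMap.adjoint_inner_left, ContinuousLinearMap.adjoint_inner_left, map_smul,
      e1, e2, mulFock_fexp, dirGrad_fexp, map_smul, mulFock_fexp]
    simp only [real_inner_smul_left, real_inner_smul_right, inner_fexp, add_neg_cancel,
      Real.exp_zero, one_mul, map_add, inner_add_left, inner_add_right, Real.exp_add]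
    rw [real_inner_comm (schwartzL2 ζ) (schwartzL2 ξ), real_inner_comm (schwartzL2 ξ) (schwartzL2 η),
      real_inner_comm (schwartzL2 ζ) (schwartzL2 η)]
    ring
  exact congrArg (fun B : Fock →L[ℝ] Fock →L[ℝ] Fock => B y z) h

/-! ### The gradient of a test random variable -/

/-- The kernels `(n + 1) φ⁽ⁿ⁺¹⁾(·, s)`. -/
def gradKernel (φ : TestRV μ) (s : ℝ) : ChaosSeq :=
  fun n => (n + 1 : ℝ) • symProj n (kcurry n (φ.kernel (n + 1)) s)

/-- The kernels of D_s φ do not depend on the level. Restricting to natural levels gives one null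
set that serves for all of them. -/
theorem grad_toFock (φ : TestRV μ) :
    ∀ᵐ s : ℝ, ∀ k : ℕ, grad k (φ.toFock (k + 1)) s = toFock k (gradKernel φ s) ∧
      normSq k (gradKernel φ s) < ∞ := by
  refine ae_all_iff.2 fun k => ?_
  filter_upwards [coeFn_grad k (φ.toFock (k + 1)), ae_all_iff.2 fun n =>
    Lp.coeFn_smul (wt ((k : ℝ) + 1) (n + 1)) (kcurry n (φ.kernel (n + 1)))] with s h1 h2
  have h3 : ofFock k (grad k (φ.toFock (k + 1)) s) = gradKernel φ s := by
    funext n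
    have h4 : kcurry n (φ.toFock (k + 1) (n + 1)) =
        wt ((k : ℝ) + 1) (n + 1) • kcurry n (φ.kernel (n + 1)) := by
      rw [TestRV.toFock, toFock_apply (φ.normSq_kernel _), ← map_smul]; rfl
    rw [ofFock, gradKernel, h1, h4, h2, Pi.smul_apply, map_smul, smul_smul, smul_smul, mul_assoc,
      gradCoeff_mul]
    congr 1
    have := (wt_pos k n).ne'
    field_simp
  rw [← h3]
  exact ⟨(toFock_ofFock _ _).symm, normSq_ofFock _ _⟩

open Classical in
/-- The gradient `D_s φ` of a test random variable. -/
def TestRV.grad (hμ : IsWhiteNoiseMeasure μ) (φ : TestRV μ) (s : ℝ) : TestRV μ :=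
  if h : ∀ l : ℝ, 0 < l → normSq l (gradKernel φ s) < ∞ then TestRV.ofKernel hμ _ h
  -- The value 0 is taken only on a null set of s.
  else TestRV.ofKernel hμ 0 fun l _ => by simp [normSq]

theorem TestRV.toFock_grad (hμ : IsWhiteNoiseMeasure μ) (φ : TestRV μ) :
    ∀ᵐ s : ℝ, ∀ k : ℕ, (φ.grad hμ s).toFock k = WhiteNoise.grad k (φ.toFock (k + 1)) s := by
  filter_upwards [grad_toFock φ] with s hs k
  have h : ∀ l : ℝ, 0 < l → normSq l (gradKernel φ s) < ∞ := fun l _ => by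
    obtain ⟨k, hk⟩ := exists_nat_ge l
    exact (normSq_mono hk _).trans_lt (hs k).2
  rw [(hs k).1, TestRV.grad, dif_pos h]
  rfl

/-! ### Lebesgue points -/

theorem memLp_window (θ t ε : ℝ) : MemLp (window θ t ε) 2 (volume : Measure ℝ) :=
  memLp_indicator_const 2 measurableSet_Icc _ (Or.inr (by simp))

/-- The window as an element of `L²(ℝ)`. -/
def windowLp (θ t ε : ℝ) : Lp ℝ 2 (volume : Measure ℝ) := (memLp_window θ t ε).toLp _

theorem coeFn_windowLp (θ t ε : ℝ) : windowLp θ t ε =ᵐ[volume] window θ t ε :=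
  (memLp_window θ t ε).coeFn_toLp

/-- The window is the ball of radius ε/2 about s + (1/2 - θ)ε. As θ ∈ [0, 1], it contains s, so
Lebesgue differentiation along off-centre balls applies. -/
theorem tendsto_avg_window {θ : ℝ} (hθ : θ ∈ Icc (0 : ℝ) 1) (G : Lp Fock 2 (volume : Measure ℝ)) :
    ∀ᵐ s : ℝ, Tendsto (fun ε => avg (windowLp θ s ε) G) (𝓝[>] 0) (𝓝 (G s)) := by
  have hG : LocallyIntegrable G volume := (Lp.memLp G).locallyIntegrable (by norm_num)
  filter_upwards [IsUnifLocDoublingMeasure.ae_tendsto_average volume hG 1] with s hs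
  have h1 := hs (l := 𝓝[>] (0 : ℝ)) (fun ε => s + (1 / 2 - θ) * ε) (fun ε => ε / 2) ?_ ?_
  · refine h1.congr' ?_
    filter_upwards [self_mem_nhdsWithin] with ε hε
    have hε : 0 < ε := hε
    have h2 : Metric.closedBall (s + (1 / 2 - θ) * ε) (ε / 2) =
        Icc (s - θ * ε) (s + (1 - θ) * ε) := by
      rw [Real.closedBall_eq_Icc]
      congr 1 <;> ring
    rw [h2, setAverage_eq, avg_apply, Real.volume_real_Icc,
      show s + (1 - θ) * ε - (s - θ * ε) = ε by ring, max_eq_left hε.le, ← integral_smul,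
      ← integral_indicator measurableSet_Icc]
    refine integral_congr_ae ?_
    filter_upwards [coeFn_windowLp θ s ε] with x hx
    rw [hx, window]
    by_cases hx' : x ∈ Icc (s - θ * ε) (s + (1 - θ) * ε) <;> simp [hx']
  · have : Tendsto (fun ε : ℝ => ε / 2) (𝓝 0) (𝓝 0) := by
      simpa using (tendsto_id (x := 𝓝 (0 : ℝ))).div_const 2
    refine tendsto_nhdsWithin_iff.2 ⟨this.mono_left nhdsWithin_le_nhds, ?_⟩
    filter_upwards [self_mem_nhdsWithin] with ε hε
    exact half_pos (mem_Ioi.1 hε)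
  · filter_upwards [self_mem_nhdsWithin] with ε hε
    have hε : 0 < ε := hε
    rw [Real.closedBall_eq_Icc]
    constructor
    · nlinarith [mul_nonneg hθ.1 hε.le, mul_le_mul_of_nonneg_right hθ.2 hε.le]
    · nlinarith [mul_nonneg hθ.1 hε.le, mul_le_mul_of_nonneg_right hθ.2 hε.le]

/-! ### The stochastic derivative of a product -/

theorem exists_nat_normSq_lt_top (Φ : GStar) : ∃ k : ℕ, 0 < k ∧ normSq (-(k : ℝ)) Φ.1 < ∞ := by
  obtain ⟨l, hl, h⟩ := Φ.2
  obtain ⟨k, hk⟩ := exists_nat_ge l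
  exact ⟨k, by exact_mod_cast hl.trans_le hk, (normSq_mono (neg_le_neg hk) _).trans_lt h⟩

/-- The dual Leibniz rule, paired with Φ. It is exact for every direction h, before any limit. -/
theorem dirDerivPairing_testMul (hμ : IsWhiteNoiseMeasure μ) {h : ℝ → ℝ}
    {H : Lp ℝ 2 (volume : Measure ℝ)} (hH : H =ᵐ[volume] h) {l : ℝ} (hl : 0 < l) {Φ : GStar}
    (hΦ : normSq (-l) Φ.1 < ∞) (φ ψ : TestRV μ) :
    dirDerivPairing h (testMul φ Φ) ψ = dirDerivPairing h Φ (TestRV.mul hμ φ ψ) +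
      inner ℝ (toFock (-l) Φ.1)
        (mulFock hμ hl.le (ψ.toFock (l + 1)) (dirGrad (l + 1) H (φ.toFock (l + 1 + 1)))) := by
  have hs : ∀ χ : TestRV μ, scale 1 (χ.toFock (l + 1 + 1)) = χ.toFock (l + 1) := fun χ => by
    have := χ.scale_toFock (le_add_of_nonneg_right zero_le_one : l + 1 ≤ l + 1 + 1)
    rwa [add_sub_cancel_left] at this
  have h1 := mulFock_adjoint_dirGrad hμ hl.le H (φ.toFock (l + 1 + 1)) (ψ.toFock (l + 1 + 1))
  rw [hs, hs] at h1
  rw [dirDerivPairing_eq hH (normSq_testMul_lt_top hμ hl φ hΦ), dirDerivPairing_eq hH hΦ,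
    toFock_testMul hμ hl φ hΦ, TestRV.toFock_mul hμ (add_nonneg hl.le zero_le_one),
    ← ContinuousLinearMap.adjoint_inner_right (dirGrad (-(l + 1 + 1)) H),
    ← ContinuousLinearMap.adjoint_inner_right (dirGrad (-(l + 1)) H), mulAdj,
    ContinuousLinearMap.adjoint_inner_left, h1, inner_add_right]

/-- The product rule for the stochastic derivative. -/
theorem hasStochDeriv_testMul (hμ : IsWhiteNoiseMeasure μ) {θ : ℝ} (hθ : θ ∈ Icc (0 : ℝ) 1)
    (φ : TestRV μ) :
    ∀ᵐ s : ℝ, ∀ K DK : GStar, HasStochDeriv μ θ s K DK →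
      HasStochDeriv μ θ s (testMul φ K) (testMul φ DK + testMul (φ.grad hμ s) K) := by
  -- The exceptional set is fixed here, before K is chosen. The level of K is unknown, so all
  -- natural levels are included.
  filter_upwards [TestRV.toFock_grad hμ φ, ae_all_iff.2 fun k : ℕ =>
    tendsto_avg_window hθ (grad ((k + 1 : ℕ) : ℝ) (φ.toFock (((k + 1 : ℕ) : ℝ) + 1)))]
    with s h1 h2 K DK hK ψ
  obtain ⟨k, hk, hKk⟩ := exists_nat_normSq_lt_top K
  have hk' : (0 : ℝ) < k := by exact_mod_cast hk
  have e : ∀ ε, dirDerivPairing (window θ s ε) (testMul φ K) ψ = _ := fun ε =>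
    dirDerivPairing_testMul hμ (coeFn_windowLp θ s ε) hk' hKk φ ψ
  simp only [e]
  rw [pairing_add, pairing_testMul hμ, pairing_testMul hμ]
  -- The first term converges by hypothesis, with test variable φψ; the second because s is a
  -- Lebesgue point of the gradient of φ.
  refine (hK _).add ?_
  rw [pairing_eq hKk, TestRV.toFock_mul hμ hk'.le, mulFock_comm]
  have h3 := h1 (k + 1)
  have h4 := h2 k
  push_cast at h3 h4
  rw [h3]
  exact tendsto_const_nhds.inner (((mulFock hμ hk'.le (ψ.toFock (k + 1))).continuous.tendsto _).comp h4)

end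

section

/-! ### Symmetrization -/

/-- Permutation of the variables of a kernel. -/
def permL2 {n : ℕ} (π : Equiv.Perm (Fin n)) : KernelL2 n →ₗᵢ[ℝ] KernelL2 n :=
  Lp.compMeasurePreservingₗᵢ ℝ _ (measurePreserving_perm π)

theorem coeFn_permL2 {n : ℕ} (π : Equiv.Perm (Fin n)) (F : KernelL2 n) :
    permL2 π F =ᵐ[volume] fun y => F fun i => y (π i) :=
  Lp.coeFn_compMeasurePreserving F (measurePreserving_perm π)

theorem mem_symL2_iff_permL2 {n : ℕ} {f : KernelL2 n} : f ∈ symL2 n ↔ ∀ π, permL2 π f = f :=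
  mem_symL2_iff

theorem permL2_permL2 {n : ℕ} (σ π : Equiv.Perm (Fin n)) (F : KernelL2 n) :
    permL2 σ (permL2 π F) = permL2 (σ * π) F := by
  ext1
  refine (coeFn_permL2 σ _).trans ?_
  refine ((measurePreserving_perm σ).quasiMeasurePreserving.ae_eq_comp (coeFn_permL2 π F)).trans ?_
  exact (coeFn_permL2 (σ * π) F).symm

/-- The symmetrization of a kernel. -/
def symmetrize {n : ℕ} (F : KernelL2 n) : KernelL2 n :=
  (n.factorial : ℝ)⁻¹ • ∑ π : Equiv.Perm (Fin n), permL2 π F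

theorem symmetrize_mem {n : ℕ} (F : KernelL2 n) : symmetrize F ∈ symL2 n := by
  refine mem_symL2_iff_permL2.2 fun σ => ?_
  rw [symmetrize, map_smul, map_sum]
  congr 1
  simp only [permL2_permL2]
  exact Equiv.sum_comp (Equiv.mulLeft σ) fun π => permL2 π F

theorem symProj_eq_symmetrize {n : ℕ} (F : KernelL2 n) : (symProj n F : KernelL2 n) = symmetrize F := by
  have h : symProj n F = ⟨symmetrize F, symmetrize_mem F⟩ := by
    refine ext_inner_right ℝ fun g => ?_
    have h1 : ∀ π, inner ℝ (permL2 π F) (g : KernelL2 n) = inner ℝ F (g : KernelL2 n) := fun π => by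
      conv_lhs => rw [← mem_symL2_iff_permL2.1 g.2 π]
      exact (permL2 π).inner_map_map _ _
    rw [inner_symProj, Submodule.coe_inner]
    change _ = inner ℝ ((n.factorial : ℝ)⁻¹ • ∑ π : Equiv.Perm (Fin n), permL2 π F) (g : KernelL2 n)
    rw [real_inner_smul_left, sum_inner]
    simp only [h1, Finset.sum_const, Finset.card_univ, Fintype.card_perm, Fintype.card_fin,
      nsmul_eq_mul]
    rw [inv_mul_cancel_left₀ (by positivity)]
  rw [h]

theorem coeFn_symProj {n : ℕ} (F : KernelL2 n) : (symProj n F : KernelL2 n) =ᵐ[volume]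
    fun y => (n.factorial : ℝ)⁻¹ * ∑ π : Equiv.Perm (Fin n), F fun i => y (π i) := by
  rw [symProj_eq_symmetrize]
  have h1 : (∑ π : Equiv.Perm (Fin n), permL2 π F : KernelL2 n) =ᵐ[volume]
      ∑ π : Equiv.Perm (Fin n), (permL2 π F : (Fin n → ℝ) → ℝ) := Lp.coeFn_finsetSum _ _
  filter_upwards [Lp.coeFn_smul (n.factorial : ℝ)⁻¹ (∑ π : Equiv.Perm (Fin n), permL2 π F), h1,
    ae_all_iff.2 fun π => coeFn_permL2 π F] with y h1 h2 h3
  rw [symmetrize, h1, Pi.smul_apply, h2, Finset.sum_apply, smul_eq_mul]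
  simp only [h3]

/-! ### The Skorohod integral -/

variable {μ : Measure TemperedDist}

/-- Almost all sections of F are prescribed, and a kernel is determined by its sections; the
symmetrization fixes the kernels of J. -/
theorem HasSkorohodIntegral.unique {Ψ Ψ' : ℝ → GStar} {t : ℝ} {J J' : GStar}
    (hΨ : ∀ᵐ s ∂(volume.restrict (Icc 0 t)), Ψ s = Ψ' s)
    (h : HasSkorohodIntegral Ψ t J) (h' : HasSkorohodIntegral Ψ' t J') : J = J' := by
  refine Subtype.ext (funext fun n => ?_)
  cases n with
  | zero => rw [h.1, h'.1]
  | succ n =>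
    obtain ⟨F, hF, hJ⟩ := h.2 n
    obtain ⟨F', hF', hJ'⟩ := h'.2 n
    have hFF : F = F' := by
      refine (kcurry n).injective (Lp.ext ?_)
      filter_upwards [coeFn_kcurry F, coeFn_kcurry F', hF, hF',
        (ae_restrict_iff' measurableSet_Icc).1 hΨ] with s h1 h2 h3 h4 h5
      ext1
      refine (h1.trans h3).trans ((h2.trans h4).trans (Eventually.of_forall fun x => ?_)).symm
      by_cases hs : s ∈ Icc 0 t
      · simp only [indicator_of_mem hs, h5 hs]
      · simp only [indicator_of_notMem hs]
    subst hFF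
    exact Subtype.ext (Lp.ext (hJ.trans hJ'.symm))

variable [IsProbabilityMeasure μ]

/-- Weakly measurable processes on `[0, t]` with a square-integrable norm `‖·‖_{-l}`. -/
def IsL2Process (μ : Measure TemperedDist) (Ψ : ℝ → GStar) (t l : ℝ) : Prop :=
  (∀ ψ : TestRV μ, AEMeasurable (fun s => pairing (Ψ s) ψ) (volume.restrict (Icc 0 t))) ∧
    ∫⁻ s in Icc 0 t, normSq (-l) (Ψ s).1 < ∞

/-- Testing with Iₙ(f) gives weak measurability of the n-th kernel, and Pettis' theorem makes it
strong. -/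
theorem IsL2Process.aestronglyMeasurable_kernel (hμ : IsWhiteNoiseMeasure μ) {Ψ : ℝ → GStar}
    {t l : ℝ} (h : IsL2Process μ Ψ t l) (n : ℕ) :
    AEStronglyMeasurable (fun s => (Ψ s).1 n) (volume.restrict (Icc 0 t)) := by
  refine aestronglyMeasurable_of_inner fun f => ?_
  have h1 := (h.1 (TestRV.single hμ n f)).const_mul (n.factorial : ℝ)⁻¹
  refine h1.congr (Eventually.of_forall fun s => ?_)
  simp only [pairing_single]
  rw [inv_mul_cancel_left₀ (by positivity), real_inner_comm]

theorem IsL2Process.ae_normSq_lt_top (hμ : IsWhiteNoiseMeasure μ) {Ψ : ℝ → GStar} {t l : ℝ}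
    (h : IsL2Process μ Ψ t l) :
    ∀ᵐ s ∂(volume.restrict (Icc 0 t)), normSq (-l) (Ψ s).1 < ∞ := by
  refine ae_lt_top' ?_ h.2.ne
  unfold normSq
  exact AEMeasurable.tsum fun n =>
    (((h.aestronglyMeasurable_kernel hμ n).norm.aemeasurable.pow_const 2).const_mul _).ennreal_ofReal

instance : TopologicalSpace.SeparableSpace Fock := by
  have h1 : TopologicalSpace.IsSeparable (⋃ n, range (fockSingle n)) :=
    TopologicalSpace.IsSeparable.iUnion fun n =>
      TopologicalSpace.isSeparable_range (fockSingle n).continuous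
  have h2 : TopologicalSpace.IsSeparable
      (closure (Submodule.span ℝ (⋃ n, range (fockSingle n)) : Set Fock)) := h1.span.closure
  refine TopologicalSpace.isSeparable_univ_iff.1 (h2.mono fun x _ => ?_)
  have h3 : HasSum (fun n => fockSingle n (x n)) x := lp.hasSum_single (by norm_num) x
  refine mem_closure_of_tendsto h3 (Eventually.of_forall fun s => ?_)
  exact Submodule.sum_mem _ fun n _ =>
    Submodule.subset_span (mem_iUnion.2 ⟨n, mem_range_self _⟩)

theorem IsL2Process.memLp (hμ : IsWhiteNoiseMeasure μ) {Ψ : ℝ → GStar} {t l : ℝ}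
    (h : IsL2Process μ Ψ t l) :
    MemLp ((Icc (0 : ℝ) t).indicator fun s => toFock (-l) (Ψ s).1) 2 volume := by
  rw [memLp_indicator_iff_restrict measurableSet_Icc]
  have h0 := h.ae_normSq_lt_top hμ
  have h1 : AEStronglyMeasurable (fun s => toFock (-l) (Ψ s).1) (volume.restrict (Icc 0 t)) := by
    refine aestronglyMeasurable_of_inner fun y => ?_
    refine aemeasurable_of_tendsto_metrizable_ae atTop
      (f := fun N s => ∑ n ∈ Finset.range N, inner ℝ (y n) (wt (-l) n • (Ψ s).1 n)) (fun N => ?_) ?_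
    · exact Finset.aemeasurable_fun_sum _ fun n _ =>
        (aestronglyMeasurable_const.inner
          ((h.aestronglyMeasurable_kernel hμ n).const_smul (wt (-l) n))).aemeasurable
    · filter_upwards [h0] with s hs
      have := (lp.hasSum_inner (𝕜 := ℝ) y (toFock (-l) (Ψ s).1)).tendsto_sum_nat
      refine this.congr fun N => Finset.sum_congr rfl fun n _ => ?_
      rw [toFock_apply hs]
  refine (memLp_two_iff_integrable_sq_norm h1).2 ⟨(h1.norm.pow 2), ?_⟩
  refine (lintegral_congr_ae ?_).trans_lt h.2
  filter_upwards [h0] with s hs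
  rw [normSq_eq_ofReal hs, Real.enorm_of_nonneg (sq_nonneg _)]

/-- The process as an element of `L²(ℝ; 𝒢_{-l})`. -/
def IsL2Process.toLp (hμ : IsWhiteNoiseMeasure μ) {Ψ : ℝ → GStar} {t l : ℝ}
    (h : IsL2Process μ Ψ t l) : Lp Fock 2 (volume : Measure ℝ) := (h.memLp hμ).toLp _

theorem IsL2Process.coeFn_toLp (hμ : IsWhiteNoiseMeasure μ) {Ψ : ℝ → GStar} {t l : ℝ}
    (h : IsL2Process μ Ψ t l) :
    h.toLp hμ =ᵐ[volume] (Icc (0 : ℝ) t).indicator fun s => toFock (-l) (Ψ s).1 :=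
  (h.memLp hμ).coeFn_toLp

theorem IsL2Process.toLp_apply (hμ : IsWhiteNoiseMeasure μ) {Ψ : ℝ → GStar} {t l : ℝ}
    (h : IsL2Process μ Ψ t l) (n : ℕ) :
    ∀ᵐ s : ℝ, (h.toLp hμ s) n = wt (-l) n • (Icc (0 : ℝ) t).indicator (fun s => (Ψ s).1 n) s := by
  filter_upwards [h.coeFn_toLp hμ, (ae_restrict_iff' measurableSet_Icc).1 (h.ae_normSq_lt_top hμ)]
    with s h1 h2
  rw [h1]
  by_cases hs : s ∈ Icc 0 t
  · rw [indicator_of_mem hs, indicator_of_mem hs, toFock_apply (h2 hs)]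
  · rw [indicator_of_notMem hs, indicator_of_notMem hs, smul_zero]; rfl

theorem fockSingle_apply_of_ne {n m : ℕ} (h : n ≠ m) (f : symL2 m) : fockSingle m f n = 0 :=
  fockEval_single_of_ne h f

theorem fockSingle_apply_self (n : ℕ) (f : symL2 n) : fockSingle n f n = f := fockEval_single n f

theorem grad_fockSingle_zero (l : ℝ) (f : symL2 0) : grad l (fockSingle 0 f) = 0 := by
  ext1
  filter_upwards [coeFn_grad l (fockSingle 0 f), Lp.coeFn_zero Fock 2 (volume : Measure ℝ),
    ae_all_iff.2 fun n => Lp.coeFn_zero (KernelL2 n) 2 (volume : Measure ℝ)] with s h1 h2 h3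
  ext n : 2
  rw [h1, h2, fockSingle_apply_of_ne n.succ_ne_zero, Submodule.coe_zero, map_zero, h3,
    Pi.zero_apply, map_zero, smul_zero]
  rfl

theorem grad_fockSingle_succ (l : ℝ) (n : ℕ) (f : symL2 (n + 1)) :
    ∀ᵐ s : ℝ, grad l (fockSingle (n + 1) f) s =
      fockSingle n (gradCoeff l n • symProj n (kcurry n f s)) := by
  filter_upwards [coeFn_grad l (fockSingle (n + 1) f),
    ae_all_iff.2 fun n => Lp.coeFn_zero (KernelL2 n) 2 (volume : Measure ℝ)] with s h1 h3
  ext m : 2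
  rw [h1]
  rcases eq_or_ne m n with rfl | hm
  · rw [fockSingle_apply_self, fockSingle_apply_self]
  · rw [fockSingle_apply_of_ne (by omega), fockSingle_apply_of_ne hm, Submodule.coe_zero, map_zero,
      h3, Pi.zero_apply, map_zero, smul_zero]

/-- The adjoint of f ↦ f(·, s) is symmetrization in all variables. The gradient maps level l + 1 to
level l, so its adjoint takes processes at level -l to level -(l + 1). -/
theorem hasSkorohodIntegral_ofFock (hμ : IsWhiteNoiseMeasure μ) {Ψ : ℝ → GStar} {t l : ℝ}
    (hl : 0 < l) (h : IsL2Process μ Ψ t l) :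
    HasSkorohodIntegral Ψ t (GStar.ofFock (add_pos hl one_pos)
      (ContinuousLinearMap.adjoint (grad l) (h.toLp hμ))) := by
  set G := h.toLp hμ with hG
  set z := ContinuousLinearMap.adjoint (grad l) G with hz
  have hzn : ∀ n (f : symL2 n), inner ℝ (z n) f = inner ℝ G (grad l (fockSingle n f)) := by
    intro n f
    rw [← ContinuousLinearMap.adjoint_inner_left, ← hz, real_inner_comm, ← inner_fockSingle,
      real_inner_comm]
  constructor
  · change (wt (-(l + 1)) 0)⁻¹ • z 0 = 0
    refine smul_eq_zero_of_right _ (ext_inner_right ℝ fun f => ?_)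
    rw [hzn, grad_fockSingle_zero, inner_zero_right, inner_zero_left]
  · intro n
    obtain ⟨F, hF⟩ := kcurry_surjective n
      (((wt (-l) n)⁻¹ • ((symL2 n).subtypeL ∘L fockEval n)).compLp G)
    have hFs : ∀ᵐ s : ℝ, kcurry n F s = (wt (-l) n)⁻¹ • (G s n : KernelL2 n) := by
      rw [hF]
      exact ContinuousLinearMap.coeFn_compLp _ G
    have hz1 : z (n + 1) = wt (-(l + 1)) (n + 1) • symProj (n + 1) F := by
      refine ext_inner_right ℝ fun f => ?_
      rw [hzn, symL2_inner_smul_left, inner_symProj, ← (kcurry n).inner_map_map, L2.inner_def,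
        L2.inner_def, ← integral_const_mul]
      refine integral_congr_ae ?_
      filter_upwards [hFs, grad_fockSingle_succ l n f] with s h1 h2
      -- The weights of the two dual levels absorb the gradient coefficient because (n + 1)! = (n +
      -- 1) n!.
      have h3 : wt (-(l + 1)) (n + 1) * (wt (-l) n)⁻¹ = gradCoeff l n := by
        have e1 := wt_mul_neg (l + 1) (n + 1)
        have e2 := wt_mul_neg l n
        have e3 := gradCoeff_mul l n
        have p1 := (wt_pos (l + 1) (n + 1)).ne'
        have p2 := (wt_pos (-l) n).ne'
        rw [← div_eq_mul_inv, div_eq_iff p2]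
        refine mul_right_cancel₀ p1 ?_
        rw [e1, mul_right_comm, e3, mul_assoc, mul_comm (wt l n), e2, Nat.factorial_succ]
        push_cast
        ring
      rw [h1, h2, real_inner_comm, inner_fockSingle, symL2_inner_smul_left, inner_symProj,
        real_inner_smul_left, ← mul_assoc, h3, real_inner_comm]
    refine ⟨F, ?_, ?_⟩
    · filter_upwards [hFs, coeFn_kcurry F, h.toLp_apply hμ n] with s h1 h2 h3
      refine h2.symm.trans ?_
      rw [h1, h3, Submodule.coe_smul, smul_smul, inv_mul_cancel₀ (wt_pos _ _).ne', one_smul]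
      by_cases hs : s ∈ Icc 0 t
      · simp only [indicator_of_mem hs]; rfl
      · simp only [indicator_of_notMem hs]
        exact Lp.coeFn_zero _ _ _
    · have h4 : (GStar.ofFock (add_pos hl one_pos) z).1 (n + 1) = symProj (n + 1) F := by
        change (wt (-(l + 1)) (n + 1))⁻¹ • z (n + 1) = _
        rw [hz1, smul_smul, inv_mul_cancel₀ (wt_pos _ _).ne', one_smul]
      rw [h4]
      exact coeFn_symProj F

/-- The Skorohod integral is the adjoint of the gradient. -/
theorem HasSkorohodIntegral.pairing_eq (hμ : IsWhiteNoiseMeasure μ) {Ψ : ℝ → GStar} {t l : ℝ}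
    (hl : 0 < l) (h : IsL2Process μ Ψ t l) {J : GStar} (hJ : HasSkorohodIntegral Ψ t J)
    (χ : TestRV μ) :
    pairing J χ = ∫ s, inner ℝ (h.toLp hμ s) (grad l (χ.toFock (l + 1)) s) := by
  rw [hJ.unique (Eventually.of_forall fun _ => rfl) (hasSkorohodIntegral_ofFock hμ hl h),
    WhiteNoise.pairing_eq (GStar.normSq_ofFock _ _), GStar.toFock_ofFock,
    ContinuousLinearMap.adjoint_inner_left, L2.inner_def]

end

section

/-! ### The Skorohod integral of a product -/

variable {μ : Measure TemperedDist} [IsProbabilityMeasure μ]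

theorem IsL2Process.mono {Ψ : ℝ → GStar} {t l l' : ℝ} (h : IsL2Process μ Ψ t l) (hl : l ≤ l') :
    IsL2Process μ Ψ t l' :=
  ⟨h.1, (lintegral_mono fun _ => normSq_mono (neg_le_neg hl) _).trans_lt h.2⟩

theorem IsL2Process.testMul (hμ : IsWhiteNoiseMeasure μ) {Ψ : ℝ → GStar} {t l : ℝ} (hl : 0 < l)
    (h : IsL2Process μ Ψ t l) (φ : TestRV μ) :
    IsL2Process μ (fun s => WhiteNoise.testMul φ (Ψ s)) t (l + 1) := by
  refine ⟨fun ψ => ?_, ?_⟩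
  · simp only [pairing_testMul hμ]
    exact h.1 _
  · refine (lintegral_mono_ae ?_).trans_lt
      (show ∫⁻ s in Icc 0 t, ENNReal.ofReal (‖mulAdj hμ hl.le φ‖ ^ 2) * normSq (-l) (Ψ s).1 < ∞ from ?_)
    · filter_upwards [h.ae_normSq_lt_top hμ] with s hs
      exact normSq_testMul_le hμ hl φ hs
    · rw [lintegral_const_mul' _ _ ENNReal.ofReal_ne_top]
      exact ENNReal.mul_lt_top ENNReal.ofReal_lt_top h.2

theorem TestRV.scale_one_toFock (χ : TestRV μ) (l : ℝ) :
    scale 1 (χ.toFock (l + 1)) = χ.toFock l := by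
  have := χ.scale_toFock (le_add_of_nonneg_right zero_le_one : l ≤ l + 1)
  rwa [add_sub_cancel_left] at this

/-- `φ · ∫ Ψ δB = ∫ φ · Ψ δB + ∫ D_s φ · Ψ(s) ds`. -/
theorem HasSkorohodIntegral.testMul (hμ : IsWhiteNoiseMeasure μ) {Ψ : ℝ → GStar} {t : ℝ} {k : ℕ}
    (hk : 0 < k) (h : IsL2Process μ Ψ t k) {J : GStar} (hJ : HasSkorohodIntegral Ψ t J)
    (φ : TestRV μ) :
    ∃ J' R : GStar, HasSkorohodIntegral (fun s => WhiteNoise.testMul φ (Ψ s)) t J' ∧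
      HasPettisIntegral μ (fun s => WhiteNoise.testMul (φ.grad hμ s) (Ψ s)) t R ∧
      WhiteNoise.testMul φ J = J' + R := by
  have hk' : (0 : ℝ) < k := by exact_mod_cast hk
  have h' := h.testMul hμ hk' φ
  have hJ' := hasSkorohodIntegral_ofFock hμ (add_pos hk' one_pos) h'
  set J' := GStar.ofFock (add_pos (add_pos hk' one_pos) one_pos)
    (ContinuousLinearMap.adjoint (grad ((k : ℝ) + 1)) (h'.toLp hμ)) with hJdef
  -- R is defined as the difference φ·J - J'; what remains is to identify it as a Pettis integral.
  refine ⟨J', WhiteNoise.testMul φ J - J', hJ', fun ψ => ?_, (add_sub_cancel _ _).symm⟩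
  have hi1 : Integrable fun s => (inner ℝ (h.toLp hμ s)
      (grad k ((TestRV.mul hμ φ ψ).toFock (k + 1)) s) : ℝ) := L2.integrable_inner (𝕜 := ℝ) _ _
  have hi2 : Integrable fun s => (inner ℝ (h'.toLp hμ s)
      (grad ((k : ℝ) + 1) (ψ.toFock (k + 1 + 1)) s) : ℝ) := L2.integrable_inner (𝕜 := ℝ) _ _
  -- Paired with ψ, φ·J gives ∫ (Ψ, D(φψ)) and J' gives ∫ (φ·Ψ, Dψ). By the Leibniz rule the
  -- integrands differ by (Ψ, ψ D_sφ), which is the pairing of D_sφ·Ψ with ψ.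
  have key : (fun s => (inner ℝ (h.toLp hμ s)
      (grad k ((TestRV.mul hμ φ ψ).toFock (k + 1)) s) : ℝ) - inner ℝ (h'.toLp hμ s)
      (grad ((k : ℝ) + 1) (ψ.toFock (k + 1 + 1)) s)) =ᵐ[volume]
      (Icc (0 : ℝ) t).indicator
        fun s => pairing (WhiteNoise.testMul (φ.grad hμ s) (Ψ s)) ψ := by
    filter_upwards [h.coeFn_toLp hμ, h'.coeFn_toLp hμ,
      grad_mulFock hμ hk'.le (φ.toFock (k + 1 + 1)) (ψ.toFock (k + 1 + 1)),
      TestRV.toFock_grad hμ φ,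
      (ae_restrict_iff' measurableSet_Icc).1 (h.ae_normSq_lt_top hμ)] with s h1 h2 h3 h4 h5
    rw [h1, h2]
    by_cases hs : s ∈ Icc 0 t
    · have h6 := h4 (k + 1)
      push_cast at h6
      rw [indicator_of_mem hs, indicator_of_mem hs, indicator_of_mem hs, pairing_testMul hμ,
        WhiteNoise.pairing_eq (h5 hs), TestRV.toFock_mul hμ (add_nonneg hk'.le zero_le_one), h3,
        toFock_testMul hμ hk' φ (h5 hs), mulAdj, ContinuousLinearMap.adjoint_inner_left,
        TestRV.scale_one_toFock, TestRV.scale_one_toFock, inner_add_right, add_sub_cancel_left,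
        TestRV.toFock_mul hμ hk'.le, h6, mulFock_comm]
    · simp only [indicator_of_notMem hs, inner_zero_left, sub_zero]
  refine ⟨(integrable_indicator_iff measurableSet_Icc).1 ((hi1.sub hi2).congr key), ?_⟩
  rw [pairing_sub, pairing_testMul hμ, hJ.pairing_eq hμ hk' h, hJ'.pairing_eq hμ (add_pos hk' one_pos) h',
    ← integral_sub hi1 hi2, ← integral_indicator measurableSet_Icc]
  exact integral_congr_ae key

/-! ### Pettis integrals and the kernel operator -/

theorem HasPettisIntegral.unique (hμ : IsWhiteNoiseMeasure μ) {Ψ Ψ' : ℝ → GStar} {t : ℝ}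
    {P P' : GStar} (hΨ : ∀ᵐ s ∂(volume.restrict (Icc 0 t)), Ψ s = Ψ' s)
    (h : HasPettisIntegral μ Ψ t P) (h' : HasPettisIntegral μ Ψ' t P') : P = P' :=
  pairing_ext hμ fun ψ => by
    rw [(h ψ).2, (h' ψ).2]
    refine integral_congr_ae ?_
    filter_upwards [hΨ] with s hs
    rw [hs]

theorem HasPettisIntegral.add {Ψ Ψ' : ℝ → GStar} {t : ℝ} {P P' : GStar}
    (h : HasPettisIntegral μ Ψ t P) (h' : HasPettisIntegral μ Ψ' t P') :
    HasPettisIntegral μ (fun s => Ψ s + Ψ' s) t (P + P') := fun ψ => by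
  simp only [pairing_add]
  exact ⟨(h ψ).1.add (h' ψ).1, by rw [(h ψ).2, (h' ψ).2, integral_add (h ψ).1 (h' ψ).1]⟩

theorem HasPettisIntegral.testMul (hμ : IsWhiteNoiseMeasure μ) {Ψ : ℝ → GStar} {t : ℝ} {P : GStar}
    (h : HasPettisIntegral μ Ψ t P) (φ : TestRV μ) :
    HasPettisIntegral μ (fun s => WhiteNoise.testMul φ (Ψ s)) t (WhiteNoise.testMul φ P) :=
  fun ψ => by
    simp only [pairing_testMul hμ]
    exact h _

theorem HasKernelOp.unique (hμ : IsWhiteNoiseMeasure μ) {g : ℝ → ℝ → ℝ} {Φ : ℝ → GStar} {t s : ℝ}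
    {K K' : GStar} (h : HasKernelOp μ g Φ t s K) (h' : HasKernelOp μ g Φ t s K') : K = K' := by
  obtain ⟨I, hI, rfl⟩ := h
  obtain ⟨I', hI', rfl⟩ := h'
  rw [pairing_ext hμ fun ψ => ((hI.2 ψ).2).trans ((hI'.2 ψ).2).symm]

/-- All conditions are imposed for every ψ, so replacing ψ by φψ proves them for the product; no
norm estimate enters. -/
theorem HasKernelOp.testMul (hμ : IsWhiteNoiseMeasure μ) {g : ℝ → ℝ → ℝ} {Φ : ℝ → GStar} {t s : ℝ}
    {K : GStar} (h : HasKernelOp μ g Φ t s K) (φ : TestRV μ) :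
    HasKernelOp μ g (fun u => WhiteNoise.testMul φ (Φ u)) t s (WhiteNoise.testMul φ K) := by
  obtain ⟨I, hI, rfl⟩ := h
  refine ⟨WhiteNoise.testMul φ I, ⟨hI.1, fun ψ => ?_⟩, ?_⟩
  · simp only [← testMul_sub hμ, pairing_testMul hμ]
    exact hI.2 _
  · rw [testMul_add hμ, testMul_smul hμ]

theorem HasStochDeriv.unique (hμ : IsWhiteNoiseMeasure μ) {θ s : ℝ} {K D D' : GStar}
    (h : HasStochDeriv μ θ s K D) (h' : HasStochDeriv μ θ s K D') : D = D' :=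
  pairing_ext hμ fun ψ => tendsto_nhds_unique (h ψ) (h' ψ)

/-! ### The Volterra integral -/

/-- Each ingredient is determined almost everywhere or by its pairings, so the value chosen in
`volterraIntegral` is the only one possible. -/
theorem HasVolterraIntegral.unique (hμ : IsWhiteNoiseMeasure μ) {θ : ℝ} {g : ℝ → ℝ → ℝ}
    {m : ℝ → GStar → GStar} {Φ : ℝ → GStar} {t : ℝ} {I I' : GStar}
    (h : HasVolterraIntegral μ θ g m Φ t I) (h' : HasVolterraIntegral μ θ g m Φ t I') :
    I = I' := by
  obtain ⟨K, DK, J, P, hK, hDK, _, _, hJ, hP, rfl⟩ := h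
  obtain ⟨K', DK', J', P', hK', hDK', _, _, hJ', hP', rfl⟩ := h'
  have h1 : ∀ᵐ s ∂(volume.restrict (Icc 0 t)), K s = K' s := by
    filter_upwards [hK, hK'] with s h1 h2 using h1.unique hμ h2
  have h2 : ∀ᵐ s ∂(volume.restrict (Icc 0 t)), DK s = DK' s := by
    filter_upwards [h1, hDK, hDK'] with s h1 h2 h3
    rw [h1] at h2
    exact h2.unique hμ h3
  rw [hJ.unique (by filter_upwards [h1] with s hs; rw [hs]) hJ',
    hP.unique hμ (by filter_upwards [h2] with s hs; rw [hs]) hP']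

theorem volterraIntegral_eq (hμ : IsWhiteNoiseMeasure μ) {θ : ℝ} {g : ℝ → ℝ → ℝ}
    {m : ℝ → GStar → GStar} {Φ : ℝ → GStar} {t : ℝ} {I : GStar}
    (h : HasVolterraIntegral μ θ g m Φ t I) : volterraIntegral μ θ g m Φ t = I := by
  have h' : ∃ I, HasVolterraIntegral μ θ g m Φ t I := ⟨I, h⟩
  rw [volterraIntegral, dif_pos h']
  exact h'.choose_spec.unique hμ h

/-- Commutation of m(s) with every test variable is needed, since besides φ the variables D_sφ
occur. -/
theorem HasVolterraIntegral.testMul (hμ : IsWhiteNoiseMeasure μ) {θ : ℝ}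
    (hθ : θ ∈ Icc (0 : ℝ) 1) {g : ℝ → ℝ → ℝ} {m : ℝ → GStar → GStar}
    (hm_add : ∀ s Φ Ψ, m s (Φ + Ψ) = m s Φ + m s Ψ)
    (hm_mul : ∀ s (χ : TestRV μ) Φ, m s (WhiteNoise.testMul χ Φ) = WhiteNoise.testMul χ (m s Φ))
    {Φ : ℝ → GStar} {t : ℝ} {I : GStar} (h : HasVolterraIntegral μ θ g m Φ t I) (φ : TestRV μ) :
    HasVolterraIntegral μ θ g m (fun s => WhiteNoise.testMul φ (Φ s)) t
      (WhiteNoise.testMul φ I) := by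
  obtain ⟨K, DK, J, P, hK, hDK, hmeas, ⟨l, hl, hint⟩, hJ, hP, rfl⟩ := h
  obtain ⟨k, hk⟩ := exists_nat_ge l
  have hk0 : (0 : ℝ) < k := hl.trans_le hk
  have hproc : IsL2Process μ (fun s => m s (K s)) t k :=
    IsL2Process.mono (l := l) ⟨hmeas, hint⟩ hk
  have hproc' := hproc.testMul hμ hk0 φ
  obtain ⟨J', R, hJ', hR, hJR⟩ := hJ.testMul hμ (by exact_mod_cast hk0) hproc φ
  -- With φ·J = J' + R, the Skorohod part becomes J' and loses R, while the product rule adds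
  -- exactly R to the Pettis part φ·P.
  refine ⟨fun s => WhiteNoise.testMul φ (K s),
    fun s => WhiteNoise.testMul φ (DK s) + WhiteNoise.testMul (φ.grad hμ s) (K s),
    J', WhiteNoise.testMul φ P + R, ?_, ?_, ?_, ⟨k + 1, by positivity, ?_⟩, ?_, ?_, ?_⟩
  · filter_upwards [hK] with s hs using hs.testMul hμ φ
  · filter_upwards [hDK, ae_restrict_of_ae (hasStochDeriv_testMul hμ hθ φ)] with s h1 h2
    exact h2 _ _ h1
  · simp only [hm_mul]
    exact hproc'.1
  · simp only [hm_mul]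
    exact hproc'.2
  · simp only [hm_mul]
    exact hJ'
  -- The integrand is m(s) applied to φ·DK + D_sφ·K, that is φ·m(DK) + D_sφ·m(K), with integrals φ·P
  -- and R.
  · simp only [hm_add, hm_mul]
    exact (hP.testMul hμ φ).add hR
  · rw [testMul_add hμ, hJR]
    abel

theorem volterraIntegral_testMul (hμ : IsWhiteNoiseMeasure μ) {θ : ℝ}
    (hθ : θ ∈ Icc (0 : ℝ) 1) {g : ℝ → ℝ → ℝ} {m : ℝ → GStar → GStar}
    (hm_add : ∀ s Φ Ψ, m s (Φ + Ψ) = m s Φ + m s Ψ)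
    (hm_mul : ∀ s (χ : TestRV μ) Φ, m s (WhiteNoise.testMul χ Φ) = WhiteNoise.testMul χ (m s Φ))
    {Φ : ℝ → GStar} {T : ℝ} (φ : TestRV μ) (h : VolterraIntegrable μ θ g m Φ T) :
    VolterraIntegrable μ θ g m (fun s => WhiteNoise.testMul φ (Φ s)) T ∧
      ∀ t ∈ Icc 0 T, volterraIntegral μ θ g m (fun s => WhiteNoise.testMul φ (Φ s)) t =
        WhiteNoise.testMul φ (volterraIntegral μ θ g m Φ t) := by
  refine ⟨fun t ht => ?_, fun t ht => ?_⟩ <;> obtain ⟨I, hI⟩ := h t ht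
  · exact ⟨_, hI.testMul hμ hθ hm_add hm_mul φ⟩
  · rw [volterraIntegral_eq hμ hI, volterraIntegral_eq hμ (hI.testMul hμ hθ hm_add hm_mul φ)]

end

end WhiteNoise

end

theorem mainTheorem12 (μ : Measure TemperedDist) [IsProbabilityMeasure μ]
    (hμ : IsWhiteNoiseMeasure μ) (θ : ℝ) (hθ : θ ∈ Icc (0 : ℝ) 1)
    (g : ℝ → ℝ → ℝ) (σ : ℝ → TestRV μ) (T : ℝ) (Φ : ℝ → GStar) (φ : TestRV μ) :
    (IntegrableX1 μ θ g Φ T →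
      IntegrableX1 μ θ g (fun s => testMul φ (Φ s)) T ∧
      ∀ t ∈ Icc 0 T,
        integralX1 μ θ g (fun s => testMul φ (Φ s)) t = testMul φ (integralX1 μ θ g Φ t)) ∧
    (IntegrableXσ μ θ g σ Φ T →
      IntegrableXσ μ θ g σ (fun s => testMul φ (Φ s)) T ∧
      ∀ t ∈ Icc 0 T,
        integralXσ μ θ g σ (fun s => testMul φ (Φ s)) t =
          testMul φ (integralXσ μ θ g σ Φ t)) := by
  -- The modulation is the identity for X₁ and multiplication by σ(s) for X_σ; in the second case
  -- commutativity of the pointwise product supplies the commutation.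
  exact ⟨volterraIntegral_testMul hμ hθ (fun _ _ _ => rfl) (fun _ _ _ => rfl) φ,
    volterraIntegral_testMul hμ hθ (fun s => testMul_add hμ (σ s))
      (fun s χ Φ => testMul_comm hμ (σ s) χ Φ) φ⟩
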